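/- Let $k$ be an algebraically closed field and let $Q$ be a Dynkin quiver of type $\mathbb{A}$, i.e. a quiver with vertices $v_1,\dots,v_n$ ($n \ge 1$) that has exactly one arrow, in one of the two possible directions, between $v_i$ and $v_{i+1}$ for each $1 \le i < n$, and no other arrows. Let $B = kQ$ be its path algebra, and let $\operatorname{Aut}_k(B)$ be the group of $k$-algebra automorphisms of $B$. Recall that every maximal (proper, unital) $k$-subalgebra $A$ of $B$ is a basic algebra; its Ext quiver has as vertices a complete set $\{e_1,\dots,e_m\}$ of primitive orthogonal idempotents of $A$, and $\dim_k e_i\,(J(A)/J(A)^2)\,e_j$ arrows from $e_i$ to $e_j$, where $J(A)$ is the Jacobson radical of $A$ (up to isomorphism this does not depend on the chosen idempotents). It is called connected if its underlying graph is connected. Let $A$ and $A'$ be maximal $k$-subalgebras of $B$ whose Ext quivers are both connected. Then there is $\varphi \in \operatorname{Aut}_k(B)$ with $\varphi(A) = A'$ if and only if $A$ and $A'$ are isomorphic as $k$-algebras. -/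

import Mathlib

universe u v w

noncomputable section

section PathAlgebra

/-- The set of all paths of a quiver, including the trivial path at every vertex: a path together
with its source and its target. -/
abbrev AllPaths (V : Type u) [Quiver.{v} V] : Type (max u v) := Σ a b : V, Quiver.Path a b

/-- The path algebra `kQ` of a quiver `Q` with vertex set `V`: the `k`-vector space with basis the
set of all paths. -/
def PathAlgebra (k : Type w) (V : Type u) [Quiver.{v} V] [Field k] : Type (max u v w) :=
  AllPaths V →₀ k

namespace PathAlgebra

variable (k : Type w) (V : Type u) [Quiver.{v} V] [Field k]

instance : AddCommGroup (PathAlgebra k V) := inferInstanceAs (AddCommGroup (AllPaths V →₀ k))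

instance : Module k (PathAlgebra k V) := inferInstanceAs (Module k (AllPaths V →₀ k))

variable {V}

/-- The basis vector of the path algebra given by a path. -/
def ofPath {a b : V} (p : Quiver.Path a b) : PathAlgebra k V :=
  Finsupp.single (⟨a, b, p⟩ : AllPaths V) (1 : k)

open Classical in
/-- The product of two paths: `p` followed by `q` if `p` ends where `q` starts, zero otherwise. -/
def pathMul (p q : AllPaths V) : PathAlgebra k V :=
  if h : p.2.1 = q.1 then ofPath k (p.2.2.comp (q.2.2.cast h.symm rfl)) else 0

variable (V) in
/-- The multiplication of the path algebra: the bilinear extension of the product of paths. -/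
def mulLinear : PathAlgebra k V →ₗ[k] PathAlgebra k V →ₗ[k] PathAlgebra k V :=
  Finsupp.linearCombination k fun p : AllPaths V =>
    Finsupp.linearCombination k fun q : AllPaths V => pathMul k p q

instance : Mul (PathAlgebra k V) := ⟨fun x y => mulLinear k V x y⟩

/-- The identity is the sum of the trivial paths. -/
instance [Fintype V] : One (PathAlgebra k V) :=
  ⟨∑ a : V, ofPath k (Quiver.Path.nil : Quiver.Path a a)⟩

theorem mul_def (x y : PathAlgebra k V) : x * y = mulLinear k V x y := rfl

theorem one_def [Fintype V] :
    (1 : PathAlgebra k V) = ∑ a : V, ofPath k (Quiver.Path.nil : Quiver.Path a a) := rfl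

theorem ofPath_mul_ofPath_eq {a b c d : V} (p : Quiver.Path a b) (q : Quiver.Path c d) :
    ofPath k p * ofPath k q = pathMul k ⟨a, b, p⟩ ⟨c, d, q⟩ := by
  have h1 : mulLinear k V (ofPath k p) =
      (1 : k) • Finsupp.linearCombination k fun q : AllPaths V => pathMul k ⟨a, b, p⟩ q :=
    Finsupp.linearCombination_single _ _ _
  rw [mul_def, h1, one_smul]
  exact (Finsupp.linearCombination_single _ _ _).trans (one_smul _ _)

theorem ofPath_mul_ofPath {a b c : V} (p : Quiver.Path a b) (q : Quiver.Path b c) :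
    ofPath k p * ofPath k q = ofPath k (p.comp q) := by
  rw [ofPath_mul_ofPath_eq, pathMul, dif_pos rfl]
  rfl

theorem ofPath_mul_ofPath_of_ne {a b c d : V} (p : Quiver.Path a b) (q : Quiver.Path c d) (h : b ≠ c) :
    ofPath k p * ofPath k q = 0 := by
  rw [ofPath_mul_ofPath_eq, pathMul, dif_neg h]

variable {k} in
@[elab_as_elim]
theorem induction_on {P : PathAlgebra k V → Prop} (x : PathAlgebra k V) (h0 : P 0)
    (hadd : ∀ x y, P x → P y → P (x + y))
    (hsmul : ∀ (r : k) {a b : V} (p : Quiver.Path a b), P (r • ofPath k p)) : P x := by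
  refine Finsupp.induction_linear (motive := P) x h0 hadd fun p r => ?_
  have h : r • ofPath k p.2.2 = (Finsupp.single p r : AllPaths V →₀ k) :=
    (Finsupp.smul_single r _ _).trans (by rw [smul_eq_mul, mul_one])
  exact h ▸ hsmul r p.2.2

instance : NonUnitalNonAssocRing (PathAlgebra k V) where
  left_distrib x y z := map_add (mulLinear k V x) y z
  right_distrib x y z := LinearMap.map_add₂ (mulLinear k V) x y z
  zero_mul x := LinearMap.map_zero₂ (mulLinear k V) x
  mul_zero x := map_zero (mulLinear k V x)

theorem smul_mul (r : k) (x y : PathAlgebra k V) : (r • x) * y = r • (x * y) :=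
  LinearMap.map_smul₂ (mulLinear k V) r x y

theorem mul_smul' (r : k) (x y : PathAlgebra k V) : x * (r • y) = r • (x * y) :=
  map_smul (mulLinear k V x) r y

theorem mul_assoc' (x y z : PathAlgebra k V) : x * y * z = x * (y * z) := by
  induction x using induction_on with
  | h0 => simp only [zero_mul]
  | hadd x x' hx hx' => simp only [add_mul, hx, hx']
  | hsmul r p =>
  induction y using induction_on with
  | h0 => simp only [zero_mul, mul_zero]
  | hadd y y' hy hy' => simp only [add_mul, mul_add, hy, hy']
  | hsmul s q =>
  induction z using induction_on with
  | h0 => simp only [mul_zero]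
  | hadd z z' hz hz' => simp only [mul_add, hz, hz']
  | @hsmul t e f w =>
    rename_i a b c d
    simp only [smul_mul, mul_smul']
    congr 3
    by_cases h1 : b = c
    · subst h1
      by_cases h2 : d = e
      · subst h2
        simp only [ofPath_mul_ofPath, Quiver.Path.comp_assoc]
      · simp only [ofPath_mul_ofPath, ofPath_mul_ofPath_of_ne k _ _ h2, mul_zero]
    · by_cases h2 : d = e
      · subst h2
        simp only [ofPath_mul_ofPath, ofPath_mul_ofPath_of_ne k _ _ h1, zero_mul]
      · simp only [ofPath_mul_ofPath_of_ne k _ _ h1, ofPath_mul_ofPath_of_ne k _ _ h2, zero_mul,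
          mul_zero]

theorem one_mul' [Fintype V] (x : PathAlgebra k V) : 1 * x = x := by
  induction x using induction_on with
  | h0 => exact mul_zero _
  | hadd x y hx hy => rw [mul_add, hx, hy]
  | @hsmul r a b p =>
    rw [mul_smul', one_def, Finset.sum_mul, Finset.sum_eq_single a, ofPath_mul_ofPath,
      Quiver.Path.nil_comp]
    · exact fun c _ hc => ofPath_mul_ofPath_of_ne k _ _ hc
    · exact fun h => absurd (Finset.mem_univ a) h

theorem mul_one' [Fintype V] (x : PathAlgebra k V) : x * 1 = x := by
  induction x using induction_on with
  | h0 => exact zero_mul _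
  | hadd x y hx hy => rw [add_mul, hx, hy]
  | @hsmul r a b p =>
    rw [smul_mul, one_def, Finset.mul_sum, Finset.sum_eq_single b, ofPath_mul_ofPath,
      Quiver.Path.comp_nil]
    · exact fun c _ hc => ofPath_mul_ofPath_of_ne k _ _ hc.symm
    · exact fun h => absurd (Finset.mem_univ b) h

instance [Fintype V] : Ring (PathAlgebra k V) where
  __ := (inferInstance : NonUnitalNonAssocRing (PathAlgebra k V))
  mul_assoc := mul_assoc' k
  one_mul := one_mul' k
  mul_one := mul_one' k

instance [Fintype V] : Algebra k (PathAlgebra k V) :=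
  Algebra.ofModule (smul_mul k) (fun r x y => mul_smul' k r x y)

end PathAlgebra

end PathAlgebra

section QuiverNotions

/-- A quiver is connected if it is nonempty and any two vertices are joined by a walk that may
traverse arrows in either direction. -/
def IsConnectedQuiver (V : Type u) [Quiver.{v} V] : Prop :=
  Nonempty V ∧ ∀ a b : V, Nonempty (@Quiver.Path (Quiver.Symmetrify V) _ a b)

/-- A quiver is a Dynkin quiver of type `A` if its vertices can be numbered `0, …, n` such that
there is exactly one arrow, in one of the two directions, between consecutive vertices, and there
are no other arrows. -/
def IsDynkinTypeA (V : Type u) [Quiver.{v} V] : Prop :=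
  ∃ (n : ℕ) (e : V ≃ Fin (n + 1)), ∀ a b : V,
    Subsingleton ((a ⟶ b) ⊕ (b ⟶ a)) ∧
    (Nonempty ((a ⟶ b) ⊕ (b ⟶ a)) ↔
      (e a : ℕ) + 1 = (e b : ℕ) ∨ (e b : ℕ) + 1 = (e a : ℕ))

end QuiverNotions

section ExtQuiver

/-- An idempotent is primitive if it is nonzero and is not the sum of two nonzero orthogonal
idempotents. -/
def IsPrimitiveIdempotent {A : Type u} [Ring A] (e : A) : Prop :=
  IsIdempotentElem e ∧ e ≠ 0 ∧
    ∀ f g : A, IsIdempotentElem f → IsIdempotentElem g → f * g = 0 → g * f = 0 → e = f + g →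
      f = 0 ∨ g = 0

/-- The Jacobson radical `J` of a `k`-algebra, as a `k`-subspace. -/
def radicalSubspace (k : Type w) (A : Type u) [Field k] [Ring A] [Algebra k A] : Submodule k A :=
  (Ring.jacobson A).restrictScalars k

/-- The number `dim_k e (J / J²) f`, where `e (J / J²) f` is the image of `e J f` in `A / J²`. -/
def extArrowCount (k : Type w) {A : Type u} [Field k] [Ring A] [Algebra k A] (e f : A) : ℕ :=
  Module.finrank k
    (((radicalSubspace k A).map (LinearMap.mulLeftRight k (e, f))).map
      (radicalSubspace k A * radicalSubspace k A).mkQ)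

/-- The vertex set of the Ext quiver of a finite-dimensional basic algebra, computed from a complete
family `e` of primitive orthogonal idempotents: the members of the family. -/
def ExtQuiver (_k : Type w) {A : Type u} {ι : Type v} (_e : ι → A) : Type v := ι

/-- There are `dim_k e_i (J / J²) e_j` arrows from the vertex `i` to the vertex `j`. -/
instance (k : Type w) {A : Type u} {ι : Type v} [Field k] [Ring A] [Algebra k A] (e : ι → A) :
    Quiver.{0} (ExtQuiver k e) :=
  ⟨fun i j : ι => Fin (extArrowCount k (e i) (e j))⟩

/-- A finite-dimensional basic algebra has a connected Ext quiver. Up to isomorphism the Ext quiver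
does not depend on the complete family of primitive orthogonal idempotents. -/
def HasConnectedExtQuiver (k : Type w) (A : Type u) [Field k] [Ring A] [Algebra k A] : Prop :=
  ∃ (n : ℕ) (e : Fin n → A), CompleteOrthogonalIdempotents e ∧
    (∀ i, IsPrimitiveIdempotent (e i)) ∧ IsConnectedQuiver (ExtQuiver k e)

end ExtQuiver

end

/-! A path in a quiver of type A is determined by its end points. So, once the vertices are numbered
`0, …, n`, the path algebra is the incidence algebra of the path order, realised inside the matrices
(`IsLineNumbering.range_toMatrix`). The orientation becomes a word `o`, whose letter `o t` is the
direction of the edge between `t` and `t + 1`.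

The maximal subalgebras are found in `covBy_lineAlgebra`. If two diagonal entries agree on all of
`A`, then `A` is the glued algebra defined by that one equation. Otherwise the diagonal separates
positions. Idempotents lift along the nil kernel of the diagonal map, so some conjugate of `A`
contains all diagonal matrix units and is determined by the pairs whose matrix units it contains.
Being proper, it misses some edge, and by maximality it is the incidence algebra with that one edge
removed, the cut algebra.

The two kinds are never isomorphic: a cut algebra has `n + 1` orthogonal idempotents, too many for a
glued one (`isEmpty_algEquiv_glueSubalgebra`). An isomorphism of cut algebras gives an isomorphism
of the cut orders (`exists_orderIso_of_algEquiv`). An isomorphism of glued algebras acts invertibly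
on radical modulo squared radical, and so gives an isomorphism of the quivers obtained by
identifying two vertices (`IsHasse.exists_perm_of_algEquiv`).

What remains is combinatorial: `cutArrow_rigid` and `GlueIso.rigid` show that the cut edge, or the
glued pair, is determined up to the reflection of the line, and that the reflection is needed only
when `o (n - 1 - t) = !o t` for all edges. In that case the reflection is an automorphism of the
quiver and induces the required automorphism of the algebra. Connectedness enters through
`exists_central_idempotent`: cutting an edge with no neighbouring edge in the same direction splits
the algebra, and such cuts have to be excluded in `cutArrow_rigid`. -/

section CutQuiverCombinatorics

/-! ### Rigidity of the Hasse quiver of a line order with one edge cut -/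

/-- The arrows of the Hasse quiver of the path order of an oriented line on `0, …, n`, with the
edge `i` (joining `i` and `i + 1`) removed from the order. The edge `t` points to the right
when `o t = true`. -/
def CutArrow (n : ℕ) (o : ℕ → Bool) (i x y : ℕ) : Prop :=
  x ≤ n ∧ y ≤ n ∧
    ((y = x + 1 ∧ x ≠ i ∧ o x = true) ∨ (x = y + 1 ∧ y ≠ i ∧ o y = false) ∨
      (y = x + 2 ∧ (i = x ∨ i = x + 1) ∧ o x = true ∧ o (x + 1) = true) ∨
      (x = y + 2 ∧ (i = y ∨ i = y + 1) ∧ o y = false ∧ o (y + 1) = false))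

/-- The underlying graph of `CutArrow`. -/
def CutAdj (n : ℕ) (o : ℕ → Bool) (i x y : ℕ) : Prop :=
  CutArrow n o i x y ∨ CutArrow n o i y x

/-- The edge before `i` exists and has the same direction. -/
def ExtendsLeft (o : ℕ → Bool) (i : ℕ) : Prop := 1 ≤ i ∧ o (i - 1) = o i

/-- The edge after `i` exists and has the same direction. -/
def ExtendsRight (n : ℕ) (o : ℕ → Bool) (i : ℕ) : Prop := i + 1 < n ∧ o (i + 1) = o i

/-- This reduces the dependence on `o` to the two propositions `ExtendsLeft` and `ExtendsRight`. The
graph is the line without edge `i`, with a chord from `i - 1` to `i + 1` or from `i` to `i + 2` when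
the corresponding composite path exists. One chord gives a tree with at most one trivalent vertex;
two chords give a square with two tails. -/
theorem cutAdj_iff {n : ℕ} {o : ℕ → Bool} {i : ℕ} (hi : i < n) (x y : ℕ) :
    CutAdj n o i x y ↔ x ≤ n ∧ y ≤ n ∧
      ((y = x + 1 ∧ x ≠ i) ∨ (x = y + 1 ∧ y ≠ i) ∨
        (ExtendsLeft o i ∧ ((x + 1 = i ∧ y = i + 1) ∨ (y + 1 = i ∧ x = i + 1))) ∨
        (ExtendsRight n o i ∧ ((x = i ∧ y = i + 2) ∨ (y = i ∧ x = i + 2)))) := by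
  simp only [CutAdj, CutArrow, ExtendsLeft, ExtendsRight]
  constructor
  · rintro (⟨hx, hy, h | h | h | h⟩ | ⟨hx, hy, h | h | h | h⟩) <;>
      refine ⟨by omega, by omega, ?_⟩ <;> grind (splits := 30)
  · rintro ⟨hx, hy, h⟩
    rcases h with h | h | h | h
    · cases h' : o x <;> grind
    · cases h' : o y <;> grind
    · obtain ⟨⟨h1, h2⟩, h | h⟩ := h <;> cases h' : o i <;> grind (splits := 30)
    · obtain ⟨⟨h1, h2⟩, h | h⟩ := h <;> cases h' : o i <;> grind (splits := 30)

/-- Along a branch every inner vertex has exactly the two obvious neighbours, and the last vertex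
only one. -/
structure IsBranch (adj : ℕ → ℕ → Prop) (x : ℕ → ℕ) (l : ℕ) : Prop where
  pos : 1 ≤ l
  adj_iff : ∀ s, s < l → ∀ z, adj (x (s + 1)) z ↔ z = x s ∨ (s + 1 < l ∧ z = x (s + 2))
  ne : ∀ s, s + 1 < l → x (s + 2) ≠ x s

/-- A walk that never turns back has no choice along a branch, so agreement on the first edge
propagates. The lengths agree because the last vertex, and no inner one, has a single neighbour. -/
theorem IsBranch.match {adj adj' : ℕ → ℕ → Prop} {σ : Equiv.Perm ℕ}
    (hσ : ∀ x y, adj x y ↔ adj' (σ x) (σ y)) {x y : ℕ → ℕ} {l m : ℕ} (hx : IsBranch adj x l)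
    (hy : IsBranch adj' y m) (h0 : σ (x 0) = y 0) (h1 : σ (x 1) = y 1) :
    l = m ∧ ∀ s ≤ l, σ (x s) = y s := by
  have key : ∀ s, s + 1 ≤ l → s + 1 ≤ m → σ (x s) = y s ∧ σ (x (s + 1)) = y (s + 1) := by
    intro s
    induction s with
    | zero => exact fun _ _ => ⟨h0, h1⟩
    | succ s ih =>
      intro hl hm
      obtain ⟨ih0, ih1⟩ := ih (by omega) (by omega)
      refine ⟨ih1, ?_⟩
      have h2 : adj (x (s + 1)) (x (s + 2)) :=
        (hx.adj_iff s (by omega) _).2 (Or.inr ⟨by omega, rfl⟩)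
      rw [hσ, ih1, hy.adj_iff s (by omega)] at h2
      rcases h2 with h2 | h2
      · exact absurd (σ.injective (h2.trans ih0.symm)) (hx.ne s (by omega))
      · exact h2.2
  have hl := hx.pos
  have hm := hy.pos
  have hlm : l = m := by
    rcases lt_trichotomy l m with h | h | h
    · obtain ⟨s, rfl⟩ : ∃ s, l = s + 1 := ⟨l - 1, by omega⟩
      obtain ⟨k0, k1⟩ := key s le_rfl (by omega)
      have h2 : adj' (y (s + 1)) (y (s + 2)) := (hy.adj_iff s (by omega) _).2 (Or.inr ⟨h, rfl⟩)
      rw [← k1, ← σ.apply_symm_apply (y (s + 2)), ← hσ, hx.adj_iff s (by omega)] at h2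
      rcases h2 with h2 | h2
      · exact absurd (by rw [← k0, ← h2, σ.apply_symm_apply]) (hy.ne s h)
      · omega
    · exact h
    · obtain ⟨s, rfl⟩ : ∃ s, m = s + 1 := ⟨m - 1, by omega⟩
      obtain ⟨k0, k1⟩ := key s (by omega) le_rfl
      have h2 : adj (x (s + 1)) (x (s + 2)) := (hx.adj_iff s (by omega) _).2 (Or.inr ⟨h, rfl⟩)
      rw [hσ, k1, hy.adj_iff s (by omega)] at h2
      rcases h2 with h2 | h2
      · exact absurd (σ.injective (h2.trans k0.symm)) (hx.ne s h)
      · omega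
  refine ⟨hlm, fun s hs => ?_⟩
  rcases s with _ | s
  · exact h0
  · exact (key s hs (by omega)).2

theorem isBranch_left {n : ℕ} {o : ℕ → Bool} {i a : ℕ} (hi : i < n) (ha : 1 ≤ a) (hai : a + 1 ≤ i) :
    IsBranch (CutAdj n o i) (fun s => a - s) a where
  pos := ha
  adj_iff s hs z := by rw [cutAdj_iff hi]; grind
  ne s hs := by omega

theorem isBranch_right {n : ℕ} {o : ℕ → Bool} {i a : ℕ} (hi : i < n) (ha : a < n)
    (hai : i + 2 ≤ a) : IsBranch (CutAdj n o i) (fun s => a + s) (n - a) where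
  pos := by omega
  adj_iff s hs z := by rw [cutAdj_iff hi]; grind
  ne s hs := by omega

/-- The branch crosses the cut on the chord from `i - 1` to `i + 1` and skips `i`, which hangs off
`i - 1` as a leaf; hence the special value at `s = 0`. -/
theorem isBranch_main_right {n : ℕ} {o : ℕ → Bool} {i : ℕ} (hi : i < n) (hl : ExtendsLeft o i)
    (hr : ¬ ExtendsRight n o i) :
    IsBranch (CutAdj n o i) (fun s => if s = 0 then i - 1 else i + s) (n - i) where
  pos := by omega
  adj_iff s hs z := by
    have := hl.1
    rw [cutAdj_iff hi]; grind
  ne s hs := by grind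

theorem isBranch_main_left {n : ℕ} {o : ℕ → Bool} {i : ℕ} (hi : i < n) (hl : ¬ ExtendsLeft o i)
    (hr : ExtendsRight n o i) :
    IsBranch (CutAdj n o i) (fun s => if s = 0 then i + 2 else i + 1 - s) (i + 1) where
  pos := by omega
  adj_iff s hs z := by
    have := hr.1
    rw [cutAdj_iff hi]; grind
  ne s hs := by grind

theorem isBranch_pendant_left {n : ℕ} {o : ℕ → Bool} {i : ℕ} (hi : i < n) (hl : ExtendsLeft o i)
    (hr : ¬ ExtendsRight n o i) :
    IsBranch (CutAdj n o i) (fun s => if s = 0 then i - 1 else i) 1 where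
  pos := by omega
  adj_iff s hs z := by
    have := hl.1
    rw [cutAdj_iff hi]; grind
  ne s hs := by grind

theorem isBranch_pendant_right {n : ℕ} {o : ℕ → Bool} {i : ℕ} (hi : i < n)
    (hl : ¬ ExtendsLeft o i) (hr : ExtendsRight n o i) :
    IsBranch (CutAdj n o i) (fun s => if s = 0 then i + 2 else i + 1) 1 where
  pos := by omega
  adj_iff s hs z := by
    have := hr.1
    rw [cutAdj_iff hi]; grind
  ne s hs := by grind

theorem cutAdj_center_left {n : ℕ} {o : ℕ → Bool} {i : ℕ} (hi : i < n) (hl : ExtendsLeft o i)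
    (z : ℕ) :
    CutAdj n o i (i - 1) z ↔ z = i ∨ z = i + 1 ∨ z + 2 = i := by
  have := hl.1
  rw [cutAdj_iff hi]; grind

theorem cutAdj_center_right {n : ℕ} {o : ℕ → Bool} {i : ℕ} (hi : i < n)
    (hr : ExtendsRight n o i) (z : ℕ) :
    CutAdj n o i (i + 2) z ↔ z = i + 1 ∨ z = i ∨ (i + 3 ≤ n ∧ z = i + 3) := by
  have := hr.1
  rw [cutAdj_iff hi]; grind

/-- With only the left chord present, `i - 1` is the only candidate for a vertex of degree three,
and it has that degree only if the line continues to its left. Graph isomorphisms therefore preserve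
this centre. -/
theorem eq_center_left {n : ℕ} {o : ℕ → Bool} {i v a b c : ℕ} (hi : i < n) (hl : ExtendsLeft o i)
    (hr : ¬ ExtendsRight n o i) (ha : CutAdj n o i v a) (hb : CutAdj n o i v b)
    (hc : CutAdj n o i v c) (hab : a ≠ b) (hac : a ≠ c) (hbc : b ≠ c) : v = i - 1 ∧ 2 ≤ i := by
  have := hl.1
  rw [cutAdj_iff hi] at ha hb hc
  by_cases h : v = i - 1
  · grind
  · exfalso; simp only [hl, hr, true_and, false_and, or_false] at ha hb hc; omega

theorem eq_center_right {n : ℕ} {o : ℕ → Bool} {i v a b c : ℕ} (hi : i < n)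
    (hl : ¬ ExtendsLeft o i) (hr : ExtendsRight n o i) (ha : CutAdj n o i v a)
    (hb : CutAdj n o i v b) (hc : CutAdj n o i v c) (hab : a ≠ b) (hac : a ≠ c) (hbc : b ≠ c) :
    v = i + 2 ∧ i + 3 ≤ n := by
  have := hr.1
  rw [cutAdj_iff hi] at ha hb hc
  simp only [hl, hr, true_and, false_and, false_or] at ha hb hc; omega

theorem CutArrow.adj_iff {n : ℕ} {o : ℕ → Bool} {i i' : ℕ} {σ : Equiv.Perm ℕ}
    (hσ : ∀ x y, CutArrow n o i x y ↔ CutArrow n o i' (σ x) (σ y)) (x y : ℕ) :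
    CutAdj n o i x y ↔ CutAdj n o i' (σ x) (σ y) := by
  simp only [CutAdj, hσ]

/-- If `i < i'`, both centres are trivalent and correspond. The main branch at `i` has length `n -
i`, which rules out the pendant vertex and the main branch at `i'`. Only the left branch at `i'` is
left, and there the arrow directions contradict each other. -/
theorem cut_left_left {n : ℕ} {o : ℕ → Bool} {i i' : ℕ} {σ : Equiv.Perm ℕ}
    (hσ : ∀ x y, CutArrow n o i x y ↔ CutArrow n o i' (σ x) (σ y))
    (hi' : i' < n) (hl : ExtendsLeft o i) (hr : ¬ ExtendsRight n o i)
    (hl' : ExtendsLeft o i') (hr' : ¬ ExtendsRight n o i') : i' ≤ i := by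
  by_contra! hlt
  have hadj := CutArrow.adj_iff hσ
  have hi : i < n := by omega
  have h1 := hl.1
  obtain ⟨-, hi2⟩ := eq_center_left (v := σ.symm (i' - 1)) (a := σ.symm i') (b := σ.symm (i' + 1))
    (c := σ.symm (i' - 2)) hi hl hr
    (by rw [hadj]; simp only [σ.apply_symm_apply]; rw [cutAdj_center_left hi' hl']; simp)
    (by rw [hadj]; simp only [σ.apply_symm_apply]; rw [cutAdj_center_left hi' hl']; simp)
    (by rw [hadj]; simp only [σ.apply_symm_apply]; rw [cutAdj_center_left hi' hl']; omega)
    (by rw [σ.symm.injective.ne_iff]; omega) (by rw [σ.symm.injective.ne_iff]; omega)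
    (by rw [σ.symm.injective.ne_iff]; omega)
  have hc : σ (i - 1) = i' - 1 := (eq_center_left (a := σ i) (b := σ (i + 1))
    (c := σ (i - 2)) hi' hl' hr'
    (by rw [← hadj, cutAdj_center_left hi hl]; simp)
    (by rw [← hadj, cutAdj_center_left hi hl]; simp)
    (by rw [← hadj, cutAdj_center_left hi hl]; omega)
    (by rw [σ.injective.ne_iff]; omega) (by rw [σ.injective.ne_iff]; omega)
    (by rw [σ.injective.ne_iff]; omega)).1
  have hn1 : CutAdj n o i' (i' - 1) (σ (i + 1)) := by
    rw [← hc, ← hadj, cutAdj_center_left hi hl]; simp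
  have hn0 : CutAdj n o i' (i' - 1) (σ i) := by
    rw [← hc, ← hadj, cutAdj_center_left hi hl]; simp
  have hne : σ i ≠ σ (i + 1) := by rw [σ.injective.ne_iff]; omega
  rw [cutAdj_center_left hi' hl'] at hn1 hn0
  have hmain := isBranch_main_right hi hl hr
  rcases hn1 with h | h | h
  · have := (hmain.match hadj (isBranch_pendant_left hi' hl' hr') (by simpa using hc)
      (by simpa using h)).1
    omega
  · have := (hmain.match hadj (isBranch_main_right hi' hl' hr') (by simpa using hc)
      (by simpa using h)).1
    omega
  -- Here `n - i = i' - 1`. The arrow reaching `i'` on the main branch is sent to the one from `i`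
  -- to `i - 1`, which forces `o i ≠ o i'` (or is absurd outright when `i' = i + 1`). The pendant
  -- arrow at `i` is sent to one leaving `i' - 1` for `i'` or `i' + 1`, which forces `o i = o i'`.
  · obtain ⟨hlen, hw⟩ := hmain.match hadj (isBranch_left (a := i' - 1) hi' (by omega) (by omega))
      (by simpa using hc) (by simp only [one_ne_zero, if_false, h.symm]; omega)
    have e1 := hw (i' - i - 1) (by omega)
    have e2 := hw (i' - i) (by omega)
    have d1 := hσ (if i' - i - 1 = 0 then i - 1 else i + (i' - i - 1))
      (if i' - i = 0 then i - 1 else i + (i' - i))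
    rw [e1, e2] at d1
    have d0 := hσ (i - 1) i
    rw [hc] at d0
    have hs : σ i = i' ∨ σ i = i' + 1 := by omega
    obtain ⟨-, h2⟩ := hl
    obtain ⟨h3, h4⟩ := hl'
    clear hadj hmain hw e1 e2 hσ hr hr'
    have h5 : i' - 1 - (i' - i - 1) = i := by omega
    have h6 : i' - 1 - (i' - i) = i - 1 := by omega
    rw [h5, h6] at d1
    have h7 : (if i' - i - 1 = 0 then i - 1 else i + (i' - i - 1)) =
      if i + 1 = i' then i - 1 else i' - 1 := by split_ifs <;> omega
    rw [h7, if_neg (by omega : i' - i ≠ 0), (by omega : i + (i' - i) = i')] at d1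
    simp only [CutArrow] at d1 d0
    cases h1 : o i <;> cases h2 : o i' <;> grind (splits := 30)
theorem cutArrow_main_right {n : ℕ} {o : ℕ → Bool} {i : ℕ} (hl : ExtendsLeft o i) {s : ℕ}
    (hs : s < n - i) :
    CutArrow n o i (if s = 0 then i - 1 else i + s) (if s + 1 = 0 then i - 1 else i + (s + 1)) ↔
      o (i + s) = true := by
  obtain ⟨h1, h2⟩ := hl
  simp only [CutArrow]
  rcases s with _ | s
  · simp; cases h : o i <;> grind
  · simp; grind

theorem cutArrow_main_left {n : ℕ} {o : ℕ → Bool} {i : ℕ} (hr : ExtendsRight n o i) {s : ℕ}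
    (hs : s < i + 1) :
    CutArrow n o i (if s = 0 then i + 2 else i + 1 - s)
      (if s + 1 = 0 then i + 2 else i + 1 - (s + 1)) ↔ o (i - s) = false := by
  obtain ⟨h1, h2⟩ := hr
  simp only [CutArrow]
  rcases s with _ | s
  · simp; cases h : o i <;> grind
  · simp; grind

theorem cutArrow_left {n : ℕ} {o : ℕ → Bool} {i a s : ℕ} (hi : i < n) (ha : a + 1 ≤ i)
    (hs : s < a) : CutArrow n o i (a - s) (a - (s + 1)) ↔ o (a - 1 - s) = false := by
  simp only [CutArrow]; grind

theorem cutArrow_right {n : ℕ} {o : ℕ → Bool} {i a s : ℕ} (ha : i + 2 ≤ a)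
    (hs : s < n - a) : CutArrow n o i (a + s) (a + (s + 1)) ↔ o (a + s) = true := by
  simp only [CutArrow]; grind

theorem cutArrow_pendant_left {n : ℕ} {o : ℕ → Bool} {i : ℕ} (hi : i < n)
    (hl : ExtendsLeft o i) : CutArrow n o i (i - 1) i ↔ o i = true := by
  obtain ⟨h1, h2⟩ := hl
  simp only [CutArrow]; grind

theorem cutArrow_pendant_right {n : ℕ} {o : ℕ → Bool} {i : ℕ}
    (hr : ExtendsRight n o i) : CutArrow n o i (i + 2) (i + 1) ↔ o i = false := by
  obtain ⟨h1, h2⟩ := hr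
  simp only [CutArrow]; grind

/-- Once the centres correspond, the three branches at one are matched with those at the other.
Lengths and directions leave only matchings under which main branch and side branch carry opposite
words, possibly after exchanging branches of length one. Reading these words along the line gives
the reflection. -/
theorem cut_left_right_of_center {n : ℕ} {o : ℕ → Bool} {i i' : ℕ} {σ : Equiv.Perm ℕ}
    (hσ : ∀ x y, CutArrow n o i x y ↔ CutArrow n o i' (σ x) (σ y))
    (hi : i < n) (hi' : i' < n) (hl : ExtendsLeft o i) (hr : ¬ ExtendsRight n o i)
    (hl' : ¬ ExtendsLeft o i') (hr' : ExtendsRight n o i') (hc : σ (i - 1) = i' + 2)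
    (hdeg : 2 ≤ i ↔ i' + 3 ≤ n) :
    i' = n - 1 - i ∧ ∀ t < n, o (n - 1 - t) = !o t := by
  have hadj := CutArrow.adj_iff hσ
  have hl1 := hl.1
  have hr1 := hr'.1
  have hn0 : CutAdj n o i' (i' + 2) (σ i) := by
    rw [← hc, ← hadj, cutAdj_center_left hi hl]; simp
  have hn1 : CutAdj n o i' (i' + 2) (σ (i + 1)) := by
    rw [← hc, ← hadj, cutAdj_center_left hi hl]; simp
  have hn2 : 2 ≤ i → CutAdj n o i' (i' + 2) (σ (i - 2)) := fun h => by
    rw [← hc, ← hadj, cutAdj_center_left hi hl]; omega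
  rw [cutAdj_center_right hi' hr'] at hn0 hn1 hn2
  have hne1 : σ i ≠ σ (i + 1) := by rw [σ.injective.ne_iff]; omega
  have hne2 : 2 ≤ i → σ i ≠ σ (i - 2) := fun _ => by rw [σ.injective.ne_iff]; omega
  have hne3 : 2 ≤ i → σ (i + 1) ≠ σ (i - 2) := fun _ => by rw [σ.injective.ne_iff]; omega
  have hmain := isBranch_main_right hi hl hr
  have hmain' := isBranch_main_left hi' hl' hr'
  have hpend := isBranch_pendant_left hi hl hr
  have hpend' := isBranch_pendant_right hi' hl' hr'
  have hleft : 2 ≤ i → IsBranch (CutAdj n o i) (fun s => i - 1 - s) (i - 1) :=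
    fun h => isBranch_left hi (by omega) (by omega)
  have hright : i' + 3 ≤ n → IsBranch (CutAdj n o i') (fun s => i' + 2 + s) (n - (i' + 2)) :=
    fun h => isBranch_right hi' (by omega) (by omega)
  have e0 := (hσ (i - 1) i).symm
  have e1 := (hσ (i - 1) (i + 1)).symm
  rw [hc] at e0 e1
  rw [cutArrow_pendant_left hi hl] at e0
  have e1' := cutArrow_main_right hl (s := 0) (by omega : 0 < n - i)
  have e2 := cutArrow_main_left hr' (s := 0) (by omega)
  have e3 := cutArrow_pendant_right hr'
  simp only [if_true, zero_add, one_ne_zero, if_false, add_zero, Nat.sub_zero,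
    Nat.add_sub_cancel] at e1' e2
  rw [e1'] at e1
  have hl2 := hl.2
  have hr2 := hr'.2
  have main : n - i = i' + 1 ∧ ∀ s < n - i, o (i + s) = !o (i' - s) := by
    rcases hn1 with h | h | h
    · have hlen := (hmain.match hadj hpend' (by simpa using hc) (by simpa using h)).1
      rw [h, e3] at e1
      have ha : o i = !o i' := by cases h1 : o i <;> cases h2 : o i' <;> grind
      -- The main branch at `i` went to the pendant vertex, so it has length one. If the pendant
      -- vertex at `i` takes the main branch at `i'`, that branch has length one too. Otherwise the
      -- left branch takes it, and then `i - 1 = i' + 1` contradicts the opposite directions in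
      -- `ha`.
      have hi1 : i' = 0 := by
        rcases hn0 with h' | h' | ⟨h'', h'⟩
        · omega
        · have := (hpend.match hadj hmain' (by simpa using hc) (by simpa using h')).1
          omega
        · have hi2 := hdeg.2 h''
          have h2 : σ (i - 2) = i' := by
            have := hn2 hi2; have := hne2 hi2; have := hne3 hi2; omega
          have := ((hleft hi2).match hadj hmain' (by simpa using hc)
            (by simpa [Nat.sub_sub] using h2)).1
          have h4 : i - 1 = i' + 1 := by omega
          rw [h4] at hl2
          grind
      refine ⟨by omega, fun s hs => ?_⟩
      obtain rfl : s = 0 := by omega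
      exact ha
    · obtain ⟨hlen, hw⟩ := hmain.match hadj hmain' (by simpa using hc) (by simpa using h)
      refine ⟨hlen, fun s hs => ?_⟩
      have d := hσ (if s = 0 then i - 1 else i + s) (if s + 1 = 0 then i - 1 else i + (s + 1))
      rw [hw s (by omega), hw (s + 1) (by omega), cutArrow_main_right hl hs,
        cutArrow_main_left hr' (by omega)] at d
      cases h1 : o (i + s) <;> cases h2 : o (i' - s) <;> grind
    · exfalso
      have := (hmain.match hadj (hright h.1) (by simpa using hc) (by simpa using h.2)).1
      have h4 : i - 1 = i' + 1 := by omega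
      have h5 : σ i = i' + 1 ∨ σ i = i' := by omega
      rw [h4] at hl2
      rcases h5 with h5 | h5 <;> rw [h5] at e0 <;> cases h1 : o i <;> grind
  obtain ⟨hlen, hmw⟩ := main
  have ha : o i = !o i' := hmw 0 (by omega)
  have side : 2 ≤ i → ∀ s < i - 1, o (i - 2 - s) = !o (i' + 2 + s) := by
    intro hi2
    have hi3 := hdeg.1 hi2
    have hL := hleft hi2
    have f0 := (hσ (i - 1) (i - 2)).symm
    have f1 := cutArrow_left (n := n) (o := o) (a := i - 1) (s := 0) hi (by omega) (by omega)
    have f2 := cutArrow_right (n := n) (o := o) (i := i') (a := i' + 2) (s := 0)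
      (by omega) (by omega)
    have g1 : i - 1 - (0 + 1) = i - 2 := by omega
    rw [g1, Nat.sub_zero, Nat.sub_zero] at f1
    rw [add_zero] at f2
    rw [f1, hc] at f0
    rcases hn2 hi2 with h | h | ⟨-, h⟩
    · have hlen2 := (hL.match hadj hpend' (by simpa using hc)
        (by simpa [Nat.sub_sub] using h)).1
      rw [h, e3] at f0
      have h5 : σ i = i' + 3 ∨ σ (i + 1) = i' + 3 := by
        have := hne1; have := hne2 hi2; have := hne3 hi2; omega
      have h6 : o i = o (i' + 2) := by
        rcases h5 with h5 | h5
        · rw [h5, f2] at e0; cases h1 : o i <;> cases h2 : o (i' + 2) <;> grind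
        · rw [h5, f2] at e1; cases h1 : o i <;> cases h2 : o (i' + 2) <;> grind
      intro s hs
      obtain rfl : s = 0 := by omega
      rw [Nat.sub_zero, add_zero, ← h6, ha]
      cases h1 : o (i - 2) <;> cases h2 : o i' <;> grind
    · have := (hL.match hadj hmain' (by simpa using hc) (by simpa [Nat.sub_sub] using h)).1
      have h4 : i - 1 = i' + 1 := by omega
      rw [h4] at hl2
      grind
    · obtain ⟨hlen2, hw⟩ := hL.match hadj (hright hi3) (by simpa using hc)
        (by simpa [Nat.sub_sub] using h)
      intro s hs
      have d := hσ (i - 1 - s) (i - 1 - (s + 1))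
      rw [hw s (by omega), hw (s + 1) (by omega), cutArrow_left hi (by omega) hs,
        cutArrow_right le_rfl (by omega), Nat.sub_sub i 1 1] at d
      cases h1 : o (i - 2 - s) <;> cases h2 : o (i' + 2 + s) <;> grind
  refine ⟨by omega, ?_⟩
  -- The main branch covers `t ≥ i`. The edge `i - 1`, absorbed in the chord, is supplied by
  -- `ExtendsLeft` and its mirror image by `ExtendsRight`.
  have half : ∀ t < n, i ≤ t + 1 → o (n - 1 - t) = !o t := by
    intro t ht hit
    rcases Nat.lt_or_ge t i with h | h
    · have h1 : t = i - 1 := by omega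
      have h2 : n - 1 - t = i' + 1 := by omega
      rw [h2, h1, hl2, hr2, ha, Bool.not_not]
    · have := hmw (t - i) (by omega)
      have h1 : i + (t - i) = t := by omega
      have h2 : i' - (t - i) = n - 1 - t := by omega
      rw [h1, h2] at this
      rw [this, Bool.not_not]
  intro t ht
  rcases Nat.lt_or_ge (t + 1) i with h | h
  · have := side (by omega) (i - 2 - t) (by omega)
    have h1 : i - 2 - (i - 2 - t) = t := by omega
    have h2 : i' + 2 + (i - 2 - t) = n - 1 - t := by omega
    rw [h1, h2] at this
    rw [this, Bool.not_not]
  · exact half t ht h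

theorem cut_left_right {n : ℕ} {o : ℕ → Bool} {i i' : ℕ} {σ : Equiv.Perm ℕ}
    (hσ : ∀ x y, CutArrow n o i x y ↔ CutArrow n o i' (σ x) (σ y))
    (hi : i < n) (hi' : i' < n) (hl : ExtendsLeft o i) (hr : ¬ ExtendsRight n o i)
    (hl' : ¬ ExtendsLeft o i') (hr' : ExtendsRight n o i') :
    i' = n - 1 - i ∧ ∀ t < n, o (n - 1 - t) = !o t := by
  have hadj := CutArrow.adj_iff hσ
  have hl1 := hl.1
  have hr1 := hr'.1
  by_cases hi2 : 2 ≤ i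
  · obtain ⟨hc, hi3⟩ := eq_center_right (v := σ (i - 1)) (a := σ i) (b := σ (i + 1))
      (c := σ (i - 2)) hi' hl' hr'
      (by rw [← hadj, cutAdj_center_left hi hl]; simp)
      (by rw [← hadj, cutAdj_center_left hi hl]; simp)
      (by rw [← hadj, cutAdj_center_left hi hl]; omega)
      (by rw [σ.injective.ne_iff]; omega) (by rw [σ.injective.ne_iff]; omega)
      (by rw [σ.injective.ne_iff]; omega)
    exact cut_left_right_of_center hσ hi hi' hl hr hl' hr' hc ⟨fun _ => hi3, fun _ => hi2⟩
  -- Without a left branch the graph is a path and degrees do not show the centre. It is recovered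
  -- as the neighbour of the end vertex `1`, whose image is one of the two ends `0` and `i' + 1`;
  -- the arrow direction excludes `0`.
  · have hn : ¬ i' + 3 ≤ n := fun hi3 => hi2 (eq_center_left (v := σ.symm (i' + 2))
      (a := σ.symm i') (b := σ.symm (i' + 1)) (c := σ.symm (i' + 3)) hi hl hr
      (by rw [hadj]; simp only [σ.apply_symm_apply]; rw [cutAdj_center_right hi' hr']; simp)
      (by rw [hadj]; simp only [σ.apply_symm_apply]; rw [cutAdj_center_right hi' hr']; simp)
      (by rw [hadj]; simp only [σ.apply_symm_apply]; rw [cutAdj_center_right hi' hr']; omega)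
      (by rw [σ.symm.injective.ne_iff]; omega) (by rw [σ.symm.injective.ne_iff]; omega)
      (by rw [σ.symm.injective.ne_iff]; omega)).2
    refine cut_left_right_of_center hσ hi hi' hl hr hl' hr' ?_ (by omega)
    obtain rfl : i = 1 := by omega
    obtain rfl : n = i' + 2 := by omega
    have p : ∀ z, CutAdj (i' + 2) o 1 1 z ↔ z = 0 := fun z => by rw [cutAdj_iff hi]; grind
    have p0 : CutAdj (i' + 2) o i' (σ 1) (σ 0) := by rw [← hadj, p]
    have uniq : ∀ z, CutAdj (i' + 2) o i' (σ 1) z → z = σ 0 := fun z hz => by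
      rw [← σ.apply_symm_apply z, ← hadj, p] at hz
      rw [← hz, σ.apply_symm_apply]
    have hends : σ 1 = 0 ∨ σ 1 = i' + 1 := by
      by_contra! hcon
      obtain ⟨q1, q2⟩ := hcon
      have q3 := ((cutAdj_iff hi' _ _).1 p0).1
      have u1 := uniq (σ 1 - 1)
      have u2 := uniq (σ 1 + 1)
      have u3 := uniq (σ 1 + 2)
      have u4 := uniq (σ 1 - 2)
      rw [cutAdj_iff hi'] at u1 u2 u3 u4
      simp only [hl', hr', true_and, false_and, false_or] at u1 u2 u3 u4
      omega
    have a0 := hσ 0 1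
    have h2 : o 0 = o 1 := hl.2
    rcases hends with h | h
    · exfalso
      rw [h, cutAdj_iff hi'] at p0
      simp only [hl', hr', true_and, false_and, false_or] at p0
      rw [h] at a0
      rcases Nat.eq_zero_or_pos i' with h0 | h0
      · have : σ 0 = 2 := by omega
        rw [this] at a0
        subst h0
        simp only [CutArrow] at a0
        cases h1 : o 1 <;> grind
      · have : σ 0 = 1 := by omega
        rw [this] at a0
        simp only [CutArrow] at a0
        cases h1 : o 1 <;> grind
    · rw [h, cutAdj_iff hi'] at p0
      simp only [hl', hr', true_and, false_and, false_or] at p0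
      show σ 0 = i' + 2
      omega
theorem CutAdj.cases {n : ℕ} {o : ℕ → Bool} {i v z : ℕ} (hi : i < n) (h : CutAdj n o i v z) :
    (v = i ∧ (z + 1 = i ∨ z = i + 2)) ∨ (v = i + 1 ∧ (z + 1 = i ∨ z = i + 2)) ∨
      (v + 1 = i ∧ (z = i ∨ z = i + 1 ∨ z + 1 = v)) ∨
      (v = i + 2 ∧ (z = i ∨ z = i + 1 ∨ z = i + 3)) ∨
      ((v + 1 < i ∨ i + 2 < v) ∧ (z = v + 1 ∨ z + 1 = v)) := by
  rw [cutAdj_iff hi] at h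
  omega

/-- The graph is a line apart from the two chords, so its only possible four-cycle runs through `i -
1`, `i`, `i + 2`, `i + 1`. This locates the cut when both chords are present. -/
theorem cutAdj_square {n : ℕ} {o : ℕ → Bool} {i u x y v : ℕ} (hi : i < n) (hxy : x ≠ y)
    (huv : u ≠ v) (h1 : CutAdj n o i u x) (h2 : CutAdj n o i u y) (h3 : CutAdj n o i x v)
    (h4 : CutAdj n o i y v) :
    ((x = i ∧ y = i + 1) ∨ (x = i + 1 ∧ y = i)) ∧
      ((u + 1 = i ∧ v = i + 2) ∨ (v + 1 = i ∧ u = i + 2)) ∨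
      (((u = i ∧ v = i + 1) ∨ (u = i + 1 ∧ v = i)) ∧
      ((x + 1 = i ∧ y = i + 2) ∨ (y + 1 = i ∧ x = i + 2))) := by
  replace h1 := h1.cases hi
  replace h2 := h2.cases hi
  replace h3 := h3.cases hi
  replace h4 := h4.cases hi
  rcases h1 with ⟨c, d⟩ | ⟨c, d⟩ | ⟨c, d⟩ | ⟨c, d⟩ | ⟨c, d⟩
  · replace h2 : y + 1 = i ∨ y = i + 2 := by clear h3 h4; omega
    rcases d with d | d <;> rcases h2 with h2 | h2 <;> grind (splits := 30)
  · replace h2 : y + 1 = i ∨ y = i + 2 := by clear h3 h4; omega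
    rcases d with d | d <;> rcases h2 with h2 | h2 <;> grind (splits := 30)
  · replace h2 : y = i ∨ y = i + 1 ∨ y + 1 = u := by clear h3 h4; omega
    rcases d with d | d | d <;> rcases h2 with h2 | h2 | h2 <;> grind
  · replace h2 : y = i ∨ y = i + 1 ∨ y = i + 3 := by clear h3 h4; omega
    rcases d with d | d | d <;> rcases h2 with h2 | h2 | h2 <;> grind
  · replace h2 : y = u + 1 ∨ y + 1 = u := by clear h3 h4; omega
    rcases d with d | d <;> rcases h2 with h2 | h2 <;> grind (splits := 30)

/-- Two distinct directed paths of length two with common ends form the square around the cut.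
Having one detects intrinsically that both chords exist, and its source and sink reveal the
direction of the cut edge. -/
theorem CutArrow.diamond {n : ℕ} {o : ℕ → Bool} {i u x y v : ℕ} (hi : i < n) (hxy : x ≠ y)
    (h1 : CutArrow n o i u x) (h2 : CutArrow n o i u y) (h3 : CutArrow n o i x v)
    (h4 : CutArrow n o i y v) :
    ExtendsLeft o i ∧ ExtendsRight n o i ∧ ((x = i ∧ y = i + 1) ∨ (x = i + 1 ∧ y = i)) ∧
      ((o i = true ∧ u + 1 = i ∧ v = i + 2) ∨ (o i = false ∧ v + 1 = i ∧ u = i + 2)) := by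
  have huv : u ≠ v := by
    rintro rfl
    simp only [CutArrow] at h1 h3
    grind
  have key := cutAdj_square hi hxy huv (Or.inl h1) (Or.inl h2) (Or.inl h3) (Or.inl h4)
  have a1 := (cutAdj_iff hi _ _).1 (Or.inl h1)
  have a2 := (cutAdj_iff hi _ _).1 (Or.inl h2)
  have a3 := (cutAdj_iff hi _ _).1 (Or.inl h3)
  have a4 := (cutAdj_iff hi _ _).1 (Or.inl h4)
  have hl : ExtendsLeft o i := by
    by_contra h
    simp only [h, false_and, false_or] at a1 a2 a3 a4
    clear h1 h2 h3 h4
    rcases key with ⟨hk | hk, hk' | hk'⟩ | ⟨hk | hk, hk' | hk'⟩ <;> omega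
  have hr : ExtendsRight n o i := by
    by_contra h
    simp only [h, false_and, or_false] at a1 a2 a3 a4
    clear h1 h2 h3 h4
    rcases key with ⟨hk | hk, hk' | hk'⟩ | ⟨hk | hk, hk' | hk'⟩ <;> omega
  have hl1 := hl.1
  have hr1 := hr.1
  refine ⟨hl, hr, ?_⟩
  have hl2 := hl.2
  have hr2 := hr.2
  simp only [CutArrow] at h1 h2 h3 h4
  obtain ⟨-, -, h1⟩ := h1
  obtain ⟨-, -, h2⟩ := h2
  clear a1 a2 a3 a4
  rcases key with ⟨hk, hk'⟩ | ⟨hk, hk'⟩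
  · refine ⟨hk, ?_⟩
    rcases hk with ⟨rfl, rfl⟩ | ⟨rfl, rfl⟩ <;> rcases hk' with ⟨rfl, rfl⟩ | ⟨rfl, rfl⟩ <;> grind
  · exfalso
    cases h : o i <;> grind (splits := 20)

theorem cut_both_same {n : ℕ} {o : ℕ → Bool} {i i' : ℕ} {σ : Equiv.Perm ℕ}
    (hσ : ∀ x y, CutArrow n o i x y ↔ CutArrow n o i' (σ x) (σ y)) (hi : i < n) (hi' : i' < n)
    (hl' : 1 ≤ i') (hi2 : 2 ≤ i) (hc : σ (i - 1) = i' - 1)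
    (hm : (σ i = i' ∧ σ (i + 1) = i' + 1) ∨ (σ i = i' + 1 ∧ σ (i + 1) = i')) : i = i' := by
  have hadj := CutArrow.adj_iff hσ
  have h1 : CutAdj n o i' (i' - 1) (σ (i - 2)) := by
    rw [← hc, ← hadj, cutAdj_iff hi]; omega
  have hne1 : σ i ≠ σ (i - 2) := by rw [σ.injective.ne_iff]; omega
  have hne2 : σ (i + 1) ≠ σ (i - 2) := by rw [σ.injective.ne_iff]; omega
  rw [cutAdj_iff hi'] at h1
  have := ((isBranch_left (a := i - 1) hi (by omega) (by omega)).match hadj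
    (isBranch_left (a := i' - 1) hi' (by omega) (by omega)) (by simpa using hc)
    (by rw [show i - 1 - 1 = i - 2 by omega]; omega)).1
  omega

theorem cut_both_opposite {n : ℕ} {o : ℕ → Bool} {i i' : ℕ} {σ : Equiv.Perm ℕ}
    (hσ : ∀ x y, CutArrow n o i x y ↔ CutArrow n o i' (σ x) (σ y)) (hi : i < n)
    (hi' : i' < n) (hr : i + 1 < n) (hr' : i' + 1 < n)
    (hl' : 1 ≤ i') (hc : σ (i - 1) = i' + 2) (hd : σ (i + 2) = i' - 1)
    (hm : (σ i = i' ∧ σ (i + 1) = i' + 1) ∨ (σ i = i' + 1 ∧ σ (i + 1) = i')) :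
    (2 ≤ i → i + i' + 1 = n ∧ ∀ s < i - 1, o (i - 2 - s) = !o (i' + 2 + s)) ∧
      (i + 2 < n → i + i' + 1 = n ∧ ∀ s < n - (i + 2), o (i + 2 + s) = !o (i' - 2 - s)) := by
  have hadj := CutArrow.adj_iff hσ
  constructor
  · intro hi2
    have h1 : CutAdj n o i' (i' + 2) (σ (i - 2)) := by
      rw [← hc, ← hadj, cutAdj_iff hi]; omega
    have hne1 : σ i ≠ σ (i - 2) := by rw [σ.injective.ne_iff]; omega
    have hne2 : σ (i + 1) ≠ σ (i - 2) := by rw [σ.injective.ne_iff]; omega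
    rw [cutAdj_iff hi'] at h1
    obtain ⟨hlen, hw⟩ := (isBranch_left (a := i - 1) hi (by omega) (by omega)).match hadj
      (isBranch_right (a := i' + 2) hi' (by omega) (by omega)) (by simpa using hc)
      (by rw [show i - 1 - 1 = i - 2 by omega]; omega)
    refine ⟨by omega, fun s hs => ?_⟩
    have d := hσ (i - 1 - s) (i - 1 - (s + 1))
    rw [hw s (by omega), hw (s + 1) (by omega), cutArrow_left hi (by omega) hs,
      cutArrow_right le_rfl (by omega), Nat.sub_sub i 1 1] at d
    cases h1 : o (i - 2 - s) <;> cases h2 : o (i' + 2 + s) <;> grind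
  · intro hi2
    have h1 : CutAdj n o i' (i' - 1) (σ (i + 3)) := by
      rw [← hd, ← hadj, cutAdj_iff hi]; omega
    have hne1 : σ i ≠ σ (i + 3) := by rw [σ.injective.ne_iff]; omega
    have hne2 : σ (i + 1) ≠ σ (i + 3) := by rw [σ.injective.ne_iff]; omega
    rw [cutAdj_iff hi'] at h1
    obtain ⟨hlen, hw⟩ := (isBranch_right (a := i + 2) hi (by omega) (by omega)).match hadj
      (isBranch_left (a := i' - 1) hi' (by omega) (by omega)) (by simpa using hd)
      (by rw [show i + 2 + 1 = i + 3 by omega]; omega)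
    refine ⟨by omega, fun s hs => ?_⟩
    have d := hσ (i + 2 + s) (i + 2 + (s + 1))
    rw [hw s (by omega), hw (s + 1) (by omega), cutArrow_right le_rfl (by omega),
      cutArrow_left hi' (by omega) (by omega), Nat.sub_sub i' 1 1] at d
    cases h1 : o (i + 2 + s) <;> cases h2 : o (i' - 2 - s) <;> grind

theorem CutArrow.symm_iff {n : ℕ} {o : ℕ → Bool} {i i' : ℕ} {σ : Equiv.Perm ℕ}
    (hσ : ∀ x y, CutArrow n o i x y ↔ CutArrow n o i' (σ x) (σ y)) (x y : ℕ) :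
    CutArrow n o i' x y ↔ CutArrow n o i (σ.symm x) (σ.symm y) := by
  rw [hσ, σ.apply_symm_apply, σ.apply_symm_apply]

theorem cut_both_image {n : ℕ} {o : ℕ → Bool} {i i' : ℕ} {σ : Equiv.Perm ℕ}
    (hσ : ∀ x y, CutArrow n o i x y ↔ CutArrow n o i' (σ x) (σ y))
    (hi' : i' < n) (hl : ExtendsLeft o i) (hr : ExtendsRight n o i) :
    ExtendsLeft o i' ∧ ExtendsRight n o i' ∧
      ((σ i = i' ∧ σ (i + 1) = i' + 1) ∨ (σ i = i' + 1 ∧ σ (i + 1) = i')) ∧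
      ((o i = o i' ∧ σ (i - 1) = i' - 1 ∧ σ (i + 2) = i' + 2) ∨
        (o i = !o i' ∧ σ (i - 1) = i' + 2 ∧ σ (i + 2) = i' - 1)) := by
  have hne : σ i ≠ σ (i + 1) := by rw [σ.injective.ne_iff]; omega
  obtain ⟨hl1, hl2⟩ := hl
  obtain ⟨hr1, hr2⟩ := hr
  cases h : o i
  · obtain ⟨a, b, c, d⟩ := CutArrow.diamond (u := σ (i + 2)) (x := σ i) (y := σ (i + 1))
      (v := σ (i - 1)) hi' hne (by rw [← hσ]; simp only [CutArrow]; grind)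
      (by rw [← hσ]; simp only [CutArrow]; grind) (by rw [← hσ]; simp only [CutArrow]; grind)
      (by rw [← hσ]; simp only [CutArrow]; grind)
    exact ⟨a, b, c, by cases h' : o i' <;> grind⟩
  · obtain ⟨a, b, c, d⟩ := CutArrow.diamond (v := σ (i + 2)) (x := σ i) (y := σ (i + 1))
      (u := σ (i - 1)) hi' hne (by rw [← hσ]; simp only [CutArrow]; grind)
      (by rw [← hσ]; simp only [CutArrow]; grind) (by rw [← hσ]; simp only [CutArrow]; grind)
      (by rw [← hσ]; simp only [CutArrow]; grind)
    exact ⟨a, b, c, by cases h' : o i' <;> grind⟩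

/-- The square goes to the square. If the directions of the cut edges agree, left tail goes to left
tail and their lengths give `i = i'`; if they disagree the tails are exchanged with opposite words.
-/
theorem cut_both {n : ℕ} {o : ℕ → Bool} {i i' : ℕ} {σ : Equiv.Perm ℕ}
    (hσ : ∀ x y, CutArrow n o i x y ↔ CutArrow n o i' (σ x) (σ y)) (hi : i < n)
    (hi' : i' < n) (hl : ExtendsLeft o i) (hr : ExtendsRight n o i) :
    i = i' ∨ (i' = n - 1 - i ∧ ∀ t < n, o (n - 1 - t) = !o t) := by
  obtain ⟨hl', hr', hm, h⟩ := cut_both_image hσ hi' hl hr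
  have hl1 := hl.1
  have hr1 := hr.1
  have hl1' := hl'.1
  have hr1' := hr'.1
  rcases h with ⟨ho, hc, hd⟩ | ⟨ho, hc, hd⟩
  · left
    by_cases h1 : 2 ≤ i
    · exact cut_both_same hσ hi hi' hl1' h1 hc hm
    · by_cases h2 : 2 ≤ i'
      · refine (cut_both_same (CutArrow.symm_iff hσ) hi' hi hl1 h2 ?_ ?_).symm
        · rw [← hc, σ.symm_apply_apply]
        · rcases hm with hm | hm
          · left; constructor <;> rw [Equiv.symm_apply_eq] <;> simp [hm]
          · right; constructor <;> rw [Equiv.symm_apply_eq] <;> simp [hm]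
      · omega
  · right
    obtain ⟨hL, hR⟩ := cut_both_opposite hσ hi hi' hr1 hr1' hl1' hc hd hm
    have hsum : i + i' + 1 = n := by
      by_cases h1 : 2 ≤ i
      · exact (hL h1).1
      · by_cases h2 : i + 2 < n
        · exact (hR h2).1
        · omega
    refine ⟨by omega, fun t ht => ?_⟩
    rcases Nat.lt_or_ge (t + 1) i with h | h
    · have := (hL (by omega)).2 (i - 2 - t) (by omega)
      rw [show i - 2 - (i - 2 - t) = t by omega,
        show i' + 2 + (i - 2 - t) = n - 1 - t by omega] at this
      rw [this, Bool.not_not]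
    · rcases Nat.lt_or_ge (i + 1) t with h' | h'
      · have := (hR (by omega)).2 (t - (i + 2)) (by omega)
        rw [show i + 2 + (t - (i + 2)) = t by omega,
          show i' - 2 - (t - (i + 2)) = n - 1 - t by omega] at this
        rw [this, Bool.not_not]
      -- The edges `i - 1`, `i`, `i + 1` belong to no tail, but all three have the direction of the
      -- cut edge.
      · have hl2 := hl.2
        have hl2' := hl'.2
        have hr2 := hr.2
        have hr2' := hr'.2
        have : t = i - 1 ∧ n - 1 - t = i' + 1 ∨ t = i ∧ n - 1 - t = i' ∨
          t = i + 1 ∧ n - 1 - t = i' - 1 := by omega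
        rcases this with ⟨h1, h2⟩ | ⟨h1, h2⟩ | ⟨h1, h2⟩ <;> rw [h2, h1] <;>
          simp only [hl2, hr2, hl2', hr2', ho, Bool.not_not]

/-- Reflecting the line reverses every direction as read from left to right, hence the negation in
the new word. No symmetry of `o` is assumed: this only transfers left-handed results to right-handed
ones. -/
theorem cutArrow_flip {n : ℕ} {o : ℕ → Bool} {i x y : ℕ} (hi : i < n) (hx : x ≤ n) (hy : y ≤ n) :
    CutArrow n (fun t => !o (n - 1 - t)) (n - 1 - i) (n - x) (n - y) ↔ CutArrow n o i x y := by
  simp only [CutArrow]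
  have e1 : y = x + 1 → n - 1 - (n - y) = x := by omega
  have e2 : x = y + 1 → n - 1 - (n - x) = y := by omega
  have e3 : x = y + 2 → n - 1 - (n - x) = y + 1 ∧ n - 1 - (n - x + 1) = y := by omega
  have e4 : y = x + 2 → n - 1 - (n - y) = x + 1 ∧ n - 1 - (n - y + 1) = x := by omega
  constructor
  · rintro ⟨-, -, h | h | h | h⟩
    · have := e2 (by omega); grind
    · have := e1 (by omega); grind
    · have := e3 (by omega); grind
    · have := e4 (by omega); grind
  · rintro ⟨-, -, h | h | h | h⟩
    · have := e1 (by omega); grind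
    · have := e2 (by omega); grind
    · have := e4 (by omega); grind
    · have := e3 (by omega); grind
/-- The reflection of the line `0, …, n`, as a permutation of `ℕ`. -/
def reflectPerm (n : ℕ) : Equiv.Perm ℕ :=
  Function.Involutive.toPerm (fun x => if x ≤ n then n - x else x) fun x => by
    by_cases h : x ≤ n <;> simp [h]; try omega

theorem reflectPerm_apply (n x : ℕ) : reflectPerm n x = if x ≤ n then n - x else x := rfl

theorem cutArrow_reflectPerm {n : ℕ} {o : ℕ → Bool} {i : ℕ} (hi : i < n) (x y : ℕ) :
    CutArrow n (fun t => !o (n - 1 - t)) (n - 1 - i) (reflectPerm n x) (reflectPerm n y) ↔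
      CutArrow n o i x y := by
  by_cases hx : x ≤ n
  · by_cases hy : y ≤ n
    · rw [reflectPerm_apply, reflectPerm_apply, if_pos hx, if_pos hy, cutArrow_flip hi hx hy]
    · simp [CutArrow, reflectPerm_apply, hy]
  · simp [CutArrow, reflectPerm_apply, hx]

theorem extendsLeft_flip {n : ℕ} {o : ℕ → Bool} {i : ℕ} (hi : i < n) :
    ExtendsLeft (fun t => !o (n - 1 - t)) (n - 1 - i) ↔ ExtendsRight n o i := by
  simp only [ExtendsLeft, ExtendsRight, Bool.not_inj_iff]
  constructor
  · rintro ⟨h1, h2⟩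
    rw [show n - 1 - (n - 1 - i - 1) = i + 1 by omega, show n - 1 - (n - 1 - i) = i by omega] at h2
    exact ⟨by omega, h2⟩
  · rintro ⟨h1, h2⟩
    rw [show n - 1 - (n - 1 - i - 1) = i + 1 by omega, show n - 1 - (n - 1 - i) = i by omega]
    exact ⟨by omega, h2⟩

theorem extendsRight_flip {n : ℕ} {o : ℕ → Bool} {i : ℕ} (hi : i < n) :
    ExtendsRight n (fun t => !o (n - 1 - t)) (n - 1 - i) ↔ ExtendsLeft o i := by
  simp only [ExtendsLeft, ExtendsRight, Bool.not_inj_iff]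
  constructor
  · rintro ⟨h1, h2⟩
    rw [show n - 1 - (n - 1 - i + 1) = i - 1 by omega, show n - 1 - (n - 1 - i) = i by omega] at h2
    exact ⟨by omega, h2⟩
  · rintro ⟨h1, h2⟩
    rw [show n - 1 - (n - 1 - i + 1) = i - 1 by omega, show n - 1 - (n - 1 - i) = i by omega]
    exact ⟨by omega, h2⟩

theorem cut_right_right {n : ℕ} {o : ℕ → Bool} {i i' : ℕ} {σ : Equiv.Perm ℕ}
    (hσ : ∀ x y, CutArrow n o i x y ↔ CutArrow n o i' (σ x) (σ y)) (hi : i < n)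
    (hi' : i' < n) (hl : ¬ ExtendsLeft o i) (hr : ExtendsRight n o i)
    (hl' : ¬ ExtendsLeft o i') (hr' : ExtendsRight n o i') : i ≤ i' := by
  have := cut_left_left (n := n) (o := fun t => !o (n - 1 - t)) (i := n - 1 - i)
    (i' := n - 1 - i') (σ := ((reflectPerm n).symm.trans σ).trans (reflectPerm n))
    (fun x y => by
      obtain ⟨x, rfl⟩ := (reflectPerm n).surjective x
      obtain ⟨y, rfl⟩ := (reflectPerm n).surjective y
      simp only [Equiv.trans_apply, Equiv.symm_apply_apply]
      rw [cutArrow_reflectPerm hi, cutArrow_reflectPerm hi', hσ])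
    (by omega) (by rwa [extendsLeft_flip hi]) (by rwa [extendsRight_flip hi])
    (by rwa [extendsLeft_flip hi']) (by rwa [extendsRight_flip hi'])
  omega

/-- The Hasse quiver of the path order with one edge removed determines that edge up to a
reflection of the line. -/
theorem cutArrow_rigid {n : ℕ} {o : ℕ → Bool} {i i' : ℕ} {σ : Equiv.Perm ℕ}
    (hσ : ∀ x y, CutArrow n o i x y ↔ CutArrow n o i' (σ x) (σ y)) (hi : i < n) (hi' : i' < n)
    (hc : ExtendsLeft o i ∨ ExtendsRight n o i) (hc' : ExtendsLeft o i' ∨ ExtendsRight n o i') :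
    i = i' ∨ (i' = n - 1 - i ∧ ∀ t < n, o (n - 1 - t) = !o t) := by
  have hσ' := CutArrow.symm_iff hσ
  by_cases hl : ExtendsLeft o i <;> by_cases hr : ExtendsRight n o i
  · exact cut_both hσ hi hi' hl hr
  all_goals
    by_cases hl' : ExtendsLeft o i' <;> by_cases hr' : ExtendsRight n o i'
    · rcases cut_both hσ' hi' hi hl' hr' with h | ⟨h, h'⟩
      · exact Or.inl h.symm
      · exact Or.inr ⟨by omega, h'⟩
  · exact Or.inl (le_antisymm (cut_left_left hσ' hi hl' hr' hl hr)
      (cut_left_left hσ hi' hl hr hl' hr'))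
  · exact Or.inr (cut_left_right hσ hi hi' hl hr hl' hr')
  · simp_all
  · have := cut_left_right hσ' hi' hi hl' hr' hl hr
    exact Or.inr ⟨by omega, this.2⟩
  · exact Or.inl (le_antisymm (cut_right_right hσ hi hi' hl hr hl' hr')
      (cut_right_right hσ' hi' hi hl' hr' hl hr))
  all_goals simp_all

/-! ### The path order and its covering pairs -/

/-- The path order of an oriented line: there is a path from `x` to `y`. -/
def LineRel (o : ℕ → Bool) (x y : ℕ) : Prop :=
  (∀ t, x ≤ t → t < y → o t = true) ∧ (∀ t, y ≤ t → t < x → o t = false)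

/-- The path order with the edge `i` removed. -/
def CutRel (o : ℕ → Bool) (i x y : ℕ) : Prop :=
  LineRel o x y ∧ ¬ (x = i ∧ y = i + 1) ∧ ¬ (x = i + 1 ∧ y = i)

theorem LineRel.refl (o : ℕ → Bool) (x : ℕ) : LineRel o x x :=
  ⟨fun t _ _ => by omega, fun t _ _ => by omega⟩

theorem LineRel.trans {o : ℕ → Bool} {x y z : ℕ} (h : LineRel o x y) (h' : LineRel o y z) :
    LineRel o x z := by
  have k1 : x < y → z < y → False := fun h1 h2 => by
    have e1 := h.1 (y - 1) (by omega) (by omega)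
    have e2 := h'.2 (y - 1) (by omega) (by omega)
    simp [e1] at e2
  have k2 : y < x → y < z → False := fun h1 h2 => by
    have e1 := h.2 y (by omega) (by omega)
    have e2 := h'.1 y (by omega) (by omega)
    simp [e1] at e2
  constructor
  · intro t h1 h2
    by_cases h3 : t < y
    · exact h.1 t h1 h3
    · exact h'.1 t (by omega) h2
  · intro t h1 h2
    by_cases h3 : t < y
    · exact h'.2 t h1 h3
    · exact h.2 t (by omega) h2

theorem LineRel.antisymm {o : ℕ → Bool} {x y : ℕ} (h : LineRel o x y) (h' : LineRel o y x) :
    x = y := by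
  by_contra hne
  rcases Nat.lt_or_gt_of_ne hne with h1 | h1
  · have e1 := h.1 x le_rfl h1
    have e2 := h'.2 x le_rfl h1
    simp [e1] at e2
  · have e1 := h.2 y le_rfl h1
    have e2 := h'.1 y le_rfl h1
    simp [e1] at e2
-- A directed path on a line cannot turn back, since it would use the same edge in both directions.
theorem LineRel.between {o : ℕ → Bool} {x y z : ℕ} (h : LineRel o x z) (h' : LineRel o z y) :
    (x ≤ y → x ≤ z ∧ z ≤ y) ∧ (y ≤ x → y ≤ z ∧ z ≤ x) := by
  have k1 : ¬ (x < z ∧ y < z) := fun ⟨h1, h2⟩ => by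
    have e1 := h.1 (z - 1) (by omega) (by omega)
    have e2 := h'.2 (z - 1) (by omega) (by omega)
    simp [e1] at e2
  have k2 : ¬ (z < x ∧ z < y) := fun ⟨h1, h2⟩ => by
    have e1 := h.2 z (by omega) (by omega)
    have e2 := h'.1 z (by omega) (by omega)
    simp [e1] at e2
  omega

theorem lineRel_succ {o : ℕ → Bool} {x : ℕ} : LineRel o x (x + 1) ↔ o x = true :=
  ⟨fun h => h.1 x le_rfl (by omega), fun h => ⟨fun t h1 h2 => by
    obtain rfl : t = x := by omega
    exact h, fun t h1 h2 => by omega⟩⟩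

theorem lineRel_succ' {o : ℕ → Bool} {x : ℕ} : LineRel o (x + 1) x ↔ o x = false :=
  ⟨fun h => h.2 x le_rfl (by omega), fun h => ⟨fun t h1 h2 => by omega, fun t h1 h2 => by
    obtain rfl : t = x := by omega
    exact h⟩⟩

/-- When the pair of edge `i` is removed, a relation of length two through that edge loses its only
intermediate vertex and becomes a cover. Anything longer still has an intermediate vertex. -/
theorem cutArrow_iff_cover {n : ℕ} {o : ℕ → Bool} {i x y : ℕ} (hx : x ≤ n)
    (hy : y ≤ n) : CutArrow n o i x y ↔ CutRel o i x y ∧ x ≠ y ∧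
      ∀ z ≤ n, CutRel o i x z → CutRel o i z y → z = x ∨ z = y := by
  constructor
  · rintro ⟨-, -, ⟨rfl, h1, h2⟩ | ⟨rfl, h1, h2⟩ | ⟨rfl, h1, h2, h3⟩ | ⟨rfl, h1, h2, h3⟩⟩
    · refine ⟨⟨lineRel_succ.2 h2, by omega, by omega⟩, by omega, fun z _ hz hz' => ?_⟩
      have := hz.1.between hz'.1
      omega
    · refine ⟨⟨lineRel_succ'.2 h2, by omega, by omega⟩, by omega, fun z _ hz hz' => ?_⟩
      have := hz.1.between hz'.1
      omega
    · refine ⟨⟨(lineRel_succ.2 h2).trans (lineRel_succ.2 h3), by omega, by omega⟩, by omega,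
        fun z _ hz hz' => ?_⟩
      have := hz.1.between hz'.1
      have := hz.2
      have := hz'.2
      omega
    · refine ⟨⟨(lineRel_succ'.2 h3).trans (lineRel_succ'.2 h2), by omega, by omega⟩, by omega,
        fun z _ hz hz' => ?_⟩
      have := hz.1.between hz'.1
      have := hz.2
      have := hz'.2
      omega
  · rintro ⟨⟨h1, h2⟩, hne, hcov⟩
    refine ⟨hx, hy, ?_⟩
    rcases Nat.lt_or_gt_of_ne hne with h | h
    · have sub : ∀ a b, x ≤ a → a ≤ b → b ≤ y → LineRel o a b := fun a b ha hab hb =>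
        ⟨fun t h3 h4 => h1.1 t (by omega) (by omega), fun t h3 h4 => by omega⟩
      have o1 := lineRel_succ.1 (sub x (x + 1) le_rfl (by omega) (by omega))
      rcases (by omega : y = x + 1 ∨ x + 2 ≤ y) with h3 | h3
      · left; exact ⟨h3, by omega, o1⟩
      · right; right; left
        have o2 := lineRel_succ.1 (sub (x + 1) (x + 2) (by omega) (by omega) (by omega))
        have c1 : x ≠ i → i = x + 1 ∧ y = x + 2 := fun hxi => by
          by_contra hcon
          have := hcov (x + 1) (by omega) ⟨sub _ _ (by omega) (by omega) (by omega), by omega⟩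
            ⟨sub _ _ (by omega) (by omega) (by omega), by omega⟩
          omega
        have c2 : x = i → y = x + 2 := fun hxi => by
          by_contra hcon
          have := hcov (x + 2) (by omega) ⟨sub _ _ (by omega) (by omega) (by omega), by omega⟩
            ⟨sub _ _ (by omega) (by omega) (by omega), by omega⟩
          omega
        exact ⟨by omega, by omega, o1, o2⟩
    · have sub : ∀ a b, y ≤ b → b ≤ a → a ≤ x → LineRel o a b := fun a b ha hab hb =>
        ⟨fun t h3 h4 => by omega, fun t h3 h4 => h1.2 t (by omega) (by omega)⟩
      have o1 := lineRel_succ'.1 (sub (y + 1) y le_rfl (by omega) (by omega))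
      rcases (by omega : x = y + 1 ∨ y + 2 ≤ x) with h3 | h3
      · right; left; exact ⟨h3, by omega, o1⟩
      · right; right; right
        have o2 := lineRel_succ'.1 (sub (y + 2) (y + 1) (by omega) (by omega) (by omega))
        have c1 : y ≠ i → i = y + 1 ∧ x = y + 2 := fun hxi => by
          by_contra hcon
          have := hcov (y + 1) (by omega) ⟨sub _ _ (by omega) (by omega) (by omega), by omega⟩
            ⟨sub _ _ (by omega) (by omega) (by omega), by omega⟩
          omega
        have c2 : y = i → x = y + 2 := fun hxi => by
          by_contra hcon
          have := hcov (y + 2) (by omega) ⟨sub _ _ (by omega) (by omega) (by omega), by omega⟩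
            ⟨sub _ _ (by omega) (by omega) (by omega), by omega⟩
          omega
        exact ⟨by omega, by omega, o1, o2⟩

/-- The extension of a permutation of `Fin m` to `ℕ` by the identity. -/
def natPerm {m : ℕ} (σ : Equiv.Perm (Fin m)) : Equiv.Perm ℕ :=
  σ.extendDomain Fin.equivSubtype

theorem natPerm_val {m : ℕ} (σ : Equiv.Perm (Fin m)) (x : Fin m) :
    natPerm σ x = σ x := σ.extendDomain_apply_image Fin.equivSubtype x

theorem natPerm_of_le {m : ℕ} (σ : Equiv.Perm (Fin m)) {x : ℕ} (h : m ≤ x) :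
    natPerm σ x = x := σ.extendDomain_apply_not_subtype _ (by simpa using h)

theorem natPerm_lt_iff {m : ℕ} (σ : Equiv.Perm (Fin m)) {x : ℕ} :
    natPerm σ x < m ↔ x < m := by
  by_cases h : x < m
  · simp only [h, iff_true]
    rw [show x = ((⟨x, h⟩ : Fin m) : ℕ) from rfl, natPerm_val]
    exact Fin.isLt _
  · rw [natPerm_of_le σ (by omega)]

/-- An order isomorphism preserves covers, so `cutArrow_rigid` applies. The extension of `σ` by the
identity is harmless because there are no arrows beyond `n`. -/
theorem cutRel_rigid {n : ℕ} {o : ℕ → Bool} {i i' : ℕ} {σ : Equiv.Perm (Fin (n + 1))}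
    (hσ : ∀ x y : Fin (n + 1), CutRel o i x y ↔ CutRel o i' (σ x) (σ y)) (hi : i < n) (hi' : i' < n)
    (hc : ExtendsLeft o i ∨ ExtendsRight n o i) (hc' : ExtendsLeft o i' ∨ ExtendsRight n o i') :
    i = i' ∨ (i' = n - 1 - i ∧ ∀ t < n, o (n - 1 - t) = !o t) := by
  have hle : ∀ x, natPerm σ x ≤ n ↔ x ≤ n := fun x => by
    have := natPerm_lt_iff σ (x := x); omega
  have hrel : ∀ x y, x ≤ n → y ≤ n →
      (CutRel o i x y ↔ CutRel o i' (natPerm σ x) (natPerm σ y)) := fun x y hx hy => by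
    have := hσ ⟨x, by omega⟩ ⟨y, by omega⟩
    rwa [← natPerm_val, ← natPerm_val] at this
  refine cutArrow_rigid (σ := natPerm σ) (fun x y => ?_) hi hi' hc hc'
  by_cases hx : x ≤ n
  · by_cases hy : y ≤ n
    · rw [cutArrow_iff_cover hx hy, cutArrow_iff_cover ((hle x).2 hx) ((hle y).2 hy),
        hrel x y hx hy, (natPerm σ).injective.ne_iff]
      refine and_congr_right fun _ => and_congr_right fun _ => ?_
      constructor
      · intro h z hz h1 h2
        obtain ⟨z, rfl⟩ := (natPerm σ).surjective z
        rw [hle] at hz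
        rw [(natPerm σ).injective.eq_iff, (natPerm σ).injective.eq_iff]
        exact h z hz ((hrel _ _ hx hz).2 h1) ((hrel _ _ hz hy).2 h2)
      · intro h z hz h1 h2
        have := h _ ((hle z).2 hz) ((hrel _ _ hx hz).1 h1) ((hrel _ _ hz hy).1 h2)
        rwa [(natPerm σ).injective.eq_iff, (natPerm σ).injective.eq_iff] at this
    · simp [CutArrow, hle, hy]
  · simp [CutArrow, hle, hx]
end CutQuiverCombinatorics

/-! ### Rigidity of a line with two vertices identified -/

section GlueCombinatorics

/-- The map identifying the vertex `j` with the vertex `i`. -/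
def mergeVertex (i j x : ℕ) : ℕ := if x = j then i else x

/-- The source of the edge `t` joining `t` and `t + 1`. -/
def edgeSource (o : ℕ → Bool) (t : ℕ) : ℕ := bif o t then t else t + 1

/-- The target of the edge `t` joining `t` and `t + 1`. -/
def edgeTarget (o : ℕ → Bool) (t : ℕ) : ℕ := bif o t then t + 1 else t

/-- An isomorphism, given by `σ` on vertices and `τ` on edges, between the quivers obtained from an
oriented line by identifying the vertices `i` and `j`, respectively `i'` and `j'`. -/
structure GlueIso (n : ℕ) (o : ℕ → Bool) (i j i' j' : ℕ) (σ τ : Equiv.Perm ℕ) : Prop where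
  lt : i < j
  le : j ≤ n
  lt' : i' < j'
  le' : j' ≤ n
  map_right : σ j = j'
  map_le : ∀ x, σ x ≤ n ↔ x ≤ n
  map_lt : ∀ t, τ t < n ↔ t < n
  source : ∀ t < n, σ (mergeVertex i j (edgeSource o t)) = mergeVertex i' j' (edgeSource o (τ t))
  target : ∀ t < n, σ (mergeVertex i j (edgeTarget o t)) = mergeVertex i' j' (edgeTarget o (τ t))

namespace GlueIso

variable {n : ℕ} {o : ℕ → Bool} {i j i' j' : ℕ} {σ τ : Equiv.Perm ℕ}

theorem symm (h : GlueIso n o i j i' j' σ τ) : GlueIso n o i' j' i j σ.symm τ.symm where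
  lt := h.lt'
  le := h.le'
  lt' := h.lt
  le' := h.le
  map_right := by rw [← h.map_right, σ.symm_apply_apply]
  map_le x := by rw [← h.map_le, σ.apply_symm_apply]
  map_lt x := by rw [← h.map_lt, τ.apply_symm_apply]
  source t ht := by
    rw [Equiv.symm_apply_eq, h.source _ (by rwa [← h.map_lt, τ.apply_symm_apply]),
      τ.apply_symm_apply]
  target t ht := by
    rw [Equiv.symm_apply_eq, h.target _ (by rwa [← h.map_lt, τ.apply_symm_apply]),
      τ.apply_symm_apply]

/-- An edge is carried over either along the numbering or against it, and this decides whether the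
letter of the word is kept or negated. -/
theorem ends (h : GlueIso n o i j i' j' σ τ) {t : ℕ} (ht : t < n) :
    (o t = o (τ t) ∧ σ (mergeVertex i j t) = mergeVertex i' j' (τ t) ∧
      σ (mergeVertex i j (t + 1)) = mergeVertex i' j' (τ t + 1)) ∨
    (o t = (!o (τ t)) ∧ σ (mergeVertex i j t) = mergeVertex i' j' (τ t + 1) ∧
      σ (mergeVertex i j (t + 1)) = mergeVertex i' j' (τ t)) := by
  have h1 := h.source t ht
  have h2 := h.target t ht
  simp only [edgeSource, edgeTarget] at h1 h2
  cases h3 : o t <;> cases h4 : o (τ t) <;> simp_all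

theorem inc_iff (h : GlueIso n o i j i' j' σ τ) {t v : ℕ} (ht : t < n) :
    (mergeVertex i j t = v ∨ mergeVertex i j (t + 1) = v) ↔
      (mergeVertex i' j' (τ t) = σ v ∨ mergeVertex i' j' (τ t + 1) = σ v) := by
  rcases h.ends ht with ⟨-, h1, h2⟩ | ⟨-, h1, h2⟩ <;> rw [← h1, ← h2] <;> simp [or_comm]

theorem loop_iff (h : GlueIso n o i j i' j' σ τ) {t : ℕ} (ht : t < n) :
    mergeVertex i j t = mergeVertex i j (t + 1) ↔
      mergeVertex i' j' (τ t) = mergeVertex i' j' (τ t + 1) := by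
  rcases h.ends ht with ⟨-, h1, h2⟩ | ⟨-, h1, h2⟩ <;> rw [← h1, ← h2] <;> simp [eq_comm]

theorem word_same (h : GlueIso n o i j i' j' σ τ) {t : ℕ} (ht : t < n)
    (hl : mergeVertex i j t ≠ mergeVertex i j (t + 1))
    (he : σ (mergeVertex i j t) = mergeVertex i' j' (τ t)) : o t = o (τ t) := by
  rcases h.ends ht with ⟨e, -⟩ | ⟨-, e, -⟩
  · exact e
  · exact absurd ((h.loop_iff ht).2 (he.symm.trans e)) hl

theorem word_flip (h : GlueIso n o i j i' j' σ τ) {t : ℕ} (ht : t < n)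
    (hl : mergeVertex i j t ≠ mergeVertex i j (t + 1))
    (he : σ (mergeVertex i j t) = mergeVertex i' j' (τ t + 1)) : o t = !o (τ t) := by
  rcases h.ends ht with ⟨-, e, -⟩ | ⟨e, -⟩
  · exact absurd ((h.loop_iff ht).2 (e.symm.trans he)) hl
  · exact e

/-- Walking along the line on both sides, as long as the vertices on the way are incident with
two edges only. -/
theorem walk (h : GlueIso n o i j i' j' σ τ) {X Y F G : ℕ → ℕ} {m : ℕ} (hm : 0 < m)
    (hF : ∀ s < m, F s < n ∧
      ((mergeVertex i j (F s) = X s ∧ mergeVertex i j (F s + 1) = X (s + 1)) ∨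
        (mergeVertex i j (F s) = X (s + 1) ∧ mergeVertex i j (F s + 1) = X s)))
    (hG : ∀ s < m,
      ((mergeVertex i' j' (G s) = Y s ∧ mergeVertex i' j' (G s + 1) = Y (s + 1)) ∨
        (mergeVertex i' j' (G s) = Y (s + 1) ∧ mergeVertex i' j' (G s + 1) = Y s)))
    (hY : ∀ s, s + 1 < m → ∀ e < n,
      (mergeVertex i' j' e = Y (s + 1) ∨ mergeVertex i' j' (e + 1) = Y (s + 1)) →
        e = G s ∨ e = G (s + 1))
    (hne : ∀ s, s + 1 < m → F s ≠ F (s + 1)) (h0 : σ (X 0) = Y 0) (he : τ (F 0) = G 0) :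
    ∀ s < m, τ (F s) = G s ∧ σ (X s) = Y s ∧ σ (X (s + 1)) = Y (s + 1) := by
  have step : ∀ s < m, τ (F s) = G s → σ (X s) = Y s → σ (X (s + 1)) = Y (s + 1) := by
    intro s hs h1 h2
    obtain ⟨hlt, hF⟩ := hF s hs
    have hG := hG s hs
    rcases h.ends hlt with ⟨-, e1, e2⟩ | ⟨-, e1, e2⟩ <;> rw [h1] at e1 e2 <;>
      rcases hF with ⟨f1, f2⟩ | ⟨f1, f2⟩ <;> rcases hG with ⟨g1, g2⟩ | ⟨g1, g2⟩ <;>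
      simp_all
  intro s
  induction s with
  | zero => exact fun hs => ⟨he, h0, step 0 hm he h0⟩
  | succ s ih =>
    intro hs
    obtain ⟨i1, i2, i3⟩ := ih (by omega)
    have hF1 := hF (s + 1) hs
    have hinc : mergeVertex i j (F (s + 1)) = X (s + 1) ∨
        mergeVertex i j (F (s + 1) + 1) = X (s + 1) := by
      rcases hF1.2 with h | h
      · exact Or.inl h.1
      · exact Or.inr h.2
    rw [h.inc_iff hF1.1, i3] at hinc
    have key : τ (F (s + 1)) = G (s + 1) := by
      rcases hY s hs _ ((h.map_lt _).2 hF1.1) hinc with e | e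
      · exact absurd (τ.injective (i1.trans e.symm)) (hne s hs)
      · exact e
    exact ⟨key, i3, step (s + 1) hs key i3⟩

/-- If the line extends beyond the glued pair, at least three edges, or a loop and another edge,
meet at the merged vertex. Any other vertex meets at most two edges and no loop. For `i = 0` and `j
= n` the quiver is a plain cycle and nothing distinguishes the merged vertex. -/
theorem map_left (h : GlueIso n o i j i' j' σ τ) (ht : 0 < i ∨ j < n) : σ i = i' := by
  by_contra hne
  have hij := h.lt
  have hjn := h.le
  have h1 : σ i ≠ j' := by rw [← h.map_right, σ.injective.ne_iff]; omega
  have inc : ∀ t < n, (mergeVertex i j t = i ∨ mergeVertex i j (t + 1) = i) →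
      τ t = σ i ∨ τ t + 1 = σ i := fun t ht hi => by
    rw [h.inc_iff ht] at hi
    simp only [mergeVertex] at hi
    grind
  have e1 := inc i (by omega) (Or.inl (by simp [mergeVertex]))
  have e2 := inc (j - 1) (by omega) (Or.inr (by simp [mergeVertex]; omega))
  obtain ⟨e, he1, he2, he3, he4⟩ : ∃ e < n, e ≠ i ∧ e ≠ j - 1 ∧
      (mergeVertex i j e = i ∨ mergeVertex i j (e + 1) = i) := by
    rcases ht with ht | ht
    · exact ⟨i - 1, by omega, by omega, by omega, Or.inr (by simp [mergeVertex]; omega)⟩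
    · exact ⟨j, by omega, by omega, by omega, Or.inl (by simp [mergeVertex])⟩
  have e3 := inc e he1 he4
  have n1 : τ e ≠ τ i := τ.injective.ne_iff.2 he2
  have n2 : τ e ≠ τ (j - 1) := τ.injective.ne_iff.2 he3
  by_cases hL : i = j - 1
  · have := (h.loop_iff (t := i) (by omega)).1 (by simp only [mergeVertex]; grind)
    simp only [mergeVertex] at this
    have := h.lt'
    grind
  · have n3 : τ i ≠ τ (j - 1) := τ.injective.ne_iff.2 hL
    omega

end GlueIso

/-- The vertices of the left (`false`) or right (`true`) end of a line, numbered from the end. -/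
def endVertex (n : ℕ) (ε : Bool) (s : ℕ) : ℕ := bif ε then n - s else s

/-- The edges of the left (`false`) or right (`true`) end of a line, numbered from the end. -/
def endEdge (n : ℕ) (ε : Bool) (s : ℕ) : ℕ := bif ε then n - 1 - s else s

/-- The length of the part of a line before `i` (`false`) or after `j` (`true`). -/
def endLength (n i j : ℕ) (ε : Bool) : ℕ := bif ε then n - j else i

namespace GlueIso

variable {n : ℕ} {o : ℕ → Bool} {i j i' j' : ℕ} {σ τ : Equiv.Perm ℕ}

/-- A free end meets one edge and is not the merged vertex. Its image has the same properties, and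
inner vertices of the line meet two edges. -/
theorem exists_end (h : GlueIso n o i j i' j' σ τ) {ε : Bool} (hε : 0 < endLength n i j ε) :
    ∃ ε', 0 < endLength n i' j' ε' ∧ σ (endVertex n ε 0) = endVertex n ε' 0 := by
  have hij := h.lt
  have hjn := h.le
  have hij' := h.lt'
  have hjn' := h.le'
  have hi : σ i = i' := h.map_left (by cases ε <;> simp [endLength] at hε <;> omega)
  have hv : endVertex n ε 0 ≠ i ∧ endVertex n ε 0 ≠ j ∧ endVertex n ε 0 ≤ n := by
    cases ε <;> simp [endLength, endVertex] at hε ⊢ <;> omega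
  have w1 : σ (endVertex n ε 0) ≠ i' := by rw [← hi, σ.injective.ne_iff]; exact hv.1
  have w2 : σ (endVertex n ε 0) ≠ j' := by rw [← h.map_right, σ.injective.ne_iff]; exact hv.2.1
  have w3 : σ (endVertex n ε 0) ≤ n := (h.map_le _).2 hv.2.2
  have inc : ∀ t < n, (τ t = σ (endVertex n ε 0) ∨ τ t + 1 = σ (endVertex n ε 0)) →
      t = endEdge n ε 0 := fun t ht hi => by
    have : mergeVertex i' j' (τ t) = σ (endVertex n ε 0) ∨
        mergeVertex i' j' (τ t + 1) = σ (endVertex n ε 0) := by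
      simp only [mergeVertex]; grind
    rw [← h.inc_iff ht] at this
    cases ε <;> simp [endLength, endVertex, mergeVertex, endEdge] at hε this ⊢ <;> grind
  have hends : σ (endVertex n ε 0) = 0 ∨ σ (endVertex n ε 0) = n := by
    by_contra! hcon
    generalize σ (endVertex n ε 0) = w at *
    have a1 := inc (τ.symm w) (by rw [← h.map_lt, τ.apply_symm_apply]; omega) (by simp)
    have a2 := inc (τ.symm (w - 1)) (by rw [← h.map_lt, τ.apply_symm_apply]; omega)
      (by simp; omega)
    have := τ.symm.injective (a1.trans a2.symm)
    omega
  rcases hends with he | he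
  · exact ⟨false, by simp [endLength]; omega, he.trans (by simp [endVertex])⟩
  · exact ⟨true, by simp [endLength]; omega, he.trans (by simp [endVertex])⟩

/-- Walking inwards from corresponding free ends, both walks reach the merged vertex after the same
number of steps. If opposite ends correspond, the walks run in opposite directions of the numbering,
which negates the word. -/
theorem end_match (h : GlueIso n o i j i' j' σ τ) {ε ε' : Bool} (hε : 0 < endLength n i j ε)
    (hε' : 0 < endLength n i' j' ε') (h0 : σ (endVertex n ε 0) = endVertex n ε' 0) :
    endLength n i j ε = endLength n i' j' ε' ∧
      (∀ s < endLength n i j ε, τ (endEdge n ε s) = endEdge n ε' s) ∧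
      (ε' = (!ε) → ∀ s < endLength n i j ε, o (endEdge n ε s) = !o (endEdge n ε' s)) := by
  have hij := h.lt
  have hjn := h.le
  have hij' := h.lt'
  have hjn' := h.le'
  have hi : σ i = i' := h.map_left (by cases ε <;> simp [endLength] at hε <;> omega)
  have hw := h.walk (X := fun s => mergeVertex i j (endVertex n ε s))
    (Y := fun s => mergeVertex i' j' (endVertex n ε' s)) (F := endEdge n ε) (G := endEdge n ε')
    (m := min (endLength n i j ε) (endLength n i' j' ε')) (by omega)
    (fun s hs => by
      cases ε
      · simp only [endLength, endEdge, endVertex, cond_false] at hs ⊢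
        exact ⟨by omega, Or.inl ⟨trivial, trivial⟩⟩
      · simp only [endLength, endEdge, endVertex, cond_true] at hs ⊢
        refine ⟨by omega, Or.inr ⟨?_, ?_⟩⟩ <;> congr 1 <;> omega)
    (fun s hs => by
      cases ε'
      · simp only [endEdge, endVertex, cond_false] at hs ⊢
        exact Or.inl ⟨trivial, trivial⟩
      · simp only [endLength, endEdge, endVertex, cond_true] at hs ⊢
        refine Or.inr ⟨?_, ?_⟩ <;> congr 1 <;> omega)
    (fun s hs e he hinc => by
      cases ε' <;> simp [endLength, endEdge, endVertex, mergeVertex] at hs hinc ⊢ <;> grind)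
    (fun s hs => by
      cases ε <;> simp [endLength, endEdge] at hs ⊢
      omega)
    (by
      have e1 : mergeVertex i j (endVertex n ε 0) = endVertex n ε 0 := by
        cases ε <;> simp [endLength, endVertex, mergeVertex] at hε ⊢ <;> omega
      have e2 : mergeVertex i' j' (endVertex n ε' 0) = endVertex n ε' 0 := by
        cases ε' <;> simp [endLength, endVertex, mergeVertex] at hε' ⊢ <;> omega
      simp only [e1, e2, h0])
    (by
      have hlt : endEdge n ε 0 < n := by
        cases ε <;> simp [endLength, endEdge] at hε ⊢ <;> omega
      have hinc := (h.inc_iff (t := endEdge n ε 0) (v := endVertex n ε 0) hlt).1 (by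
        cases ε <;> simp [endLength, endVertex, mergeVertex, endEdge] at hε ⊢ <;> grind)
      rw [h0] at hinc
      have := (h.map_lt (endEdge n ε 0)).2 hlt
      cases ε' <;> simp [endLength, endVertex, mergeVertex] at hε' hinc ⊢ <;>
        simp [endEdge] at * <;> grind)
  have hlen : endLength n i j ε = endLength n i' j' ε' := by
    obtain ⟨-, -, hlast⟩ := hw (min (endLength n i j ε) (endLength n i' j' ε') - 1) (by omega)
    rw [Nat.sub_add_cancel (by omega)] at hlast
    have x1 : ∀ ε s, s ≤ endLength n i j ε →
        (mergeVertex i j (endVertex n ε s) = i ↔ s = endLength n i j ε) := fun ε s hs => by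
      cases ε <;> simp [endLength, endVertex, mergeVertex] at hs ⊢ <;> grind
    have x2 : ∀ ε s, s ≤ endLength n i' j' ε →
        (mergeVertex i' j' (endVertex n ε s) = i' ↔ s = endLength n i' j' ε) := fun ε s hs => by
      cases ε <;> simp [endLength, endVertex, mergeVertex] at hs ⊢ <;> grind
    have x3 := x1 ε _ (min_le_left (endLength n i j ε) (endLength n i' j' ε'))
    have x4 := x2 ε' _ (min_le_right (endLength n i j ε) (endLength n i' j' ε'))
    rw [← hlast] at x4
    have x5 := σ.injective.eq_iff (a := mergeVertex i j (endVertex n ε (min (endLength n i j ε) (endLength n i' j' ε')))) (b := i)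
    rw [hi, x4, x3] at x5
    omega
  refine ⟨hlen, fun s hs => (hw s (by omega)).1, fun hεε' s hs => ?_⟩
  obtain ⟨w1, w2, w3⟩ := hw s (by omega)
  rw [← w1]
  refine h.word_flip ?_ ?_ ?_
  · cases ε <;> simp [endLength, endEdge] at hs ⊢ <;> omega
  · cases ε <;> simp [endLength, endEdge, mergeVertex] at hs ⊢ <;> grind
  · rw [w1, hεε']
    rw [hεε'] at w2 w3
    cases ε
    · simp only [endLength, endVertex, endEdge, Bool.not_false, cond_true, cond_false] at *
      rw [w2]; congr 1; omega
    · simp only [endLength, endVertex, endEdge, Bool.not_true, cond_true, cond_false] at *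
      rw [show n - 1 - s = n - (s + 1) by omega, w3]

/-- The shift lowers `t` by `i' - i` and raises its mirror edge by the same amount. Descending this
way inside the cycle reaches `t < i'`, whose mirror image lies in the right end, where the claim is
known. -/
theorem flip_of_shift (h : GlueIso n o i j i' j' σ τ) (hii' : i < i')
    (hi' : i' = n - j) (hend : ∀ t < n, t < i ∨ j ≤ t → o t = !o (n - 1 - t))
    (hshift : ∀ t, i ≤ t → t < j → o t = o (t + (i' - i))) :
    ∀ t < n, o (n - 1 - t) = !o t := by
  have hij := h.lt
  have hjn := h.le
  intro t
  induction t using Nat.strong_induction_on with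
  | _ t ih =>
    intro ht
    by_cases h1 : t < i ∨ j ≤ t
    · rw [hend t ht h1, Bool.not_not]
    · by_cases h2 : t < i'
      · rw [hend (n - 1 - t) (by omega) (by omega), show n - 1 - (n - 1 - t) = t by omega]
      · have e1 := hshift (t - (i' - i)) (by omega) (by omega)
        have e2 := hshift (n - 1 - t) (by omega) (by omega)
        have e3 := ih (t - (i' - i)) (by omega) (by omega)
        rw [show t - (i' - i) + (i' - i) = t by omega] at e1
        rw [show n - 1 - (t - (i' - i)) = n - 1 - t + (i' - i) by omega, e1] at e3
        rw [e2, e3]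

/-- With the ends exchanged, only the cycle remains, and it can be traversed in two ways. Against
the numbering, its word is reflected directly; along the numbering, it is shifted, and
`flip_of_shift` applies unless `i = i'`. -/
theorem flip_of_ends (h : GlueIso n o i j i' j' σ τ) (ht : 0 < i ∨ j < n) (hj' : j' = n - i)
    (hi' : i' = n - j) (hend : ∀ t < n, t < i ∨ j ≤ t → τ t = n - 1 - t)
    (hword : ∀ t < n, t < i ∨ j ≤ t → o t = !o (n - 1 - t)) :
    i = i' ∨ ∀ t < n, o (n - 1 - t) = !o t := by
  by_cases hii' : i = i'
  · exact Or.inl hii'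
  right
  have hij := h.lt
  have hjn := h.le
  have hmi := h.map_left ht
  by_cases hL : j = i + 1
  · intro t ht
    by_cases h1 : t < i ∨ j ≤ t
    · rw [hword t ht h1, Bool.not_not]
    · obtain rfl : t = i := by omega
      rw [hword (n - 1 - t) (by omega) (by omega), show n - 1 - (n - 1 - t) = t by omega]
  -- The edge `i` starts at the merged vertex. Images of the end edges are already taken, so its
  -- image is one of the two cycle edges there.
  have hstart : τ i = i' ∨ τ i = j' - 1 := by
    have hinc := (h.inc_iff (t := i) (v := i) (by omega)).1 (Or.inl (by simp [mergeVertex]))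
    rw [hmi] at hinc
    have hlt := (h.map_lt i).2 (by omega)
    have n1 : 0 < i → τ i ≠ τ (i - 1) := fun _ => by rw [τ.injective.ne_iff]; omega
    have n2 : j < n → τ i ≠ τ j := fun _ => by rw [τ.injective.ne_iff]; omega
    have e1 := hend (i - 1)
    have e2 := hend j
    simp only [mergeVertex] at hinc
    by_cases c1 : 0 < i <;> by_cases c2 : j < n <;> grind
  have hF : ∀ s < j - i, i + s < n ∧
      ((mergeVertex i j (i + s) = mergeVertex i j (i + s) ∧
        mergeVertex i j (i + s + 1) = mergeVertex i j (i + (s + 1))) ∨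
      (mergeVertex i j (i + s) = mergeVertex i j (i + (s + 1)) ∧
        mergeVertex i j (i + s + 1) = mergeVertex i j (i + s))) :=
    fun s hs => ⟨by omega, Or.inl ⟨rfl, rfl⟩⟩
  have hnl : ∀ s < j - i, mergeVertex i j (i + s) ≠ mergeVertex i j (i + s + 1) := fun s hs => by
    simp only [mergeVertex]; grind
  rcases hstart with hs | hs
  · have hw := h.walk (X := fun s => mergeVertex i j (i + s)) (F := fun s => i + s)
      (Y := fun s => mergeVertex i' j' (i' + s)) (G := fun s => i' + s) (m := j - i) (by omega) hF
      (fun s hs => Or.inl ⟨rfl, rfl⟩)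
      (fun s hs e he hinc => by simp only [mergeVertex] at hinc ⊢; grind)
      (fun s hs => by omega)
      (by simp only [add_zero, mergeVertex]; grind) (by simpa using hs)
    have hshift : ∀ s < j - i, o (i + s) = o (i' + s) := fun s hs => by
      obtain ⟨w1, w2, w3⟩ := hw s hs
      rw [h.word_same (t := i + s) (by omega) (hnl s hs) (by rw [w1]; exact w2), w1]
    rcases Nat.lt_or_gt_of_ne hii' with hlt | hlt
    · refine h.flip_of_shift hlt hi' hword fun t h1 h2 => ?_
      have := hshift (t - i) (by omega)
      rwa [show i + (t - i) = t by omega, show i' + (t - i) = t + (i' - i) by omega] at this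
    · refine h.symm.flip_of_shift hlt (by omega) (fun t ht h1 => ?_)
        fun t h1 h2 => ?_
      · have := hword (n - 1 - t) (by omega) (by omega)
        rw [show n - 1 - (n - 1 - t) = t by omega] at this
        rw [this, Bool.not_not]
      · have := hshift (t - i') (by omega)
        rw [show i' + (t - i') = t by omega, show i + (t - i') = t + (i - i') by omega] at this
        exact this.symm
  · have hw := h.walk (X := fun s => mergeVertex i j (i + s)) (F := fun s => i + s)
      (Y := fun s => mergeVertex i' j' (j' - s)) (G := fun s => j' - 1 - s) (m := j - i)
      (by omega) hF
      (fun s hs => Or.inr ⟨by congr 1; omega, by congr 1; omega⟩)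
      (fun s hs e he hinc => by simp only [mergeVertex] at hinc ⊢; grind)
      (fun s hs => by omega)
      (by simp only [add_zero, Nat.sub_zero, mergeVertex]; grind) (by simpa using hs)
    intro t ht
    by_cases h1 : t < i ∨ j ≤ t
    · rw [hword t ht h1, Bool.not_not]
    · obtain ⟨w1, w2, w3⟩ := hw (t - i) (by omega)
      rw [show i + (t - i) = t by omega] at w1 w2
      have := h.word_flip ht (by simpa [show i + (t - i) = t by omega] using hnl (t - i) (by omega))
        (by rw [w1, w2]; congr 1; omega)
      rw [w1, show j' - 1 - (t - i) = n - 1 - t by omega] at this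
      rw [this, Bool.not_not]

/-- The quiver obtained from an oriented line by identifying two vertices determines these two
vertices up to a reflection of the line. -/
theorem rigid (h : GlueIso n o i j i' j' σ τ) :
    (i = i' ∧ j = j') ∨ (i' = n - j ∧ j' = n - i ∧ ∀ t < n, o (n - 1 - t) = !o t) := by
  have hij := h.lt
  have hjn := h.le
  have hij' := h.lt'
  have hjn' := h.le'
  have h' := h.symm
  have lF : endLength n i j false = i := rfl
  have lT : endLength n i j true = n - j := rfl
  have lF' : endLength n i' j' false = i' := rfl
  have lT' : endLength n i' j' true = n - j' := rfl
  have vF : endVertex n false 0 = 0 := rfl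
  have vT : endVertex n true 0 = n := rfl
  have hσ : σ 0 ≠ σ n := by rw [σ.injective.ne_iff]; omega
  have hσ' : σ.symm 0 ≠ σ.symm n := by rw [σ.symm.injective.ne_iff]; omega
  -- Two free ends have distinct images among the free ends on the other side, so that side has two
  -- as well.
  have both : ∀ {i j i' j' : ℕ} {σ τ : Equiv.Perm ℕ}, GlueIso n o i j i' j' σ τ →
      σ 0 ≠ σ n → 0 < i → j < n → 0 < i' ∧ j' < n := by
    intro i j i' j' σ τ h hσ h1 h2
    obtain ⟨ε, a1, a2⟩ := h.exists_end (ε := false) (by simpa [endLength] using h1)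
    obtain ⟨ε', b1, b2⟩ := h.exists_end (ε := true) (by simpa [endLength] using h2)
    have a3 : σ 0 = endVertex n ε 0 := a2
    have b3 : σ n = endVertex n ε' 0 := b2
    cases ε <;> cases ε' <;> simp [endLength] at a1 b1 <;> simp_all
  have b1 := both h hσ
  have b2 := both h' hσ'
  by_cases hi : 0 < i
  · obtain ⟨ε, a1, a2⟩ := h.exists_end (ε := false) hi
    obtain ⟨a3, a4, a5⟩ := h.end_match (ε := false) hi a1 a2
    cases ε
    · left
      rw [lF, lF'] at a3
      refine ⟨a3, ?_⟩
      by_cases hj : j < n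
      · obtain ⟨ε, c1, c2⟩ := h.exists_end (ε := true) (by omega)
        obtain ⟨c3, -, -⟩ := h.end_match (ε := true) (by omega) c1 c2
        cases ε
        · exact absurd (a2.trans c2.symm) hσ
        · omega
      · omega
    · rw [lF, lT'] at a3
      by_cases hj : j < n
      · obtain ⟨ε, c1, c2⟩ := h.exists_end (ε := true) (by omega)
        obtain ⟨c3, c4, c5⟩ := h.end_match (ε := true) (by omega) c1 c2
        cases ε
        · rw [lT, lF'] at c3
          have q1 : ∀ t < n, t < i ∨ j ≤ t → τ t = n - 1 - t := fun t ht h1 => by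
            rcases h1 with h1 | h1
            · exact a4 t h1
            · have := c4 (n - 1 - t) (by omega)
              simp only [endEdge, cond_true, cond_false] at this
              rwa [show n - 1 - (n - 1 - t) = t by omega] at this
          have q2 : ∀ t < n, t < i ∨ j ≤ t → o t = !o (n - 1 - t) := fun t ht h1 => by
            rcases h1 with h1 | h1
            · exact a5 rfl t h1
            · have := c5 rfl (n - 1 - t) (by omega)
              simp only [endEdge, cond_true, cond_false] at this
              rwa [show n - 1 - (n - 1 - t) = t by omega] at this
          rcases h.flip_of_ends (Or.inl hi) (by omega) (by omega) q1 q2 with h2 | h2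
          · left; omega
          · right; exact ⟨by omega, by omega, h2⟩
        · exact absurd (a2.trans c2.symm) hσ
      · rcases h.flip_of_ends (Or.inl hi) (by omega) (by omega)
          (fun t ht h1 => a4 t (by omega)) (fun t ht h1 => a5 rfl t (by omega)) with h2 | h2
        · left; omega
        · right; exact ⟨by omega, by omega, h2⟩
  · by_cases hj : j < n
    · obtain ⟨ε, c1, c2⟩ := h.exists_end (ε := true) (by omega)
      obtain ⟨c3, c4, c5⟩ := h.end_match (ε := true) (by omega) c1 c2
      cases ε
      · rw [lT, lF'] at c3
        have q1 : ∀ t < n, t < i ∨ j ≤ t → τ t = n - 1 - t := fun t ht h1 => by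
          have := c4 (n - 1 - t) (by omega)
          simp only [endEdge, cond_true, cond_false] at this
          rwa [show n - 1 - (n - 1 - t) = t by omega] at this
        have q2 : ∀ t < n, t < i ∨ j ≤ t → o t = !o (n - 1 - t) := fun t ht h1 => by
          have := c5 rfl (n - 1 - t) (by omega)
          simp only [endEdge, cond_true, cond_false] at this
          rwa [show n - 1 - (n - 1 - t) = t by omega] at this
        rcases h.flip_of_ends (Or.inr hj) (by omega) (by omega) q1 q2 with h2 | h2
        · left; omega
        · right; exact ⟨by omega, by omega, h2⟩
      · left; omega
    · left
      have d1 : ¬ 0 < i' := fun hi' => by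
        obtain ⟨ε, a1, -⟩ := h'.exists_end (ε := false) hi'
        cases ε <;> omega
      have d2 : ¬ j' < n := fun hj' => by
        obtain ⟨ε, a1, -⟩ := h'.exists_end (ε := true) (by omega)
        cases ε <;> omega
      omega

end GlueIso
end GlueCombinatorics

/-! ### Incidence algebras as matrix algebras -/

section IncidenceAlgebra

/-- A reflexive, transitive and antisymmetric relation. -/
structure IsOrderRel {ι : Type*} (R : ι → ι → Prop) : Prop where
  refl : ∀ x, R x x
  trans : ∀ {x y z}, R x y → R y z → R x z
  antisymm : ∀ {x y}, R x y → R y x → x = y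

variable {k : Type*} [Field k] {ι : Type*} [Fintype ι] [DecidableEq ι]

/-- The incidence algebra of an order relation, as an algebra of matrices. -/
def incidence (k : Type*) [Field k] {R : ι → ι → Prop} (hR : IsOrderRel R) :
    Subalgebra k (Matrix ι ι k) where
  carrier := {M | ∀ x y, ¬ R x y → M x y = 0}
  mul_mem' {M N} hM hN x y h := by
    rw [Matrix.mul_apply]
    refine Finset.sum_eq_zero fun z _ => ?_
    by_cases h1 : R x z
    · rw [hN z y fun h2 => h (hR.trans h1 h2), mul_zero]
    · rw [hM x z h1, zero_mul]
  add_mem' {M N} hM hN x y h := by rw [Matrix.add_apply, hM x y h, hN x y h, add_zero]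
  algebraMap_mem' r x y h := by
    rw [Matrix.algebraMap_matrix_apply, if_neg]
    rintro rfl
    exact h (hR.refl x)

variable {R : ι → ι → Prop} (hR : IsOrderRel R)

theorem single_mem_incidence {x y : ι} (h : R x y) (c : k) :
    Matrix.single x y c ∈ incidence k hR := fun a b hab => by
  rw [Matrix.single_apply_of_ne]
  rintro ⟨rfl, rfl⟩
  exact hab h

theorem diagonal_mem_incidence (d : ι → k) : Matrix.diagonal d ∈ incidence k hR := fun a b hab =>
  Matrix.diagonal_apply_ne _ fun h => hab (h ▸ hR.refl a)

theorem incidence_le_iff {S : ι → ι → Prop} (hS : IsOrderRel S) :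
    incidence k hS ≤ incidence k hR ↔ ∀ x y, S x y → R x y := by
  constructor
  · intro h x y hxy
    by_contra hn
    have := h (single_mem_incidence hS hxy (1 : k)) x y hn
    rw [Matrix.single_apply_same] at this
    exact one_ne_zero this
  · exact fun h M hM x y hxy => hM x y fun h1 => hxy (h x y h1)

variable {hR}

theorem mul_diag_of_mem {M N : Matrix ι ι k} (hM : M ∈ incidence k hR)
    (hN : N ∈ incidence k hR) (x : ι) : (M * N) x x = M x x * N x x := by
  rw [Matrix.mul_apply, Finset.sum_eq_single x]
  · intro z _ hz
    by_cases h1 : R x z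
    · rw [hN z x fun h2 => hz (hR.antisymm h2 h1), mul_zero]
    · rw [hM x z h1, zero_mul]
  · exact fun h => absurd (Finset.mem_univ x) h

/-- The entry at `(x, y)` of a product only involves the diagonal entries if there is nothing
strictly between `x` and `y`. -/
theorem mul_apply_of_cover {M N : Matrix ι ι k} (hM : M ∈ incidence k hR)
    (hN : N ∈ incidence k hR) {x y : ι} (hne : x ≠ y)
    (hc : ∀ z, R x z → R z y → z = x ∨ z = y) :
    (M * N) x y = M x x * N x y + M x y * N y y := by
  rw [Matrix.mul_apply, ← Finset.sum_pair (f := fun z => M x z * N z y) hne]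
  refine (Finset.sum_subset (Finset.subset_univ _) fun z _ hz => ?_).symm
  simp only [Finset.mem_insert, Finset.mem_singleton] at hz
  by_cases h1 : R x z
  · rw [hN z y fun h2 => hz (hc z h1 h2), mul_zero]
  · rw [hM x z h1, zero_mul]

/-- A nonzero entry of `M ^ m` yields a strict chain with `m` steps, and the number `h` of elements
below rises at every step while staying at most the size of `ι`. -/
theorem isNilpotent_of_diag {M : Matrix ι ι k} (hM : M ∈ incidence k hR)
    (hd : ∀ x, M x x = 0) : IsNilpotent M := by
  classical
  let h : ι → ℕ := fun x => (Finset.univ.filter fun z => R z x).card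
  have hlt : ∀ x y, R x y → x ≠ y → h x < h y := fun x y hxy hne =>
    Finset.card_lt_card <| by
      refine Finset.ssubset_iff_of_subset (fun z hz => ?_) |>.2 ⟨y, ?_, ?_⟩
      · simp only [Finset.mem_filter, Finset.mem_univ, true_and] at hz ⊢
        exact hR.trans hz hxy
      · simpa using hR.refl y
      · simpa using fun hyx => hne (hR.antisymm hxy hyx)
  have key : ∀ m x y, (M ^ m) x y ≠ 0 → h x + m ≤ h y := by
    intro m
    induction m with
    | zero =>
      intro x y hxy
      by_cases e : x = y
      · rw [e, add_zero]
      · exact absurd (by rw [pow_zero, Matrix.one_apply_ne e]) hxy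
    | succ m ih =>
      intro x y hxy
      rw [pow_succ, Matrix.mul_apply] at hxy
      obtain ⟨z, -, hz⟩ := Finset.exists_ne_zero_of_sum_ne_zero hxy
      have h1 := ih x z (left_ne_zero_of_mul hz)
      have h2 := right_ne_zero_of_mul hz
      have h3 : R z y := by
        by_contra h3
        exact h2 (hM z y h3)
      have h4 : z ≠ y := by
        rintro rfl
        exact h2 (hd z)
      have := hlt z y h3 h4
      omega
  refine ⟨Fintype.card ι + 1, ?_⟩
  ext x y
  by_contra hne
  have h1 := key _ x y hne
  have h2 : h y ≤ Fintype.card ι := Finset.card_le_univ _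
  omega

theorem pow_diag_of_mem {M : Matrix ι ι k} (hM : M ∈ incidence k hR) (m : ℕ) (x : ι) :
    (M ^ m) x x = M x x ^ m := by
  induction m with
  | zero => simp
  | succ m ih => rw [pow_succ, mul_diag_of_mem (pow_mem hM m) hM, ih, pow_succ]

theorem isNilpotent_iff_diag {M : Matrix ι ι k} (hM : M ∈ incidence k hR) :
    IsNilpotent M ↔ ∀ x, M x x = 0 := by
  refine ⟨fun ⟨m, hm⟩ x => ?_, isNilpotent_of_diag hM⟩
  have := pow_diag_of_mem hM m x
  rw [hm, Matrix.zero_apply] at this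
  by_contra hx; exact pow_ne_zero m hx this.symm

end IncidenceAlgebra

/-! ### Idempotents, conjugation and glued subalgebras -/

section IncidenceSubalgebras

variable {k : Type*} [Field k] {ι : Type*} [Fintype ι] [DecidableEq ι]
  {R : ι → ι → Prop} {hR : IsOrderRel R}

/-- Conjugation by a unit, as an algebra automorphism. -/
def conjEquiv (k : Type*) [Field k] {B : Type*} [Ring B] [Algebra k B] (u : Bˣ) : B ≃ₐ[k] B :=
  AlgEquiv.ofRingEquiv (f := MulSemiringAction.toRingEquiv (ConjAct Bˣ) B (ConjAct.toConjAct u))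
    fun r => by
      simp

theorem conjEquiv_apply {B : Type*} [Ring B] [Algebra k B] (u : Bˣ) (b : B) :
    conjEquiv k u b = u * b * ↑u⁻¹ := rfl

theorem conjEquiv_symm {B : Type*} [Ring B] [Algebra k B] (u : Bˣ) :
    (conjEquiv k u).symm = conjEquiv k u⁻¹ := by
  ext b
  rw [AlgEquiv.symm_apply_eq, conjEquiv_apply, conjEquiv_apply]
  simp [mul_assoc]

theorem map_conjEquiv_of_mem {B : Type*} [Ring B] [Algebra k B] {u : Bˣ} {T : Subalgebra k B}
    (hu : (u : B) ∈ T) (hu' : ((u⁻¹ : Bˣ) : B) ∈ T) :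
    T.map (conjEquiv k u : B →ₐ[k] B) = T := by
  apply le_antisymm
  · rintro _ ⟨b, hb, rfl⟩
    exact mul_mem (mul_mem hu hb) hu'
  · intro b hb
    refine ⟨(conjEquiv k u).symm b, ?_, (conjEquiv k u).apply_symm_apply b⟩
    rw [conjEquiv_symm]
    change ((u⁻¹ : Bˣ) : B) * b * ((u⁻¹⁻¹ : Bˣ) : B) ∈ T
    rw [inv_inv]
    exact mul_mem (mul_mem hu' hb) hu

/-- `M` is one minus a nilpotent element of the incidence algebra, so its inverse exists inside that
algebra. -/
theorem exists_unit_of_diag {M : Matrix ι ι k} (hM : M ∈ incidence k hR)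
    (hd : ∀ x, M x x = 1) : ∃ u : (Matrix ι ι k)ˣ, (u : Matrix ι ι k) = M ∧
      ((u⁻¹ : (Matrix ι ι k)ˣ) : Matrix ι ι k) ∈ incidence k hR := by
  have hnil : IsNilpotent (1 - (⟨M, hM⟩ : incidence k hR)) := by
    obtain ⟨m, hm⟩ := isNilpotent_of_diag (sub_mem (one_mem (incidence k hR)) hM)
      (fun x => by simp [hd x])
    exact ⟨m, Subtype.ext (by simpa using hm)⟩
  have hu := hnil.isUnit_one_sub
  rw [sub_sub_cancel] at hu
  obtain ⟨u, hu⟩ := hu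
  exact ⟨Units.map (incidence k hR).val.toMonoidHom u, by simp [hu], ((u⁻¹ : _ˣ) : incidence k hR).2⟩

/-- The diagonal of a matrix in an incidence algebra. -/
def diagHom (k : Type*) [Field k] (hR : IsOrderRel R) : incidence k hR →ₐ[k] (ι → k) where
  toFun M x := (M : Matrix ι ι k) x x
  map_one' := by ext x; simp
  map_mul' M N := by ext x; exact mul_diag_of_mem M.2 N.2 x
  map_zero' := by ext x; simp
  map_add' M N := by ext x; simp
  commutes' r := by ext x; simp [Matrix.algebraMap_matrix_apply]

/-- A complete family of nonzero orthogonal idempotents of an incidence algebra partitions the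
diagonal positions. -/
theorem exists_partition {κ : Type*} [Fintype κ] {g : κ → Matrix ι ι k}
    (hg : CompleteOrthogonalIdempotents g) (hmem : ∀ c, g c ∈ incidence k hR)
    (hne : ∀ c, g c ≠ 0) :
    ∃ ρ : ι → κ, Function.Surjective ρ ∧ (∀ v, g (ρ v) v v = 1) ∧
      ∀ v c, g c v v ≠ 0 → ρ v = c := by
  have hsum : ∀ v, ∑ c, g c v v = 1 := fun v => by
    rw [← Matrix.sum_apply, hg.complete, Matrix.one_apply_eq]
  have hex : ∀ v, ∃ c, g c v v ≠ 0 := fun v => by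
    by_contra! h
    have := hsum v
    rw [Finset.sum_eq_zero fun c _ => h c] at this
    exact zero_ne_one this
  choose ρ hρ using hex
  have hidem : ∀ c v, g c v v * g c v v = g c v v := fun c v => by
    rw [← mul_diag_of_mem (hmem c) (hmem c), (hg.idem c).eq]
  have huniq : ∀ v c, g c v v ≠ 0 → ρ v = c := fun v c hc => by
    by_contra hne
    have := mul_diag_of_mem (hmem (ρ v)) (hmem c) v
    rw [hg.ortho hne, Matrix.zero_apply] at this
    exact mul_ne_zero (hρ v) hc this.symm
  refine ⟨ρ, fun c => ?_, fun v => mul_left_cancel₀ (hρ v) (by rw [hidem, mul_one]), huniq⟩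
  -- An idempotent meeting no diagonal position would have zero diagonal, hence be nilpotent, hence
  -- vanish.
  by_contra! h
  obtain ⟨m, hm⟩ := isNilpotent_of_diag (hmem c) fun v => by
    by_contra hv
    exact h v (huniq v c hv)
  have hp : g c ^ (m + 1) = g c := (hg.idem c).pow_succ_eq m
  rw [pow_succ, hm, zero_mul] at hp
  exact hne c hp.symm

/-- The matrices in an incidence algebra whose diagonal entries at `i` and `j` agree. -/
def glueSubalgebra (k : Type*) [Field k] (hR : IsOrderRel R) (i j : ι) :
    Subalgebra k (Matrix ι ι k) where
  carrier := {M | M ∈ incidence k hR ∧ M i i = M j j}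
  mul_mem' {M N} hM hN := ⟨mul_mem hM.1 hN.1, by
    rw [mul_diag_of_mem hM.1 hN.1, mul_diag_of_mem hM.1 hN.1, hM.2, hN.2]⟩
  add_mem' {M N} hM hN := ⟨add_mem hM.1 hN.1, by
    rw [Matrix.add_apply, Matrix.add_apply, hM.2, hN.2]⟩
  algebraMap_mem' r := ⟨algebraMap_mem _ r, by simp [Matrix.algebraMap_matrix_apply]⟩

theorem glueSubalgebra_lt {i j : ι} (hij : i ≠ j) :
    glueSubalgebra k hR i j < incidence k hR := by
  refine lt_of_le_of_ne (fun M hM => hM.1) fun h => ?_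
  have : Matrix.single i i (1 : k) ∈ glueSubalgebra k hR i j := by
    rw [h]; exact single_mem_incidence hR (hR.refl i) 1
  have := this.2
  rw [Matrix.single_apply_same, Matrix.single_apply_of_ne _ _ _ _ _ (by tauto)] at this
  exact one_ne_zero this

/-- A subalgebra of an incidence algebra whose diagonal entries are separated by its members has,
up to conjugation, all the diagonal matrix units. -/
theorem exists_conj_single_mem {A : Subalgebra k (Matrix ι ι k)} (hA : A ≤ incidence k hR)
    (hsep : ∀ x y, x ≠ y → ∃ M ∈ A, M x x ≠ M y y) :
    ∃ u : (Matrix ι ι k)ˣ, (u : Matrix ι ι k) ∈ incidence k hR ∧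
      ((u⁻¹ : (Matrix ι ι k)ˣ) : Matrix ι ι k) ∈ incidence k hR ∧
      ∀ x, (u : Matrix ι ι k) * Matrix.single x x 1 * ((u⁻¹ : (Matrix ι ι k)ˣ) : Matrix ι ι k) ∈ A
        := by
  let f : A →ₐ[k] (ι → k) := (diagHom k hR).comp (Subalgebra.inclusion hA)
  have hf : ∀ (a : A) x, f a x = (a : Matrix ι ι k) x x := fun a x => rfl
  -- A subalgebra of functions that separates points contains every indicator function: it is a
  -- product of interpolating functions `d y`, each equal to one at `x` and to zero at `y`.
  have hsingle : ∀ x, Pi.single x (1 : k) ∈ f.range := by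
    intro x
    have hy : ∀ y, ∃ d ∈ f.range, y ≠ x → d x = 1 ∧ d y = 0 := by
      intro y
      by_cases hxy : x = y
      · exact ⟨1, one_mem _, fun h => absurd hxy.symm h⟩
      · obtain ⟨M, hM, hne⟩ := hsep x y hxy
        refine ⟨(M x x - M y y)⁻¹ • (f ⟨M, hM⟩ - algebraMap k _ (M y y)),
          Subalgebra.smul_mem _ (sub_mem ((AlgHom.mem_range f).2 ⟨_, rfl⟩) (algebraMap_mem _ _)) _, fun _ => ⟨?_, ?_⟩⟩
        · simp [hf, inv_mul_cancel₀ (sub_ne_zero.2 hne)]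
        · simp [hf]
    choose d hd hd' using hy
    have : Pi.single x (1 : k) = ∏ y ∈ Finset.univ.erase x, d y := by
      ext z
      rw [Finset.prod_apply]
      by_cases hz : z = x
      · subst hz
        rw [Pi.single_eq_same, Finset.prod_eq_one]
        exact fun y hy => (hd' y (Finset.ne_of_mem_erase hy)).1
      · rw [Pi.single_eq_of_ne hz]
        exact (Finset.prod_eq_zero (f := fun y => d y z) (Finset.mem_erase.2 ⟨hz, Finset.mem_univ z⟩) (hd' z hz).2).symm
    rw [this]
    exact prod_mem fun y _ => hd y
  have hker : ∀ a ∈ RingHom.ker (f : A →+* (ι → k)), IsNilpotent a := by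
    intro a ha
    obtain ⟨m, hm⟩ := isNilpotent_of_diag (hA a.2) fun x => congrFun ha x
    exact ⟨m, Subtype.ext (by simpa using hm)⟩
  obtain ⟨e, he, hfe⟩ := CompleteOrthogonalIdempotents.lift_of_isNilpotent_ker
    (f : A →+* (ι → k)) hker (e := fun x => Pi.single x (1 : k))
    (CompleteOrthogonalIdempotents.single (fun _ : ι => k)) hsingle
  have hdiag : ∀ x y, (e x : Matrix ι ι k) y y = Pi.single (M := fun _ => k) x 1 y := fun x y => by
    rw [← hf]
    exact congrFun (congrFun hfe x) y
  -- This intertwines the two families of idempotents: `M * single x x 1` and `e x * M` both equal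
  -- `e x * single x x 1`. Its diagonal is one, so it is a unit and conjugates the matrix units to
  -- the `e x`.
  let M : Matrix ι ι k := ∑ x, (e x : Matrix ι ι k) * Matrix.single x x 1
  have hM : M ∈ incidence k hR := sum_mem fun x _ =>
    mul_mem (hA (e x).2) (single_mem_incidence hR (hR.refl x) 1)
  have hMd : ∀ x, M x x = 1 := fun x => by
    simp only [M, Matrix.sum_apply]
    rw [Finset.sum_eq_single x]
    · rw [mul_diag_of_mem (hA (e x).2) (single_mem_incidence hR (hR.refl x) 1), hdiag]
      simp
    · intro y _ hy
      rw [mul_diag_of_mem (hA (e y).2) (single_mem_incidence hR (hR.refl y) 1), hdiag,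
        Pi.single_eq_of_ne hy.symm, zero_mul]
    · simp
  obtain ⟨u, hu, hu'⟩ := exists_unit_of_diag hM hMd
  refine ⟨u, hu ▸ hM, hu', fun x => ?_⟩
  have h1 : M * Matrix.single x x 1 = (e x : Matrix ι ι k) * Matrix.single x x 1 := by
    simp only [M, Finset.sum_mul, mul_assoc]
    rw [Finset.sum_eq_single x]
    · simp
    · intro y _ hy
      rw [Matrix.single_mul_single_of_ne _ _ _ _ hy, mul_zero]
    · simp
  have h2 : (e x : Matrix ι ι k) * M = (e x : Matrix ι ι k) * Matrix.single x x 1 := by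
    simp only [M, Finset.mul_sum, ← mul_assoc]
    rw [Finset.sum_eq_single x]
    · rw [← Subalgebra.coe_mul, (he.idem x).eq]
    · intro y _ hy
      rw [← Subalgebra.coe_mul, he.ortho hy.symm, Subalgebra.coe_zero, zero_mul]
    · simp
  rw [hu, h1, ← h2, ← hu, mul_assoc, Units.mul_inv, mul_one]
  exact (e x).2

end IncidenceSubalgebras

/-! ### Maximal subalgebras of the line algebra -/

section LineAlgebra

theorem isOrderRel_line (n : ℕ) (o : ℕ → Bool) :
    IsOrderRel (fun x y : Fin (n + 1) => LineRel o x y) where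
  refl x := LineRel.refl o x
  trans h h' := h.trans h'
  antisymm h h' := Fin.ext (h.antisymm h')

theorem isOrderRel_cut (n : ℕ) (o : ℕ → Bool) (i : ℕ) :
    IsOrderRel (fun x y : Fin (n + 1) => CutRel o i x y) where
  refl x := ⟨LineRel.refl o x, by omega, by omega⟩
  trans {x y z} h h' := by
    refine ⟨h.1.trans h'.1, ?_⟩
    have := h.1.between h'.1
    have := h.2
    have := h'.2
    omega
  antisymm h h' := Fin.ext (h.1.antisymm h'.1)

variable {k : Type*} [Field k] {n : ℕ} {o : ℕ → Bool}

/-- The incidence algebra of the path order of an oriented line. -/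
abbrev lineAlgebra (k : Type*) [Field k] (n : ℕ) (o : ℕ → Bool) :
    Subalgebra k (Matrix (Fin (n + 1)) (Fin (n + 1)) k) := incidence k (isOrderRel_line n o)

/-- The incidence algebra of the path order of an oriented line with an edge removed. -/
abbrev cutAlgebra (k : Type*) [Field k] (n : ℕ) (o : ℕ → Bool) (i : ℕ) :
    Subalgebra k (Matrix (Fin (n + 1)) (Fin (n + 1)) k) := incidence k (isOrderRel_cut n o i)

theorem edge_rel (o : ℕ → Bool) (t : ℕ) : LineRel o (edgeSource o t) (edgeTarget o t) := by
  cases h : o t <;> simp only [edgeSource, edgeTarget, h, cond_true, cond_false]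
  · exact lineRel_succ'.2 h
  · exact lineRel_succ.2 h

theorem cutAlgebra_lt {i : ℕ} (hi : i < n) : cutAlgebra k n o i < lineAlgebra k n o := by
  refine lt_of_le_of_ne ((incidence_le_iff _ _).2 fun x y h => h.1) fun h => ?_
  have h1 := (incidence_le_iff (k := k) _ _).1 h.ge
  cases h2 : o i
  · exact (h1 ⟨i + 1, by omega⟩ ⟨i, by omega⟩ (lineRel_succ'.2 h2)).2.2 ⟨rfl, rfl⟩
  · exact (h1 ⟨i, by omega⟩ ⟨i + 1, by omega⟩ (lineRel_succ.2 h2)).2.1 ⟨rfl, rfl⟩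

/-- A transitive relation containing all edges of an oriented line contains its path order. -/
theorem LineRel.of_edges {S : Fin (n + 1) → Fin (n + 1) → Prop} (hrefl : ∀ x, S x x)
    (htrans : ∀ x y z, S x y → S y z → S x z)
    (hedge : ∀ x y : Fin (n + 1), ((x : ℕ) + 1 = y ∨ (y : ℕ) + 1 = x) → LineRel o x y → S x y)
    {x y : Fin (n + 1)} (h : LineRel o x y) : S x y := by
  have up : ∀ m (x y : Fin (n + 1)), (x : ℕ) + m = y → LineRel o x y → S x y := by
    intro m
    induction m with
    | zero =>
      intro x y hm _
      obtain rfl : x = y := Fin.ext hm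
      exact hrefl x
    | succ m ih =>
      intro x y hm h
      have hz : (x : ℕ) + m < n + 1 := by omega
      refine htrans x ⟨x + m, hz⟩ y (ih _ _ rfl ⟨fun t h1 h2 => h.1 t h1 ?_, ?_⟩)
        (hedge _ _ (Or.inl (by simp only; omega)) ⟨fun t h1 h2 => h.1 t ?_ h2, ?_⟩)
      · simp only at h2; omega
      · intro t h1 h2; simp only at h1; omega
      · simp only at h1; omega
      · intro t h1 h2; simp only at h2; omega
  have down : ∀ m (x y : Fin (n + 1)), (y : ℕ) + m = x → LineRel o x y → S x y := by
    intro m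
    induction m with
    | zero =>
      intro x y hm _
      obtain rfl : y = x := Fin.ext hm
      exact hrefl y
    | succ m ih =>
      intro x y hm h
      have hz : (y : ℕ) + m < n + 1 := by omega
      refine htrans x ⟨y + m, hz⟩ y
        (hedge _ _ (Or.inr (by simp only; omega)) ⟨?_, fun t h1 h2 => h.2 t ?_ h2⟩)
        (ih _ _ rfl ⟨?_, fun t h1 h2 => h.2 t h1 ?_⟩)
      · intro t h1 h2; simp only at h2; omega
      · simp only at h1; omega
      · intro t h1 h2; simp only at h1; omega
      · simp only at h2; omega
  rcases le_total (x : ℕ) y with hxy | hxy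
  · exact up (y - x) x y (by omega) h
  · exact down (x - y) x y (by omega) h

/-- The maximal subalgebras of the path algebra of an oriented line. -/
theorem covBy_lineAlgebra {A : Subalgebra k (Matrix (Fin (n + 1)) (Fin (n + 1)) k)}
    (hA : A ⋖ lineAlgebra k n o) :
    (∃ i j, i < j ∧ A = glueSubalgebra k (isOrderRel_line n o) i j) ∨
      ∃ u : (Matrix (Fin (n + 1)) (Fin (n + 1)) k)ˣ,
        (u : Matrix (Fin (n + 1)) (Fin (n + 1)) k) ∈ lineAlgebra k n o ∧
        ((u⁻¹ : (Matrix (Fin (n + 1)) (Fin (n + 1)) k)ˣ) :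
          Matrix (Fin (n + 1)) (Fin (n + 1)) k) ∈ lineAlgebra k n o ∧
        ∃ i < n, A = (cutAlgebra k n o i).map
          (conjEquiv k u : Matrix (Fin (n + 1)) (Fin (n + 1)) k →ₐ[k] _) := by
  have heq : ∀ B, A ≤ B → B < lineAlgebra k n o → A = B := fun B h1 h2 => by
    by_contra hne
    exact hA.2 (lt_of_le_of_ne h1 hne) h2
  by_cases hsep : ∀ x y, x ≠ y → ∃ M ∈ A, M x x ≠ M y y
  · right
    obtain ⟨u, hu, hu', hux⟩ := exists_conj_single_mem hA.1.le hsep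
    refine ⟨u, hu, hu', ?_⟩
    have hm : (lineAlgebra k n o).map
        (conjEquiv k u : Matrix (Fin (n + 1)) (Fin (n + 1)) k →ₐ[k] _) = lineAlgebra k n o :=
      map_conjEquiv_of_mem hu hu'
    have hconj : ∀ M, conjEquiv k u M = (u : Matrix (Fin (n + 1)) (Fin (n + 1)) k) * M *
      ((u⁻¹ : (Matrix (Fin (n + 1)) (Fin (n + 1)) k)ˣ) : Matrix (Fin (n + 1)) (Fin (n + 1)) k) :=
      fun M => rfl
    have hUW := u.mul_inv
    have hWU := u.inv_mul
    generalize (u : Matrix (Fin (n + 1)) (Fin (n + 1)) k) = U at *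
    generalize ((u⁻¹ : (Matrix (Fin (n + 1)) (Fin (n + 1)) k)ˣ) :
      Matrix (Fin (n + 1)) (Fin (n + 1)) k) = W at *
    have hUW' : ∀ M, U * (W * M) = M := fun M => by rw [← mul_assoc, hUW, one_mul]
    have hWU' : ∀ M, W * (U * M) = M := fun M => by rw [← mul_assoc, hWU, one_mul]
    -- `S` records the matrix units in the conjugate of `A` that contains all diagonal ones. It is
    -- reflexive and transitive, so if it held all edges it would contain the path order, and `A`
    -- would not be proper.
    let S : Fin (n + 1) → Fin (n + 1) → Prop := fun x y =>
      U * Matrix.single x y 1 *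
        W ∈ A
    have hmul : ∀ (a b : Matrix (Fin (n + 1)) (Fin (n + 1)) k),
        U * a * W ∈ A →
        U * b * W ∈ A →
        U * (a * b) * W ∈ A := by
      intro a b ha hb
      have := mul_mem ha hb
      simpa [mul_assoc, hUW, hUW', hWU, hWU'] using this
    have htrans : ∀ x y z, S x y → S y z → S x z := fun x y z h1 h2 => by
      have := hmul _ _ h1 h2
      rwa [Matrix.single_mul_single_same, mul_one] at this
    have hentry : ∀ M ∈ A, ∀ x y, (W * M *
        U) x y ≠ 0 → S x y := by
      intro M hM x y hne
      have h1 := hmul _ _ (hux x) (hmul (W * M *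
        U) _ (by simpa [mul_assoc, hUW, hUW', hWU, hWU'] using hM) (hux y))
      rw [← mul_assoc (Matrix.single x x (1 : k)), Matrix.single_mul_mul_single, one_mul,
        mul_one] at h1
      have h2 := A.smul_mem h1 (((W * M *
        U) x y)⁻¹)
      rw [← smul_mul_assoc, ← mul_smul_comm, Matrix.smul_single, smul_eq_mul,
        inv_mul_cancel₀ hne] at h2
      exact h2
    obtain ⟨i, hi, hiS⟩ : ∃ i, i < n ∧ ∀ x y : Fin (n + 1),
        ((x : ℕ) = i ∧ (y : ℕ) = i + 1 ∨ (x : ℕ) = i + 1 ∧ (y : ℕ) = i) →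
        LineRel o x y → ¬ S x y := by
      by_contra! hcon
      refine hA.1.not_ge fun M hM => ?_
      have hrel : ∀ x y : Fin (n + 1), LineRel o x y → S x y := fun x y h =>
        LineRel.of_edges (S := S) hux htrans (fun x y hxy h => by
          obtain ⟨a, b, hab, h1, h2⟩ := hcon (min x y) (by
            have := x.2; have := y.2; omega)
          have : a = x ∧ b = y := by
            have hx : (x : ℕ) = a ∧ (y : ℕ) = b ∨ (x : ℕ) = b ∧ (y : ℕ) = a := by omega
            rcases hx with ⟨h3, h4⟩ | ⟨h3, h4⟩
            · exact ⟨Fin.ext h3.symm, Fin.ext h4.symm⟩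
            · rw [h3, h4] at h
              have := h.antisymm h1
              omega
          rwa [← this.1, ← this.2]) h
      have hN := mul_mem (mul_mem hu' hM) hu
      have hM' : M = U * (W * M *
        U) * W := by
        simp [mul_assoc, hUW, hUW']
      generalize W * M *
        U = N at hN hM'
      rw [hM', Matrix.matrix_eq_sum_single N]
      simp only [Finset.mul_sum, Finset.sum_mul]
      refine sum_mem fun x _ => sum_mem fun y _ => ?_
      by_cases h : LineRel o x y
      · have h1 := A.smul_mem (hrel x y h) (N x y)
        rwa [← smul_mul_assoc, ← mul_smul_comm, Matrix.smul_single, smul_eq_mul, mul_one] at h1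
      · rw [hN x y h]
        simp
    -- With edge `i` missing from `S`, nonzero entries occur only at pairs of `CutRel`. So `A` lies
    -- in a conjugate of the cut algebra, still proper, and equals it by maximality.
    refine ⟨i, hi, heq _ (fun M hM => ?_) ?_⟩
    · refine ⟨W * M * U,
        fun x y hxy => ?_, ?_⟩
      · by_contra hne
        have hS := hentry M hM x y hne
        have hR : LineRel o x y := by
          by_contra hR
          exact hne (mul_mem (mul_mem hu' (hA.1.le hM)) hu x y hR)
        refine hxy ⟨hR, fun h => hiS x y (Or.inl h) hR hS, fun h => hiS x y (Or.inr h) hR hS⟩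
      · refine (hconj _).trans ?_
        simp [mul_assoc, hUW, hUW']
    · have hlt := cutAlgebra_lt (k := k) (o := o) hi
      exact lt_of_le_of_ne ((Subalgebra.map_mono hlt.le).trans hm.le) fun h =>
        hlt.ne (Subalgebra.map_injective (conjEquiv k u).injective (h.trans hm.symm))
  · left
    push Not at hsep
    obtain ⟨x, y, hxy, h⟩ := hsep
    rcases lt_or_gt_of_ne hxy with h1 | h1
    · exact ⟨x, y, h1, heq _ (fun M hM => ⟨hA.1.le hM, h M hM⟩) (glueSubalgebra_lt hxy)⟩
    · exact ⟨y, x, h1, heq _ (fun M hM => ⟨hA.1.le hM, (h M hM).symm⟩)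
        (glueSubalgebra_lt hxy.symm)⟩

/-- If neither neighbour of the removed edge has its direction, then the algebra decomposes. -/
theorem exists_central_idempotent {i : ℕ} (hi : i < n) (hl : ¬ ExtendsLeft o i)
    (hr : ¬ ExtendsRight n o i) : ∃ z ∈ cutAlgebra k n o i, IsIdempotentElem z ∧
      (∀ M ∈ cutAlgebra k n o i, z * M = M * z) ∧ z ≠ 0 ∧ z ≠ 1 := by
  refine ⟨Matrix.diagonal fun x => if (x : ℕ) ≤ i then 1 else 0, diagonal_mem_incidence _ _,
    ?_, fun M hM => ?_, fun h => ?_, fun h => ?_⟩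
  · rw [IsIdempotentElem, Matrix.diagonal_mul_diagonal]
    simp
  · ext x y
    rw [Matrix.diagonal_mul, Matrix.mul_diagonal]
    by_cases hxy : CutRel o i x y
    · have : (x : ℕ) ≤ i ↔ (y : ℕ) ≤ i := by
        by_contra hne
        obtain ⟨h1, h2⟩ := hxy
        rcases (by omega : (x : ℕ) ≤ i ∧ i < y ∨ (y : ℕ) ≤ i ∧ i < x) with ⟨a, b⟩ | ⟨a, b⟩
        · have e := h1.1 i a b
          rcases (by omega : (x : ℕ) < i ∨ i + 1 < y) with c | c
          · exact hl ⟨by omega, by rw [e, h1.1 (i - 1) (by omega) (by omega)]⟩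
          · exact hr ⟨by omega, by rw [e, h1.1 (i + 1) (by omega) (by omega)]⟩
        · have e := h1.2 i a b
          rcases (by omega : (y : ℕ) < i ∨ i + 1 < x) with c | c
          · exact hl ⟨by omega, by rw [e, h1.2 (i - 1) (by omega) (by omega)]⟩
          · exact hr ⟨by omega, by rw [e, h1.2 (i + 1) (by omega) (by omega)]⟩
      simp [this]
    · rw [hM x y hxy, zero_mul, mul_zero]
  · have := congrFun (congrFun h 0) 0
    simp at this
  · have := congrFun (congrFun h ⟨i + 1, by omega⟩) ⟨i + 1, by omega⟩
    simp at this

end LineAlgebra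

/-! ### Isomorphisms of incidence algebras -/

section IncidenceIsomorphisms

variable {k : Type*} [Field k] {ι : Type*} [Fintype ι] [DecidableEq ι]
  {R R' : ι → ι → Prop} {hR : IsOrderRel R} {hR' : IsOrderRel R'}

/-- An isomorphism onto a subalgebra of an incidence algebra sends a complete family of nonzero
orthogonal idempotents to one that partitions the diagonal positions. -/
theorem exists_partition_of_algEquiv {A A' : Subalgebra k (Matrix ι ι k)} {κ : Type*} [Fintype κ]
    (hA' : A' ≤ incidence k hR') (ψ : A ≃ₐ[k] A') {e : κ → A}
    (he : CompleteOrthogonalIdempotents e) (hne : ∀ c, e c ≠ 0) :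
    ∃ ρ : ι → κ, Function.Surjective ρ ∧ (∀ v, (ψ (e (ρ v)) : Matrix ι ι k) v v = 1) ∧
      ∀ v c, (ψ (e c) : Matrix ι ι k) v v ≠ 0 → ρ v = c := by
  have h1 := he.map ((A'.val.comp (ψ : A →ₐ[k] A') : A →ₐ[k] Matrix ι ι k) : A →+* Matrix ι ι k)
  refine exists_partition (hR := hR') (g := fun c => (ψ (e c) : Matrix ι ι k)) h1
    (fun c => hA' (ψ (e c)).2) fun c h => hne c ?_
  exact ψ.injective (Subtype.ext (by simpa using h))

/-- The diagonal matrix units of an incidence algebra. -/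
def diagUnit (k : Type*) [Field k] (hR : IsOrderRel R) (x : ι) : incidence k hR :=
  ⟨Matrix.single x x 1, single_mem_incidence hR (hR.refl x) 1⟩

theorem diagUnit_ne_zero (x : ι) : diagUnit k hR x ≠ 0 := fun h => by
  have := congrFun (congrFun (congrArg Subtype.val h) x) x
  simp [diagUnit] at this

theorem completeOrthogonalIdempotents_diagUnit :
    CompleteOrthogonalIdempotents (diagUnit (k := k) hR) where
  idem x := Subtype.ext (by simp [diagUnit])
  ortho x y h := Subtype.ext (by
    simp [diagUnit, Matrix.single_mul_single_of_ne _ _ _ _ h])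
  complete := Subtype.ext (by
    simp only [diagUnit, AddSubmonoidClass.coe_finsetSum, OneMemClass.coe_one]
    ext x y
    rw [Matrix.sum_apply]
    by_cases h : x = y
    · subst h
      rw [Finset.sum_eq_single x] <;> simp +contextual
    · rw [Matrix.one_apply_ne h]
      refine Finset.sum_eq_zero fun z _ => Matrix.single_apply_of_ne _ _ _ _ _ ?_
      rintro ⟨rfl, rfl⟩
      exact h rfl)

/-- There are as many diagonal units as positions, so the partition is a bijection `ρ`. If `ρ v` and
`ρ w` were unrelated, the corner of the source algebra between their units would vanish, yet it
contains an element whose image has entry one at `(v, w)`. -/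
theorem exists_perm_of_algEquiv (ψ : incidence k hR ≃ₐ[k] incidence k hR') :
    ∃ ρ : Equiv.Perm ι, ∀ v w, R' v w → R (ρ v) (ρ w) := by
  obtain ⟨ρ, hs, h1, -⟩ := exists_partition_of_algEquiv le_rfl ψ
    (completeOrthogonalIdempotents_diagUnit (k := k) (hR := hR)) diagUnit_ne_zero
  refine ⟨Equiv.ofBijective ρ (Finite.surjective_iff_bijective.1 hs), fun v w hvw => ?_⟩
  by_contra hn
  change ¬ R (ρ v) (ρ w) at hn
  let N : incidence k hR' := ⟨Matrix.single v w 1, single_mem_incidence hR' hvw 1⟩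
  have h2 : diagUnit k hR (ρ v) * ψ.symm N * diagUnit k hR (ρ w) = 0 := Subtype.ext <| by
    change Matrix.single (ρ v) (ρ v) 1 * (ψ.symm N : Matrix ι ι k) * Matrix.single (ρ w) (ρ w) 1 = 0
    rw [Matrix.single_mul_mul_single, (ψ.symm N).2 _ _ hn]
    simp
  have h3 := congrArg (fun M => (ψ M : Matrix ι ι k) v w) h2
  simp only [map_mul, AlgEquiv.apply_symm_apply, map_zero, ZeroMemClass.coe_zero,
    Matrix.zero_apply, MulMemClass.coe_mul] at h3
  have h4 : ((ψ (diagUnit k hR (ρ v)) : Matrix ι ι k) * (Matrix.single v w 1 : Matrix ι ι k) *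
      (ψ (diagUnit k hR (ρ w)) : Matrix ι ι k) : Matrix ι ι k) v w = 1 := by
    rw [Matrix.mul_apply, Finset.sum_eq_single w]
    · rw [Matrix.mul_single_apply_same, h1, h1]
      simp
    · intro z _ hz
      rw [Matrix.mul_single_apply_of_ne _ _ _ _ _ hz, zero_mul]
    · simp
  exact one_ne_zero (h4.symm.trans h3)

/-- Isomorphic incidence algebras come from isomorphic orders. -/
theorem exists_orderIso_of_algEquiv (ψ : incidence k hR ≃ₐ[k] incidence k hR') :
    ∃ σ : Equiv.Perm ι, ∀ x y, R x y ↔ R' (σ x) (σ y) := by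
  classical
  obtain ⟨ρ, hρ⟩ := exists_perm_of_algEquiv ψ
  obtain ⟨σ, hσ⟩ := exists_perm_of_algEquiv ψ.symm
  refine ⟨σ, fun x y => ⟨hσ x y, fun h => ?_⟩⟩
  -- The permutations from `ψ` and `ψ.symm` are not known to be inverse to each other. Injections
  -- both ways between the finite sets of related pairs make `f` bijective, which gives the converse
  -- implication.
  let f : {p : ι × ι // R p.1 p.2} → {p : ι × ι // R' p.1 p.2} := fun p => ⟨(σ p.1.1, σ p.1.2), hσ _ _ p.2⟩
  let g : {p : ι × ι // R' p.1 p.2} → {p : ι × ι // R p.1 p.2} := fun p => ⟨(ρ p.1.1, ρ p.1.2), hρ _ _ p.2⟩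
  have hf : Function.Injective f := fun p q h => by
    have := congrArg Subtype.val h
    simp only [f, Prod.mk.injEq, EmbeddingLike.apply_eq_iff_eq] at this
    exact Subtype.ext (Prod.ext this.1 this.2)
  have hg : Function.Injective g := fun p q h => by
    have := congrArg Subtype.val h
    simp only [g, Prod.mk.injEq, EmbeddingLike.apply_eq_iff_eq] at this
    exact Subtype.ext (Prod.ext this.1 this.2)
  have hcard := le_antisymm (Fintype.card_le_of_injective f hf) (Fintype.card_le_of_injective g hg)
  obtain ⟨⟨p, hp⟩, hpq⟩ := ((Fintype.bijective_iff_injective_and_card f).2 ⟨hf, hcard⟩).2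
    ⟨(σ x, σ y), h⟩
  have := congrArg Subtype.val hpq
  simp only [f, Prod.mk.injEq, EmbeddingLike.apply_eq_iff_eq] at this
  rw [← this.1, ← this.2]
  exact hp

/-- The images of the diagonal units would put every position in a class of its own, but elements of
a glued algebra cannot distinguish `i` from `j`. -/
theorem isEmpty_algEquiv_glueSubalgebra {i j : ι} (hij : i ≠ j) :
    IsEmpty (incidence k hR ≃ₐ[k] glueSubalgebra k hR' i j) := ⟨fun ψ => by
  obtain ⟨ρ, hs, h1, h2⟩ := exists_partition_of_algEquiv (hR' := hR')
    (glueSubalgebra_lt hij).le ψ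
    (completeOrthogonalIdempotents_diagUnit (k := k) (hR := hR)) diagUnit_ne_zero
  refine hij ((Finite.injective_iff_surjective.2 hs) (h2 j (ρ i) ?_).symm)
  rw [← (ψ (diagUnit k hR (ρ i))).2.2, h1]
  exact one_ne_zero⟩

/-- The idempotents of a glued algebra belonging to its vertices. -/
def glueUnit (k : Type*) [Field k] (hR : IsOrderRel R) (i j : ι) (c : {x : ι // x ≠ j}) :
    glueSubalgebra k hR i j :=
  ⟨Matrix.diagonal fun x => if (if x = j then i else x) = c then 1 else 0,
    diagonal_mem_incidence hR _, by
      rw [Matrix.diagonal_apply_eq, Matrix.diagonal_apply_eq, if_pos (rfl : j = j)]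
      by_cases h : i = j <;> simp [h]⟩

theorem glueUnit_ne_zero {i j : ι} (c : {x : ι // x ≠ j}) : glueUnit k hR i j c ≠ 0 := fun h => by
  have := congrFun (congrFun (congrArg Subtype.val h) c.1) c.1
  simp [glueUnit, c.2] at this

theorem completeOrthogonalIdempotents_glueUnit {i j : ι} (hij : i ≠ j) :
    CompleteOrthogonalIdempotents (glueUnit k hR i j) where
  idem x := Subtype.ext (by simp [glueUnit])
  ortho x y h := Subtype.ext (by
    refine (Matrix.diagonal_mul_diagonal _ _).trans (Matrix.diagonal_eq_zero.2 ?_)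
    ext z
    have : (x : ι) ≠ y := fun e => h (Subtype.ext e)
    simp only [mul_ite, mul_one, mul_zero, Pi.zero_apply]
    grind)
  complete := Subtype.ext (by
    simp only [glueUnit, AddSubmonoidClass.coe_finsetSum, OneMemClass.coe_one]
    ext x y
    rw [Matrix.sum_apply]
    by_cases h : x = y
    · subst h
      simp only [Matrix.diagonal_apply_eq, Matrix.one_apply_eq]
      have hx : (if x = j then i else x) ≠ j := by split_ifs <;> assumption
      rw [Finset.sum_eq_single ⟨_, hx⟩]
      · simp
      · intro c _ hc
        rw [if_neg fun e => hc (Subtype.ext e.symm)]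
      · simp
    · rw [Matrix.one_apply_ne h]
      exact Finset.sum_eq_zero fun z _ => Matrix.diagonal_apply_ne _ h)

end IncidenceIsomorphisms

/-! ### Isomorphisms of glued algebras and their quivers -/

section GluedAlgebraIsomorphisms

variable {k : Type*} [Field k] {ι : Type*} [Fintype ι] [DecidableEq ι]
  {R : ι → ι → Prop} {hR : IsOrderRel R}

/-- An isomorphism of glued algebras matches the glued vertices. -/
theorem exists_vertexPerm_of_algEquiv {i j i' j' : ι} (hij : i ≠ j) (hij' : i' ≠ j')
    (ψ : glueSubalgebra k hR i j ≃ₐ[k] glueSubalgebra k hR i' j') :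
    ∃ σ : Equiv.Perm ι, σ j = j' ∧ ∀ c v,
      (ψ (glueUnit k hR i j c) : Matrix ι ι k) v v ≠ 0 → (if v = j' then i' else v) = σ c := by
  obtain ⟨ρ, hs, h1, h2⟩ := exists_partition_of_algEquiv (hR' := hR)
    (glueSubalgebra_lt hij').le ψ (completeOrthogonalIdempotents_glueUnit hij) glueUnit_ne_zero
  have hρ : ρ j' = ρ i' := h2 j' (ρ i') <| by
    rw [← (ψ (glueUnit k hR i j (ρ i'))).2.2, h1]
    exact one_ne_zero
  -- The merged vertex occupies the positions `i'` and `j'`. It is represented by `i'`, and the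
  -- spare position `j'` is sent to the spare label `j`, which makes a permutation of all of `ι`.
  let π : ι → ι := fun x => if x = j' then j else ρ x
  have hπ : Function.Surjective π := fun x => by
    by_cases hx : x = j
    · exact ⟨j', by simp [π, hx]⟩
    · obtain ⟨v, hv⟩ := hs ⟨x, hx⟩
      by_cases hvj : v = j'
      · refine ⟨i', ?_⟩
        simp only [π, if_neg hij']
        rw [← hρ, ← hvj, hv]
      · refine ⟨v, ?_⟩
        simp only [π, if_neg hvj]
        rw [hv]
  let e := Equiv.ofBijective π (Finite.surjective_iff_bijective.1 hπ)
  refine ⟨e.symm, e.symm_apply_eq.2 (by simp [e, π]), fun c v hv => ?_⟩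
  rw [Equiv.eq_symm_apply, ← h2 v c hv]
  change π _ = _
  by_cases hvj : v = j'
  · simp only [π, if_pos hvj, if_neg hij']
    rw [hvj, hρ]
  · simp only [π, if_neg hvj]

variable {T : Type*} {s d : T → ι}

/-- The arrows `t`, from `s t` to `d t`, are the covering pairs of the order. -/
structure IsHasse (R : ι → ι → Prop) (s d : T → ι) : Prop where
  rel : ∀ t, R (s t) (d t)
  ne : ∀ t, s t ≠ d t
  cover : ∀ t z, R (s t) z → R z (d t) → z = s t ∨ z = d t
  inj : ∀ t t', s t = s t' → d t = d t' → t = t'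
  exists_of_rel : ∀ x y, R x y → x ≠ y →
    (∃ t, s t = x ∧ d t = y) ∨ ∃ z, z ≠ x ∧ z ≠ y ∧ R x z ∧ R z y

theorem single_mem_glueSubalgebra (i j : ι) {x y : ι} (hxy : R x y) (hne : x ≠ y)
    (c : k) : Matrix.single x y c ∈ glueSubalgebra k hR i j := by
  refine ⟨single_mem_incidence hR hxy c, ?_⟩
  rw [Matrix.single_apply_of_ne _ _ _ _ _ fun e => hne (e.1.trans e.2.symm),
    Matrix.single_apply_of_ne _ _ _ _ _ fun e => hne (e.1.trans e.2.symm)]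

theorem glueSubalgebra_diag_eq_zero {i j i' j' : ι}
    (ψ : glueSubalgebra k hR i j ≃ₐ[k] glueSubalgebra k hR i' j') {M : glueSubalgebra k hR i j}
    (hM : ∀ x, (M : Matrix ι ι k) x x = 0) (x : ι) : (ψ M : Matrix ι ι k) x x = 0 := by
  obtain ⟨m, hm⟩ := (isNilpotent_iff_diag M.2.1).2 hM
  refine (isNilpotent_iff_diag (ψ M).2.1).1 ⟨m, ?_⟩ x
  have : M ^ m = 0 := Subtype.ext (by simpa using hm)
  rw [← SubmonoidClass.coe_pow, ← map_pow, this, map_zero, ZeroMemClass.coe_zero]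

/-- An isomorphism of glued algebras preserves the square of the radical. -/
theorem IsHasse.apply_edge_eq_zero (h : IsHasse R s d) {i j i' j' : ι}
    (ψ : glueSubalgebra k hR i j ≃ₐ[k] glueSubalgebra k hR i' j') {M : glueSubalgebra k hR i j}
    (hM : ∀ x, (M : Matrix ι ι k) x x = 0) (hM' : ∀ t, (M : Matrix ι ι k) (s t) (d t) = 0) (t : T) :
    (ψ M : Matrix ι ι k) (s t) (d t) = 0 := by
  classical
  let L : glueSubalgebra k hR i j →ₗ[k] k :=
    { toFun := fun N => (ψ N : Matrix ι ι k) (s t) (d t)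
      map_add' := fun N N' => by simp
      map_smul' := fun c N => by simp }
  have key : ∀ x y (c : k) (hxy : R x y) (hne : x ≠ y), c = 0 ∨ (∀ t, ¬ (s t = x ∧ d t = y)) →
      L ⟨Matrix.single x y c, single_mem_glueSubalgebra i j hxy hne c⟩ = 0 := by
    intro x y c hxy hne hc
    rcases hc with rfl | hc
    · convert L.map_zero
      simp
    -- A matrix unit at a non-covering pair is a product of two radical elements. Radical elements
    -- stay radical under `ψ`, and a product of two of them vanishes at covering pairs.
    obtain ⟨z, hzx, hzy, hxz, hzy'⟩ := (h.exists_of_rel x y hxy hne).resolve_left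
      fun ⟨t, ht⟩ => hc t ht
    have h1 : (⟨Matrix.single x y c, single_mem_glueSubalgebra i j hxy hne c⟩ : glueSubalgebra k hR i j) =
        ⟨Matrix.single x z c, single_mem_glueSubalgebra i j hxz hzx.symm c⟩ *
          ⟨Matrix.single z y 1, single_mem_glueSubalgebra i j hzy' hzy 1⟩ := Subtype.ext (by simp)
    change (ψ _ : Matrix ι ι k) (s t) (d t) = 0
    rw [h1, map_mul, MulMemClass.coe_mul, mul_apply_of_cover (hR := hR) (ψ _).2.1 (ψ _).2.1 (h.ne t)
      (h.cover t), glueSubalgebra_diag_eq_zero ψ fun w => ?_,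
      glueSubalgebra_diag_eq_zero ψ fun w => ?_]
    · simp
    · exact Matrix.single_apply_of_ne _ _ _ _ _ fun e => hzy (e.1.trans e.2.symm)
    · exact Matrix.single_apply_of_ne _ _ _ _ _ fun e => hzx (e.2.trans e.1.symm)
  have hsum : M = ∑ x, ∑ y, (if hxy : R x y ∧ x ≠ y then
      ⟨Matrix.single x y ((M : Matrix ι ι k) x y), single_mem_glueSubalgebra i j hxy.1 hxy.2 _⟩ else
        0 : glueSubalgebra k hR i j) := by
    apply Subtype.ext
    simp only [AddSubmonoidClass.coe_finsetSum]
    nth_rewrite 1 [Matrix.matrix_eq_sum_single (M : Matrix ι ι k)]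
    refine Finset.sum_congr rfl fun x _ => Finset.sum_congr rfl fun y _ => ?_
    split_ifs with hxy
    · rfl
    · have : (M : Matrix ι ι k) x y = 0 := by
        by_cases e : x = y
        · rw [e, hM]
        · exact M.2.1 x y fun e' => hxy ⟨e', e⟩
      rw [this, Matrix.single_zero, ZeroMemClass.coe_zero]
  change L M = 0
  rw [hsum, map_sum]
  refine Finset.sum_eq_zero fun x _ => ?_
  rw [map_sum]
  refine Finset.sum_eq_zero fun y _ => ?_
  split_ifs with hxy
  · refine key _ _ _ hxy.1 hxy.2 ?_
    by_cases ht : ∃ t, s t = x ∧ d t = y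
    · obtain ⟨t, rfl, rfl⟩ := ht
      exact Or.inl (hM' t)
    · exact Or.inr fun t e => ht ⟨t, e⟩
  · exact map_zero L

/-- An isomorphism of glued algebras induces an isomorphism of the glued Hasse diagrams. -/
theorem IsHasse.exists_perm_of_algEquiv [Fintype T] [DecidableEq T] (h : IsHasse R s d)
    {i j i' j' : ι} (hij : i ≠ j) (hij' : i' ≠ j')
    (ψ : glueSubalgebra k hR i j ≃ₐ[k] glueSubalgebra k hR i' j') :
    ∃ (σ : Equiv.Perm ι) (τ : Equiv.Perm T), σ j = j' ∧ ∀ t,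
      σ (if s t = j then i else s t) = (if s (τ t) = j' then i' else s (τ t)) ∧
      σ (if d t = j then i else d t) = (if d (τ t) = j' then i' else d (τ t)) := by
  obtain ⟨σ, hσ, hvert⟩ := exists_vertexPerm_of_algEquiv hij hij' ψ
  let E : T → glueSubalgebra k hR i j := fun t =>
    ⟨Matrix.single (s t) (d t) 1, single_mem_glueSubalgebra i j (h.rel t) (h.ne t) 1⟩
  have hE : ∀ t x, (E t : Matrix ι ι k) x x = 0 := fun t x =>
    Matrix.single_apply_of_ne _ _ _ _ _ fun e => h.ne t (e.1.trans e.2.symm)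
  -- This is the matrix of `ψ` on the radical modulo its square, in the basis of arrows. A vector
  -- killed by it would give a combination of arrows mapped into the squared radical, which `ψ.symm`
  -- brings back to zero.
  let Λ : Matrix T T k := Matrix.of fun t' t => (ψ (E t) : Matrix ι ι k) (s t') (d t')
  have hdet : Λ.det ≠ 0 := by
    intro h0
    obtain ⟨a, ha, h1⟩ := Matrix.exists_mulVec_eq_zero_iff.2 h0
    apply ha
    let N := ∑ t, a t • E t
    have hNd : ∀ x, (N : Matrix ι ι k) x x = 0 := fun x => by
      simp [N, Matrix.sum_apply, hE]
    have hN : ∀ t, (N : Matrix ι ι k) (s t) (d t) = a t := fun t => by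
      simp only [N, AddSubmonoidClass.coe_finsetSum, Matrix.sum_apply]
      rw [Finset.sum_eq_single t]
      · simp [E]
      · intro t' _ ht'
        have : (E t' : Matrix ι ι k) (s t) (d t) = 0 :=
          Matrix.single_apply_of_ne _ _ _ _ _ fun e => ht' (h.inj _ _ e.1 e.2)
        simp [this]
      · simp
    have hψN : ∀ t, (ψ N : Matrix ι ι k) (s t) (d t) = 0 := fun t => by
      have := congrFun h1 t
      simp only [Matrix.mulVec, dotProduct, Λ, Matrix.of_apply, Pi.zero_apply] at this
      rw [← this]
      simp [N, Matrix.sum_apply, mul_comm]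
    ext t
    rw [← hN t]
    have := h.apply_edge_eq_zero ψ.symm (glueSubalgebra_diag_eq_zero ψ hNd) hψN t
    rwa [ψ.symm_apply_apply] at this
  rw [Matrix.det_apply] at hdet
  -- A nonzero determinant has a nonzero term; its permutation matches arrow `t` with an arrow `τ t`
  -- that occurs in the image of `E t`.
  obtain ⟨τ, -, hτ⟩ := Finset.exists_ne_zero_of_sum_ne_zero hdet
  have hτ' : ∀ t, Λ (τ t) t ≠ 0 := fun t ht =>
    hτ (by
      rw [Finset.prod_eq_zero (f := fun i => Λ (τ i) i) (Finset.mem_univ t) ht, smul_zero])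
  refine ⟨σ, τ, hσ, fun t => ?_⟩
  have hmerge : ∀ x, (if x = j then i else x) ≠ j := fun x => by split_ifs <;> assumption
  -- The vertex idempotents absorbed by `E t` on either side must have images that do not vanish at
  -- the ends of `τ t`, so the ends of the arrows correspond.
  have hl : E t = glueUnit k hR i j ⟨_, hmerge (s t)⟩ * E t := Subtype.ext <| by
    simp only [glueUnit, MulMemClass.coe_mul, E]
    ext x y
    rw [Matrix.diagonal_mul]
    by_cases e : s t = x
    · simp [e]
    · rw [Matrix.single_apply_of_ne _ _ _ _ _ fun e' => e e'.1, mul_zero]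
  have hr : E t = E t * glueUnit k hR i j ⟨_, hmerge (d t)⟩ := Subtype.ext <| by
    simp only [glueUnit, MulMemClass.coe_mul, E]
    ext x y
    rw [Matrix.mul_diagonal]
    by_cases e : d t = y
    · simp [e]
    · rw [Matrix.single_apply_of_ne _ _ _ _ _ fun e' => e e'.2, zero_mul]
  have hψ0 := glueSubalgebra_diag_eq_zero ψ (hE t)
  have hne : (ψ (E t) : Matrix ι ι k) (s (τ t)) (d (τ t)) ≠ 0 := hτ' t
  constructor
  · refine (hvert ⟨_, hmerge (s t)⟩ (s (τ t)) fun h0 => hne ?_).symm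
    rw [hl, map_mul, MulMemClass.coe_mul, mul_apply_of_cover (hR := hR) (ψ _).2.1 (ψ _).2.1
      (h.ne (τ t)) (h.cover (τ t)), h0, hψ0, zero_mul, mul_zero, add_zero]
  · refine (hvert ⟨_, hmerge (d t)⟩ (d (τ t)) fun h0 => hne ?_).symm
    rw [hr, map_mul, MulMemClass.coe_mul, mul_apply_of_cover (hR := hR) (ψ _).2.1 (ψ _).2.1
      (h.ne (τ t)) (h.cover (τ t)), h0, hψ0, zero_mul, mul_zero, add_zero]

end GluedAlgebraIsomorphisms

/-! ### Transport of subalgebras along automorphisms -/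

section Transport

variable {k : Type*} [Field k] {B : Type*} [Ring B] [Algebra k B]

/-- The subalgebra `A` is carried to `A'` by an automorphism preserving `T`. -/
def AutConj (T A A' : Subalgebra k B) : Prop :=
  ∃ φ : B ≃ₐ[k] B, T.map (φ : B →ₐ[k] B) = T ∧ A.map (φ : B →ₐ[k] B) = A'

variable {T A A' A'' : Subalgebra k B}

theorem AutConj.refl (T A : Subalgebra k B) : AutConj T A A :=
  ⟨AlgEquiv.refl, Subalgebra.map_id T, Subalgebra.map_id A⟩

theorem map_algEquiv_symm {φ : B ≃ₐ[k] B} (h : A.map (φ : B →ₐ[k] B) = A') :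
    A'.map (φ.symm : B →ₐ[k] B) = A := by
  rw [← h, Subalgebra.map_map, AlgEquiv.symm_comp, Subalgebra.map_id]

theorem AutConj.symm (h : AutConj T A A') : AutConj T A' A := by
  obtain ⟨φ, h1, h2⟩ := h
  exact ⟨φ.symm, map_algEquiv_symm h1, map_algEquiv_symm h2⟩

theorem AutConj.trans (h : AutConj T A A') (h' : AutConj T A' A'') : AutConj T A A'' := by
  obtain ⟨φ, h1, h2⟩ := h
  obtain ⟨φ', h1', h2'⟩ := h'
  have hc : ∀ C : Subalgebra k B, C.map (φ.trans φ' : B →ₐ[k] B) =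
      (C.map (φ : B →ₐ[k] B)).map (φ' : B →ₐ[k] B) := fun C =>
    (Subalgebra.map_map C (φ' : B →ₐ[k] B) (φ : B →ₐ[k] B)).symm
  exact ⟨φ.trans φ', by rw [hc, h1, h1'], by rw [hc, h2, h2']⟩

theorem AutConj.algEquiv (h : AutConj T A A') : Nonempty (A ≃ₐ[k] A') := by
  obtain ⟨φ, -, rfl⟩ := h
  exact ⟨φ.subalgebraMap A⟩

/-- The only central idempotents are zero and one. -/
def HasTrivialCentralIdempotents (A : Type*) [Ring A] : Prop :=
  ∀ z : A, IsIdempotentElem z → (∀ a, z * a = a * z) → z = 0 ∨ z = 1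

theorem HasTrivialCentralIdempotents.of_ringEquiv {A A' : Type*} [Ring A] [Ring A']
    (h : HasTrivialCentralIdempotents A) (e : A ≃+* A') : HasTrivialCentralIdempotents A' := by
  intro z hz hc
  refine (h (e.symm z) (hz.map e.symm) fun a => ?_).imp (fun h => ?_) fun h => ?_
  · apply e.injective
    simp [hc]
  · simpa using h
  · simpa using h

end Transport

/-! ### Algebra automorphisms induced by order automorphisms -/

section Reflection

variable {k : Type*} [Field k] {ι : Type*} [Fintype ι] [DecidableEq ι] {R S : ι → ι → Prop}
  {hR : IsOrderRel R} {hS : IsOrderRel S}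

theorem map_reindex_incidence {e : Equiv.Perm ι} (h : ∀ x y, R x y ↔ S (e x) (e y)) :
    (incidence k hR).map (Matrix.reindexAlgEquiv k k e : Matrix ι ι k →ₐ[k] _) =
      incidence k hS := by
  ext M
  constructor
  · rintro ⟨N, hN, rfl⟩ x y hxy
    refine hN _ _ fun h1 => hxy ?_
    simpa using (h _ _).1 h1
  · refine fun hM => ⟨(Matrix.reindexAlgEquiv k k e).symm M, fun x y hxy => ?_,
      (Matrix.reindexAlgEquiv k k e).apply_symm_apply M⟩
    exact hM _ _ fun h1 => hxy ((h _ _).2 (by simpa using h1))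

theorem map_reindex_glueSubalgebra {e : Equiv.Perm ι} (h : ∀ x y, R x y ↔ R (e x) (e y))
    (i j : ι) :
    (glueSubalgebra k hR i j).map (Matrix.reindexAlgEquiv k k e : Matrix ι ι k →ₐ[k] _) =
      glueSubalgebra k hR (e i) (e j) := by
  have hm := map_reindex_incidence (k := k) (hR := hR) (hS := hR) h
  have hd : ∀ (N : Matrix ι ι k) x, Matrix.reindexAlgEquiv k k e N (e x) (e x) = N x x := by simp
  ext M
  constructor
  · rintro ⟨N, hN, rfl⟩
    exact ⟨hm.le ⟨N, hN.1, rfl⟩, (hd N i).trans (hN.2.trans (hd N j).symm)⟩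
  · intro hM
    obtain ⟨N, hN, rfl⟩ := hm.ge hM.1
    exact ⟨N, ⟨hN, (hd N i).symm.trans (hM.2.trans (hd N j))⟩, rfl⟩

theorem glueSubalgebra_comm (i j : ι) : glueSubalgebra k hR i j = glueSubalgebra k hR j i := by
  ext M
  exact ⟨fun h => ⟨h.1, h.2.symm⟩, fun h => ⟨h.1, h.2.symm⟩⟩

end Reflection

/-! ### Conjugacy of isomorphic maximal subalgebras of the line algebra -/

section LineAlgebra

variable {k : Type*} [Field k] {n : ℕ} {o : ℕ → Bool}

/-- Reflection exchanges left and right, and the antisymmetry of the word makes up for it, so it is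
an automorphism of the order. -/
theorem lineRel_rev (ho : ∀ t < n, o (n - 1 - t) = !o t) (x y : Fin (n + 1)) :
    LineRel o x y ↔ LineRel o (Fin.revPerm x : Fin (n + 1)) (Fin.revPerm y : Fin (n + 1)) := by
  have key : ∀ x y : Fin (n + 1), LineRel o x y → LineRel o x.rev y.rev := by
    intro x y h
    rw [LineRel, Fin.val_rev, Fin.val_rev]
    constructor
    · intro t h1 h2
      have := h.2 (n - 1 - t) (by omega) (by omega)
      rw [ho t (by omega)] at this
      simpa using this
    · intro t h1 h2
      have := h.1 (n - 1 - t) (by omega) (by omega)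
      rw [ho t (by omega)] at this
      simpa using this
  refine ⟨key x y, fun h => ?_⟩
  have := key _ _ h
  simpa using this

theorem cutRel_rev (ho : ∀ t < n, o (n - 1 - t) = !o t) {i : ℕ} (hi : i < n) (x y : Fin (n + 1)) :
    CutRel o i x y ↔
      CutRel o (n - 1 - i) (Fin.revPerm x : Fin (n + 1)) (Fin.revPerm y : Fin (n + 1)) := by
  rw [CutRel, CutRel, ← lineRel_rev ho, Fin.revPerm_apply, Fin.revPerm_apply, Fin.val_rev,
    Fin.val_rev]
  refine and_congr_right fun _ => ?_
  omega

theorem autConj_cutAlgebra {i i' : ℕ} (hi : i < n)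
    (h : i = i' ∨ (i' = n - 1 - i ∧ ∀ t < n, o (n - 1 - t) = !o t)) :
    AutConj (lineAlgebra k n o) (cutAlgebra k n o i) (cutAlgebra k n o i') := by
  rcases h with rfl | ⟨rfl, ho⟩
  · exact AutConj.refl _ _
  · exact ⟨Matrix.reindexAlgEquiv k k Fin.revPerm, map_reindex_incidence (lineRel_rev ho),
      map_reindex_incidence (cutRel_rev ho hi)⟩

theorem isHasse_line (n : ℕ) (o : ℕ → Bool) :
    IsHasse (fun x y : Fin (n + 1) => LineRel o x y)
      (fun t : Fin n => ⟨edgeSource o t, by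
        have := t.2; cases h : o t <;> simp [edgeSource, h]⟩)
      (fun t : Fin n => ⟨edgeTarget o t, by
        have := t.2; cases h : o t <;> simp [edgeTarget, h]⟩) where
  rel t := edge_rel o t
  ne t h1 := by
    have h2 := congrArg Fin.val h1
    cases h : o t <;> simp [edgeSource, edgeTarget, h] at h2
  cover t z h1 h2 := by
    have h3 := h1.between h2
    simp only [Fin.ext_iff]
    cases h : o t <;> simp only [edgeSource, edgeTarget, h, cond_true, cond_false] at h3 ⊢ <;> omega
  inj t t' h1 h2 := by
    simp only [Fin.ext_iff] at h1 h2 ⊢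
    cases h : o t <;> cases h' : o t' <;>
      simp only [edgeSource, edgeTarget, h, h', cond_true, cond_false] at h1 h2 <;> omega
  exists_of_rel x y hxy hne := by
    have hne' : (x : ℕ) ≠ y := fun h => hne (Fin.ext h)
    rcases lt_or_gt_of_ne hne' with hlt | hlt
    · by_cases hs : (x : ℕ) + 1 = y
      · have ht : o x = true := hxy.1 x le_rfl hlt
        refine Or.inl ⟨⟨x, by omega⟩, Fin.ext ?_, Fin.ext ?_⟩ <;>
          simp [edgeSource, edgeTarget, ht, hs]
      · refine Or.inr ⟨⟨x + 1, by omega⟩, fun h => ?_, fun h => ?_, ⟨fun t _ _ => ?_, fun t _ _ => ?_⟩,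
          ⟨fun t _ _ => ?_, fun t _ _ => ?_⟩⟩ <;> simp only [Fin.ext_iff] at *
        · omega
        · omega
        · exact hxy.1 t (by omega) (by omega)
        · omega
        · exact hxy.1 t (by omega) (by omega)
        · omega
    · by_cases hs : (y : ℕ) + 1 = x
      · have ht : o y = false := hxy.2 y le_rfl hlt
        refine Or.inl ⟨⟨y, by omega⟩, Fin.ext ?_, Fin.ext ?_⟩ <;>
          simp [edgeSource, edgeTarget, ht, hs]
      · refine Or.inr ⟨⟨y + 1, by omega⟩, fun h => ?_, fun h => ?_, ⟨fun t _ _ => ?_, fun t _ _ => ?_⟩,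
          ⟨fun t _ _ => ?_, fun t _ _ => ?_⟩⟩ <;> simp only [Fin.ext_iff] at *
        · omega
        · omega
        · omega
        · exact hxy.2 t (by omega) (by omega)
        · omega
        · exact hxy.2 t (by omega) (by omega)

theorem autConj_glueSubalgebra {i j i' j' : Fin (n + 1)} (hij : i < j) (hij' : i' < j')
    (ψ : glueSubalgebra k (isOrderRel_line n o) i j ≃ₐ[k]
      glueSubalgebra k (isOrderRel_line n o) i' j') :
    AutConj (lineAlgebra k n o) (glueSubalgebra k (isOrderRel_line n o) i j)
      (glueSubalgebra k (isOrderRel_line n o) i' j') := by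
  obtain ⟨σ, τ, hσ, hτ⟩ := (isHasse_line n o).exists_perm_of_algEquiv hij.ne hij'.ne ψ
  have hmerge : ∀ a b x : Fin (n + 1), ((if x = b then a else x : Fin (n + 1)) : ℕ) =
      mergeVertex a b x := fun a b x => by
    simp only [mergeVertex, Fin.ext_iff]
    split_ifs <;> rfl
  have hG : GlueIso n o i j i' j' (natPerm σ) (natPerm τ) :=
    { lt := hij
      le := by omega
      lt' := hij'
      le' := by omega
      map_right := by rw [natPerm_val, hσ]
      map_le := fun x => by
        have := natPerm_lt_iff σ (x := x); omega
      map_lt := fun t => natPerm_lt_iff τ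
      source := fun t ht => by
        have := congrArg Fin.val (hτ ⟨t, ht⟩).1
        rw [← natPerm_val, hmerge, hmerge] at this
        rw [show natPerm τ t = τ ⟨t, ht⟩ from natPerm_val τ ⟨t, ht⟩]
        exact this
      target := fun t ht => by
        have := congrArg Fin.val (hτ ⟨t, ht⟩).2
        rw [← natPerm_val, hmerge, hmerge] at this
        rw [show natPerm τ t = τ ⟨t, ht⟩ from natPerm_val τ ⟨t, ht⟩]
        exact this }
  rcases hG.rigid with ⟨h1, h2⟩ | ⟨h1, h2, ho⟩
  · rw [Fin.ext h1, Fin.ext h2]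
    exact AutConj.refl _ _
  · refine ⟨Matrix.reindexAlgEquiv k k Fin.revPerm, map_reindex_incidence (lineRel_rev ho), ?_⟩
    rw [map_reindex_glueSubalgebra (lineRel_rev ho), glueSubalgebra_comm]
    congr 1 <;> apply Fin.ext <;> simp only [Fin.revPerm_apply, Fin.val_rev] <;> omega

/-- Isomorphic connected maximal subalgebras of the path algebra of an oriented line are conjugate
under automorphisms. -/
theorem autConj_of_algEquiv {A A' : Subalgebra k (Matrix (Fin (n + 1)) (Fin (n + 1)) k)}
    (hA : A ⋖ lineAlgebra k n o) (hA' : A' ⋖ lineAlgebra k n o)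
    (hc : HasTrivialCentralIdempotents A) (hc' : HasTrivialCentralIdempotents A')
    (ψ : A ≃ₐ[k] A') : AutConj (lineAlgebra k n o) A A' := by
  -- A cut edge with no neighbouring edge in its direction would give a nontrivial central
  -- idempotent.
  have hcut : ∀ {A : Subalgebra k (Matrix (Fin (n + 1)) (Fin (n + 1)) k)} {i : ℕ}, i < n →
      AutConj (lineAlgebra k n o) (cutAlgebra k n o i) A → HasTrivialCentralIdempotents A →
      ExtendsLeft o i ∨ ExtendsRight n o i := by
    intro A i hi h hA
    by_contra! hn
    obtain ⟨z, hz, hi', hcomm, h0, h1⟩ := exists_central_idempotent (k := k) hi hn.1 hn.2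
    obtain ⟨e⟩ := h.algEquiv
    rcases hA.of_ringEquiv e.symm.toRingEquiv ⟨z, hz⟩ (Subtype.ext hi')
      (fun a => Subtype.ext (hcomm a a.2)) with h | h
    · exact h0 (congrArg Subtype.val h)
    · exact h1 (congrArg Subtype.val h)
  rcases covBy_lineAlgebra hA with ⟨i, j, hij, rfl⟩ | ⟨u, hu, hu', i, hi, hAe⟩
  · rcases covBy_lineAlgebra hA' with ⟨i', j', hij', rfl⟩ | ⟨u', hu, hu', i', hi', hAe'⟩
    · exact autConj_glueSubalgebra hij hij' ψ
    · have h' : AutConj (lineAlgebra k n o) (cutAlgebra k n o i') A' :=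
        ⟨conjEquiv k u', map_conjEquiv_of_mem hu hu', hAe'.symm⟩
      obtain ⟨e'⟩ := h'.algEquiv
      exact (isEmpty_algEquiv_glueSubalgebra hij.ne).elim (e'.trans ψ.symm)
  · have h : AutConj (lineAlgebra k n o) (cutAlgebra k n o i) A :=
      ⟨conjEquiv k u, map_conjEquiv_of_mem hu hu', hAe.symm⟩
    obtain ⟨e⟩ := h.algEquiv
    rcases covBy_lineAlgebra hA' with ⟨i', j', hij', rfl⟩ | ⟨u', hu, hu', i', hi', hAe'⟩
    · exact (isEmpty_algEquiv_glueSubalgebra hij'.ne).elim (e.trans ψ)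
    · have h' : AutConj (lineAlgebra k n o) (cutAlgebra k n o i') A' :=
        ⟨conjEquiv k u', map_conjEquiv_of_mem hu hu', hAe'.symm⟩
      obtain ⟨e'⟩ := h'.algEquiv
      obtain ⟨σ, hσ⟩ := exists_orderIso_of_algEquiv ((e.trans ψ).trans e'.symm)
      exact (h.symm.trans (autConj_cutAlgebra hi
        (cutRel_rigid hσ hi hi' (hcut hi h hc) (hcut hi' h' hc')))).trans h'

end LineAlgebra

/-! ### Connected Ext quivers and central idempotents -/

section ExtQuiver

/-- An algebra with a connected Ext quiver does not decompose as a product. -/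
theorem HasConnectedExtQuiver.hasTrivialCentralIdempotents {k : Type w} {A : Type u} [Field k]
    [Ring A] [Algebra k A] (h : HasConnectedExtQuiver k A) : HasTrivialCentralIdempotents A := by
  obtain ⟨n, e, he, hp, -, hpath⟩ := h
  intro z hz hc
  have hzz : z * z = z := hz
  -- A central idempotent splits each `e i` into two orthogonal idempotents, and primitivity kills
  -- one of them.
  have hdich : ∀ i, z * e i = e i ∨ z * e i = 0 := fun i => by
    obtain ⟨hi, -, hsplit⟩ := hp i
    have hi' : e i * e i = e i := hi
    have hze : z * e i * (z * e i) = z * e i := by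
      rw [mul_assoc, ← mul_assoc (e i), ← hc (e i), mul_assoc z (e i), hi', ← mul_assoc, hzz]
    have h1 : z * e i * e i = z * e i := by rw [mul_assoc, hi']
    have h2 : e i * (z * e i) = z * e i := by rw [← mul_assoc, ← hc, h1]
    rcases hsplit (z * e i) (e i - z * e i) hze
      (by rw [IsIdempotentElem, sub_mul, mul_sub, mul_sub, hi', h2, h1, hze, sub_self, sub_zero])
      (by rw [mul_sub, h1, hze, sub_self]) (by rw [sub_mul, h2, hze, sub_self])
      (by rw [add_sub_cancel]) with h | h
    · exact Or.inr h
    · exact Or.inl (sub_eq_zero.1 h).symm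
  have hzero : ∀ i j, (∀ r, e i * r * e j = 0) → extArrowCount k (e i) (e j) = 0 := fun i j h => by
    have h1 : LinearMap.mulLeftRight k (e i, e j) = 0 := LinearMap.ext fun r => by
      rw [LinearMap.mulLeftRight_apply, h, LinearMap.zero_apply]
    rw [extArrowCount, h1, Submodule.map_zero, Submodule.map_bot]
    exact finrank_bot k _
  have harrow : ∀ i j, Nonempty (Fin (extArrowCount k (e i) (e j))) →
      (z * e i = 0 ↔ z * e j = 0) := by
    rintro i j ⟨f⟩
    have hne : extArrowCount k (e i) (e j) ≠ 0 := by have := f.2; omega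
    by_contra hiff
    refine hne (hzero i j fun r => ?_)
    -- If `z` acts as one at one end and as zero at the other, moving it across shows that the whole
    -- corner vanishes, so there is no arrow. Hence the behaviour of `z` is constant along walks.
    have hmove : z * e i * r * e j = e i * r * (z * e j) := by
      rw [hc (e i), mul_assoc (e i), hc r, mul_assoc, mul_assoc, mul_assoc]
    rcases hdich i with h1 | h1 <;> rcases hdich j with h2 | h2
    · refine absurd ?_ hiff
      rw [h1, h2]
      exact ⟨fun h => absurd h (hp i).2.1, fun h => absurd h (hp j).2.1⟩
    · rwa [h1, h2, mul_zero] at hmove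
    · rw [h1, h2, zero_mul, zero_mul] at hmove
      exact hmove.symm
    · exact absurd (by rw [h1, h2]) hiff
  have hconst : ∀ i j, (z * e i = 0 ↔ z * e j = 0) := by
    intro i j
    obtain ⟨p⟩ := hpath i j
    induction p with
    | nil => rfl
    | cons p f ih =>
      refine ih.trans ?_
      rcases f with f | f
      · exact harrow _ _ ⟨f⟩
      · exact (harrow _ _ ⟨f⟩).symm
  have hz1 : z = ∑ i, z * e i := by rw [← Finset.mul_sum, he.complete, mul_one]
  by_cases h : ∃ i, z * e i = 0
  · obtain ⟨i, hi⟩ := h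
    left
    rw [hz1]
    exact Finset.sum_eq_zero fun j _ => (hconst i j).1 hi
  · push Not at h
    right
    rw [hz1, ← he.complete]
    exact Finset.sum_congr rfl fun i _ => (hdich i).resolve_right (h i)

end ExtQuiver

/-! ### Passing to the image of an injective homomorphism -/

section Embedding

variable {k : Type*} [Field k] {B B' : Type*} [Ring B] [Algebra k B] [Ring B'] [Algebra k B']
  {Φ : B →ₐ[k] B'}

theorem covBy_range_of_isCoatom (hΦ : Function.Injective Φ) {A : Subalgebra k B}
    (hA : IsCoatom A) : A.map Φ ⋖ Φ.range := by
  have htop : (⊤ : Subalgebra k B).map Φ = Φ.range := Algebra.map_top Φ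
  have hmono : StrictMono (Subalgebra.map Φ) :=
    Monotone.strictMono_of_injective (fun _ _ h => Subalgebra.map_mono h)
      (Subalgebra.map_injective hΦ)
  refine ⟨htop ▸ hmono (lt_top_iff_ne_top.2 hA.1), fun C h1 h2 => ?_⟩
  have hC : (C.comap Φ).map Φ = C := by
    ext c
    constructor
    · rintro ⟨b, hb, rfl⟩
      exact hb
    · intro hc
      obtain ⟨b, rfl⟩ := (AlgHom.mem_range Φ).1 (h2.le hc)
      exact ⟨b, hc, rfl⟩
  have h3 : A < C.comap Φ := by
    refine lt_of_le_of_ne (fun a ha => h1.le ⟨a, ha, rfl⟩) fun h => ?_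
    rw [← h] at hC
    exact h1.ne hC
  rw [hA.2 _ h3, htop] at hC
  exact h2.ne hC.symm

/-- `AutConj` demands that the range be preserved precisely so that the ambient automorphism
restricts to it and pulls back to `B`. -/
theorem exists_algEquiv_of_autConj (hΦ : Function.Injective Φ) {A A' : Subalgebra k B}
    (h : AutConj Φ.range (A.map Φ) (A'.map Φ)) :
    ∃ φ : B ≃ₐ[k] B, A.map (φ : B →ₐ[k] B) = A' := by
  obtain ⟨φ, h1, h2⟩ := h
  let θ := AlgEquiv.ofInjective Φ hΦ
  let χ : B ≃ₐ[k] B := (θ.trans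
    ((φ.subalgebraMap Φ.range).trans (Subalgebra.equivOfEq _ _ h1))).trans θ.symm
  have hχ : ∀ b, Φ (χ b) = φ (Φ b) := fun b =>
    congrArg Subtype.val (θ.apply_symm_apply
      ((φ.subalgebraMap Φ.range).trans (Subalgebra.equivOfEq _ _ h1) (θ b)))
  refine ⟨χ, Subalgebra.map_injective hΦ ?_⟩
  rw [← h2, Subalgebra.map_map, Subalgebra.map_map]
  congr 1
  exact AlgHom.ext hχ

end Embedding

/-! ### The path algebra of a type A quiver as a line algebra -/

section PathAlgebra

variable {V : Type u} [Quiver.{v} V] {n : ℕ} {e : V ≃ Fin (n + 1)}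

/-- The direction of the edges of a quiver whose vertices are numbered. -/
noncomputable def orientation (e : V ≃ Fin (n + 1)) (t : ℕ) : Bool :=
  open Classical in decide (∃ a b : V, (e a : ℕ) = t ∧ (e b : ℕ) = t + 1 ∧ Nonempty (a ⟶ b))

theorem orientation_eq_true_iff {t : ℕ} : orientation e t = true ↔
    ∃ a b : V, (e a : ℕ) = t ∧ (e b : ℕ) = t + 1 ∧ Nonempty (a ⟶ b) := by
  classical
  exact decide_eq_true_iff

/-- There is exactly one arrow between consecutive vertices, and there are no other arrows. -/
def IsLineNumbering (e : V ≃ Fin (n + 1)) : Prop :=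
  ∀ a b : V, Subsingleton ((a ⟶ b) ⊕ (b ⟶ a)) ∧ (Nonempty ((a ⟶ b) ⊕ (b ⟶ a)) ↔
    (e a : ℕ) + 1 = (e b : ℕ) ∨ (e b : ℕ) + 1 = (e a : ℕ))

namespace IsLineNumbering

theorem adjacent (h : IsLineNumbering e) {a b : V} (f : a ⟶ b) :
    (e a : ℕ) + 1 = (e b : ℕ) ∨ (e b : ℕ) + 1 = (e a : ℕ) := (h a b).2.1 ⟨Sum.inl f⟩

theorem lineRel_of_hom (h : IsLineNumbering e) {a b : V} (f : a ⟶ b) :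
    LineRel (orientation e) (e a) (e b) := by
  rcases h.adjacent f with h1 | h1
  · rw [← h1, lineRel_succ]
    exact orientation_eq_true_iff.2 ⟨a, b, rfl, h1.symm, ⟨f⟩⟩
  · rw [← h1, lineRel_succ']
    rw [Bool.eq_false_iff, Ne, orientation_eq_true_iff]
    rintro ⟨b', a', hb, ha, ⟨g⟩⟩
    obtain rfl : b' = b := e.injective (Fin.ext hb)
    obtain rfl : a' = a := e.injective (Fin.ext (ha.trans h1))
    have := (h a' b').1
    exact Sum.inl_ne_inr (Subsingleton.elim (Sum.inl f) (Sum.inr g))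

theorem lineRel_of_path (h : IsLineNumbering e) {a b : V} (p : Quiver.Path a b) :
    LineRel (orientation e) (e a) (e b) := by
  induction p with
  | nil => exact LineRel.refl _ _
  | cons p f ih => exact ih.trans (h.lineRel_of_hom f)

/-- The vertex before the last is the neighbour of the end point on the side of the starting point,
by `LineRel.between`, and the arrow from it is unique. Antisymmetry of the path order excludes
cycles. -/
theorem path_subsingleton (h : IsLineNumbering e) {a b : V} (p q : Quiver.Path a b) : p = q := by
  have hcycle : ∀ {a c : V} (_ : Quiver.Path a c) (_ : c ⟶ a), False := fun {a c} p f => by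
    have h1 := (h.lineRel_of_path p).antisymm (h.lineRel_of_hom f)
    have := h.adjacent f
    omega
  induction p with
  | nil =>
    cases q with
    | nil => rfl
    | cons q g => exact (hcycle q g).elim
  | @cons c b p f ih =>
    cases q with
    | nil => exact (hcycle p f).elim
    | @cons c' _ q g =>
      obtain rfl : c = c' := by
        apply e.injective
        apply Fin.ext
        have h1 := (h.lineRel_of_path p).between (h.lineRel_of_hom f)
        have h2 := (h.lineRel_of_path q).between (h.lineRel_of_hom g)
        have h3 := h.adjacent f
        have h4 := h.adjacent g
        omega
      have := (h c b).1
      rw [ih q, Sum.inl_injective (Subsingleton.elim (Sum.inl f : (c ⟶ b) ⊕ (b ⟶ c)) (Sum.inl g))]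

theorem nonempty_path (h : IsLineNumbering e) {x y : Fin (n + 1)}
    (hxy : LineRel (orientation e) x y) : Nonempty (Quiver.Path (e.symm x) (e.symm y)) := by
  refine LineRel.of_edges (S := fun x y => Nonempty (Quiver.Path (e.symm x) (e.symm y)))
    (fun x => ⟨Quiver.Path.nil⟩) (fun x y z ⟨p⟩ ⟨q⟩ => ⟨p.comp q⟩) (fun x y hadj hrel => ?_) hxy
  obtain ⟨f | f⟩ := (h (e.symm x) (e.symm y)).2.2 (by simpa using hadj)
  · exact ⟨f.toPath⟩
  · have h1 := h.lineRel_of_hom f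
    rw [e.apply_symm_apply, e.apply_symm_apply] at h1
    have := h1.antisymm hrel
    omega

variable (k : Type w) [Field k]

/-- The representation of the path algebra of a line by matrices. -/
noncomputable def toMatrixLinear (e : V ≃ Fin (n + 1)) :
    PathAlgebra k V →ₗ[k] Matrix (Fin (n + 1)) (Fin (n + 1)) k :=
  Finsupp.linearCombination k fun p : AllPaths V => Matrix.single (e p.1) (e p.2.1) 1

theorem toMatrixLinear_ofPath {a b : V} (p : Quiver.Path a b) :
    toMatrixLinear k e (PathAlgebra.ofPath k p) = Matrix.single (e a) (e b) 1 :=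
  (Finsupp.linearCombination_single _ _ _).trans (one_smul _ _)

/-- Distinct paths have distinct pairs of end points, so the path basis is sent to distinct matrix
units. -/
theorem toMatrixLinear_injective (h : IsLineNumbering e) :
    Function.Injective (toMatrixLinear k e) := by
  have hinj : Function.Injective fun p : AllPaths V => (e p.1, e p.2.1) := by
    rintro ⟨a, b, p⟩ ⟨a', b', p'⟩ hpp
    simp only [Prod.mk.injEq, EmbeddingLike.apply_eq_iff_eq] at hpp
    obtain ⟨rfl, rfl⟩ := hpp
    rw [h.path_subsingleton p p']
  have hli := (Matrix.stdBasis k (Fin (n + 1)) (Fin (n + 1))).linearIndependent.comp _ hinj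
  have heq : (⇑(Matrix.stdBasis k (Fin (n + 1)) (Fin (n + 1))) ∘
      fun p : AllPaths V => (e p.1, e p.2.1)) = fun p => Matrix.single (e p.1) (e p.2.1) 1 :=
    funext fun p => Matrix.stdBasis_eq_single k _ _
  rw [heq] at hli
  exact hli

theorem toMatrixLinear_mul (x y : PathAlgebra k V) :
    toMatrixLinear k e (x * y) = toMatrixLinear k e x * toMatrixLinear k e y := by
  induction x using PathAlgebra.induction_on with
  | h0 => simp only [zero_mul, map_zero]
  | hadd x x' hx hx' => simp only [add_mul, map_add, hx, hx']
  | @hsmul r a b p =>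
    induction y using PathAlgebra.induction_on with
    | h0 => simp only [mul_zero, map_zero]
    | hadd y y' hy hy' => simp only [mul_add, map_add, hy, hy']
    | @hsmul s c d q =>
      simp only [PathAlgebra.smul_mul, PathAlgebra.mul_smul', map_smul, toMatrixLinear_ofPath,
        smul_mul_assoc, mul_smul_comm]
      congr 2
      by_cases hbc : b = c
      · subst hbc
        rw [PathAlgebra.ofPath_mul_ofPath, toMatrixLinear_ofPath, Matrix.single_mul_single_same,
          mul_one]
      · rw [PathAlgebra.ofPath_mul_ofPath_of_ne k _ _ hbc, map_zero,
          Matrix.single_mul_single_of_ne _ _ _ _ fun h => hbc (e.injective h)]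

/-- The representation of the path algebra of a line by matrices, as an algebra homomorphism. -/
noncomputable def toMatrix [Fintype V] (e : V ≃ Fin (n + 1)) :
    PathAlgebra k V →ₐ[k] Matrix (Fin (n + 1)) (Fin (n + 1)) k :=
  AlgHom.ofLinearMap (toMatrixLinear k e)
    (by
      simp only [PathAlgebra.one_def, map_sum, toMatrixLinear_ofPath]
      rw [Equiv.sum_comp e fun x => Matrix.single x x (1 : k), Matrix.sum_single_one])
    (toMatrixLinear_mul k)

theorem range_toMatrix [Fintype V] (h : IsLineNumbering e) :
    (toMatrix k e).range = lineAlgebra k n (orientation e) := by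
  apply le_antisymm
  · rintro _ ⟨x, rfl⟩
    change toMatrixLinear k e x ∈ _
    induction x using PathAlgebra.induction_on with
    | h0 => rw [map_zero]; exact zero_mem _
    | hadd x y hx hy => rw [map_add]; exact add_mem hx hy
    | hsmul r p =>
      rw [map_smul, toMatrixLinear_ofPath]
      exact Subalgebra.smul_mem _ (single_mem_incidence (isOrderRel_line n _) (h.lineRel_of_path p) 1) r
  · intro M hM
    rw [Matrix.matrix_eq_sum_single M]
    refine sum_mem fun x _ => sum_mem fun y _ => ?_
    by_cases hxy : LineRel (orientation e) x y
    · obtain ⟨p⟩ := h.nonempty_path hxy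
      refine (AlgHom.mem_range _).2 ⟨M x y • PathAlgebra.ofPath k p, ?_⟩
      rw [map_smul]
      change M x y • toMatrixLinear k e _ = _
      rw [toMatrixLinear_ofPath, e.apply_symm_apply, e.apply_symm_apply, Matrix.smul_single,
        smul_eq_mul, mul_one]
    · rw [hM x y hxy, Matrix.single_zero]
      exact zero_mem _

end IsLineNumbering

end PathAlgebra

theorem theorem1p1 {k : Type w} [Field k] [IsAlgClosed k]
    {V : Type u} [Quiver.{v} V] [Fintype V] (hQ : IsDynkinTypeA V)
    (A A' : Subalgebra k (PathAlgebra k V)) (hA : IsCoatom A) (hA' : IsCoatom A')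
    (hAc : HasConnectedExtQuiver k A) (hAc' : HasConnectedExtQuiver k A') :
    (∃ φ : PathAlgebra k V ≃ₐ[k] PathAlgebra k V,
        A.map (φ : PathAlgebra k V →ₐ[k] PathAlgebra k V) = A') ↔
      Nonempty (A ≃ₐ[k] A') := by
  constructor
  · rintro ⟨φ, rfl⟩
    exact ⟨φ.subalgebraMap A⟩
  · rintro ⟨ψ⟩
    obtain ⟨n, e, he⟩ := hQ
    have he : IsLineNumbering e := he
    have hΦ : Function.Injective (IsLineNumbering.toMatrix k e) := he.toMatrixLinear_injective k
    have hr := he.range_toMatrix k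
    have θ := A.equivMapOfInjective _ hΦ
    have θ' := A'.equivMapOfInjective _ hΦ
    refine exists_algEquiv_of_autConj hΦ ?_
    rw [hr]
    exact autConj_of_algEquiv (hr ▸ covBy_range_of_isCoatom hΦ hA)
      (hr ▸ covBy_range_of_isCoatom hΦ hA')
      (hAc.hasTrivialCentralIdempotents.of_ringEquiv θ.toRingEquiv)
      (hAc'.hasTrivialCentralIdempotents.of_ringEquiv θ'.toRingEquiv)
      ((θ.symm.trans ψ).trans θ')
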